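/- Let $H$ be a separable real Hilbert space with inner product $g$. Let $\mathrm{Cl}(H)$ be the complex algebra generated by $H$ with the relations $v_1v_2+v_2v_1=2g(v_1,v_2)$, with its $\mathbb Z_2$-grading in which $H$ is odd. An orthogonal complex structure $J$ on $H$ is a bounded operator which preserves $g$ and satisfies $J^2=-1$. Let $H\otimes\mathbb C=H^+\oplus H^-$ be the decomposition into the $\pm i$ eigenspaces of $J$, and let $S_{H,J}$ be the Hilbert space completion of the exterior algebra $\wedge H^+$. It is a $\mathbb Z_2$-graded unitary $\mathrm{Cl}(H)$-module, on which $v\in H^+$ acts by $\sqrt2$ times exterior multiplication by $v$ and $v\in H^-$ acts by $\sqrt2$ times contraction with $g(v,\cdot)$ ($g$ extended complex bilinearly). Let $W\subset H$ be a finite-dimensional subspace of even dimension, $H'=W^\perp$, and let $J$, $J'$ be orthogonal complex structures on $H$ and $H'$. Regard $J'$ as an operator on $H$ which is zero on $W$, and write $J\sim J'$ if $J-J'$ is Hilbert–Schmidt. Let $$S_W=\mathrm{Hom}_{\mathrm{Cl}(H')}(S_{H',J'},S_{H,J})$$ be the $\mathbb Z_2$-graded space, normed by the operator norm, of bounded complex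 linear operators which commute with $\mathrm{Cl}(H')$ in the graded sense: it is the sum of its even ($k=0$) and odd ($k=1$) parts, where $T$ is in the part of degree $k$ if it has parity $k$ and $T\,a=(-1)^{kj}a\,T$ for all $a\in \mathrm{Cl}(H')$ of parity $j$. The algebra $\mathrm{Cl}(W)$ acts on $S_W$ by composition with its action on $S_{H,J}$. Then $S_W\neq 0$ if and only if $J\sim J'$; likewise, there is a nonzero bounded operator $S_{H',J'}\to S_{H,J}$ which commutes with $\mathrm{Cl}(H')$ in the ungraded sense if and only if $J\sim J'$. If $J\sim J'$, then $S_W$ is a spinor module over $\mathrm{Cl}(W)$: orthogonal complex structures on $W$ exist, and for every such $J_W$ there is an isometric isomorphism $S_{W,J_W}\cong S_W$ of $\mathrm{Cl}(W)$-modules which either preserves or reverses the parity. -/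

import Mathlib

noncomputable section

namespace SpinorModules

section Fock

variable {V : Type*} [NormedAddCommGroup V] [InnerProductSpace ℂ V]

/-- Exterior multiplication `x ↦ v ∧ x` on the exterior algebra. -/
def wedge (v : V) : ExteriorAlgebra ℂ V →ₗ[ℂ] ExteriorAlgebra ℂ V :=
  LinearMap.mulLeft ℂ (ExteriorAlgebra.ι ℂ v)

/-- Contraction by the functional `⟨v, ·⟩`: the antiderivation of the exterior algebra which
sends `w ∈ V` to the scalar `⟨v, w⟩`. It is conjugate-linear in `v`. -/
def contract (v : V) : ExteriorAlgebra ℂ V →ₗ[ℂ] ExteriorAlgebra ℂ V :=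
  CliffordAlgebra.contractLeft (Q := (0 : QuadraticForm ℂ V)) (innerₛₗ ℂ v)

@[simp] theorem contract_one (v : V) : contract v 1 = 0 :=
  CliffordAlgebra.contractLeft_one (Q := (0 : QuadraticForm ℂ V)) (innerₛₗ ℂ v)

theorem contract_algebraMap (v : V) (r : ℂ) :
    contract v (algebraMap ℂ (ExteriorAlgebra ℂ V) r) = 0 :=
  CliffordAlgebra.contractLeft_algebraMap (Q := (0 : QuadraticForm ℂ V)) (innerₛₗ ℂ v) r

theorem contract_wedge (v w : V) (x : ExteriorAlgebra ℂ V) :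
    contract v (wedge w x) = inner ℂ v w • x - wedge w (contract v x) :=
  CliffordAlgebra.contractLeft_ι_mul (Q := (0 : QuadraticForm ℂ V)) (innerₛₗ ℂ v) w x

theorem contract_contract (v : V) (x : ExteriorAlgebra ℂ V) : contract v (contract v x) = 0 :=
  CliffordAlgebra.contractLeft_contractLeft (Q := (0 : QuadraticForm ℂ V)) (innerₛₗ ℂ v) x

theorem contract_comm (v w : V) (x : ExteriorAlgebra ℂ V) :
    contract v (contract w x) = -contract w (contract v x) :=
  CliffordAlgebra.contractLeft_comm (Q := (0 : QuadraticForm ℂ V)) (innerₛₗ ℂ v) (innerₛₗ ℂ w) x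

theorem contract_add (v w : V) (x : ExteriorAlgebra ℂ V) :
    contract (v + w) x = contract v x + contract w x := by
  simp [contract]

theorem contract_smul (c : ℂ) (v : V) (x : ExteriorAlgebra ℂ V) :
    contract (c • v) x = (starRingEnd ℂ c) • contract v x := by
  simp [contract]

theorem wedge_wedge (v : V) (x : ExteriorAlgebra ℂ V) : wedge v (wedge v x) = 0 := by
  simp [wedge, ← mul_assoc]

theorem wedge_add (v w : V) (x : ExteriorAlgebra ℂ V) :
    wedge (v + w) x = wedge v x + wedge w x := by
  simp [wedge, add_mul]

theorem wedge_smul (c : ℂ) (v : V) (x : ExteriorAlgebra ℂ V) :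
    wedge (c • v) x = c • wedge v x := by
  simp [wedge]

theorem exterior_induction {P : ExteriorAlgebra ℂ V → Prop}
    (h0 : ∀ r, P (algebraMap ℂ _ r)) (hadd : ∀ x y, P x → P y → P (x + y))
    (hw : ∀ v x, P x → P (wedge v x)) (x : ExteriorAlgebra ℂ V) : P x :=
  CliffordAlgebra.left_induction (Q := (0 : QuadraticForm ℂ V)) (P := P) h0 hadd
    (fun x v h => hw v x h) x

/-- For `v : V`, the operator `φ ↦ φ ∘ contract v` on conjugate-linear functionals. -/
def gramStep : V →ₗ[ℂ] (ExteriorAlgebra ℂ V →ₗ⋆[ℂ] ℂ) →ₗ[ℂ] (ExteriorAlgebra ℂ V →ₗ⋆[ℂ] ℂ) :=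
  LinearMap.mk₂ ℂ (fun v φ => φ.comp (contract v))
    (fun v w φ => by ext x; simp [contract_add])
    (fun c v φ => by ext x; simp [contract_smul])
    (fun v φ ψ => by ext x; simp)
    (fun c v φ => by ext x; simp)

/-- The conjugate of the scalar component. -/
def gramZero : ExteriorAlgebra ℂ V →ₗ⋆[ℂ] ℂ :=
  (starLinearEquiv ℂ (A := ℂ)).toLinearMap.comp
    (ExteriorAlgebra.algebraMapInv (R := ℂ) (M := V)).toLinearMap

/-- The Gram pairing, linear in the first and conjugate-linear in the second argument. -/
def gram : ExteriorAlgebra ℂ V →ₗ[ℂ] ExteriorAlgebra ℂ V →ₗ⋆[ℂ] ℂ :=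
  CliffordAlgebra.foldr (0 : QuadraticForm ℂ V) gramStep
    (fun v φ => by ext x; simp [gramStep, contract_contract]) gramZero

/-- The Hermitian form on the exterior algebra of an inner product space, conjugate-linear in the
first slot, in which the exterior powers are mutually orthogonal and
`⟨v₁ ∧ … ∧ vₖ, w₁ ∧ … ∧ wₖ⟩ = det ⟨vᵢ, wⱼ⟩`. It is determined by `⟨1, 1⟩ = 1` and by contraction
being the adjoint of exterior multiplication. -/
def extInner (x y : ExteriorAlgebra ℂ V) : ℂ := gram y x

theorem extInner_add_left (x y z : ExteriorAlgebra ℂ V) :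
    extInner (x + y) z = extInner x z + extInner y z := by simp [extInner]

theorem extInner_add_right (x y z : ExteriorAlgebra ℂ V) :
    extInner x (y + z) = extInner x y + extInner x z := by simp [extInner]

theorem extInner_smul_left (c : ℂ) (x y : ExteriorAlgebra ℂ V) :
    extInner (c • x) y = starRingEnd ℂ c * extInner x y := by simp [extInner]

theorem extInner_smul_right (c : ℂ) (x y : ExteriorAlgebra ℂ V) :
    extInner x (c • y) = c * extInner x y := by simp [extInner]

theorem extInner_zero_left (x : ExteriorAlgebra ℂ V) : extInner 0 x = 0 := by simp [extInner]

theorem extInner_sub_right (x y z : ExteriorAlgebra ℂ V) :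
    extInner x (y - z) = extInner x y - extInner x z := by simp [extInner]

theorem extInner_sub_left (x y z : ExteriorAlgebra ℂ V) :
    extInner (x - y) z = extInner x z - extInner y z := by simp [extInner]

theorem extInner_algebraMap_right (x : ExteriorAlgebra ℂ V) (r : ℂ) :
    extInner x (algebraMap ℂ _ r)
      = r * starRingEnd ℂ (ExteriorAlgebra.algebraMapInv x) := by
  simp [extInner, gram, CliffordAlgebra.foldr_algebraMap, gramZero]

theorem extInner_wedge_right (v : V) (x y : ExteriorAlgebra ℂ V) :
    extInner x (wedge v y) = extInner (contract v x) y := by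
  have := CliffordAlgebra.foldr_mul (0 : QuadraticForm ℂ V) gramStep
    (fun v φ => by ext x; simp [gramStep, contract_contract]) gramZero
    (CliffordAlgebra.ι _ v) y
  rw [CliffordAlgebra.foldr_ι] at this
  exact congrArg (fun f : ExteriorAlgebra ℂ V →ₗ⋆[ℂ] ℂ => f x) this

theorem algebraMapInv_wedge (v : V) (x : ExteriorAlgebra ℂ V) :
    ExteriorAlgebra.algebraMapInv (wedge v x) = 0 := by
  simp [wedge, ExteriorAlgebra.algebraMapInv]

theorem extInner_wedge_left (v : V) (x y : ExteriorAlgebra ℂ V) :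
    extInner (wedge v x) y = extInner x (contract v y) := by
  induction y using exterior_induction generalizing x with
  | h0 r =>
    rw [contract_algebraMap, extInner_algebraMap_right, algebraMapInv_wedge]
    simp [extInner]
  | hadd a b ha hb => rw [map_add, extInner_add_right, extInner_add_right, ha, hb]
  | hw w y ih =>
    rw [extInner_wedge_right, contract_wedge, contract_wedge, extInner_sub_left,
      extInner_sub_right, extInner_smul_left, extInner_smul_right, ih, extInner_wedge_right,
      inner_conj_symm]

theorem extInner_conj_symm (x y : ExteriorAlgebra ℂ V) :
    starRingEnd ℂ (extInner y x) = extInner x y := by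
  induction y using exterior_induction generalizing x with
  | h0 r =>
    rw [extInner_algebraMap_right]
    induction x using exterior_induction with
    | h0 s => rw [extInner_algebraMap_right]; simp [ExteriorAlgebra.algebraMapInv, mul_comm]
    | hadd a b ha hb => rw [extInner_add_right]; simp [ha, hb, mul_add]
    | hw w y ih =>
      rw [extInner_wedge_right, contract_algebraMap, extInner_zero_left, algebraMapInv_wedge]
      simp
  | hadd a b ha hb => rw [extInner_add_left, map_add, extInner_add_right, ha, hb]
  | hw w y ih => rw [extInner_wedge_left, ih, extInner_wedge_right]

/-- The span of the monomials in the members of a list of vectors. -/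
def monomialSpan : List V → Submodule ℂ (ExteriorAlgebra ℂ V)
  | [] => 1
  | v :: l => monomialSpan l ⊔ (monomialSpan l).map (wedge v)

theorem mem_monomialSpan_nil {x : ExteriorAlgebra ℂ V} :
    x ∈ monomialSpan ([] : List V) ↔ ∃ r, algebraMap ℂ _ r = x := by
  simp [monomialSpan, Submodule.mem_one]

theorem mem_monomialSpan_cons {v : V} {l : List V} {x : ExteriorAlgebra ℂ V} :
    x ∈ monomialSpan (v :: l) ↔ ∃ a ∈ monomialSpan l, ∃ b ∈ monomialSpan l, a + wedge v b = x := by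
  simp [monomialSpan, Submodule.mem_sup]

theorem contract_eq_zero_of_mem {l : List V} {v : V} (h : ∀ w ∈ l, inner ℂ v w = 0)
    {x : ExteriorAlgebra ℂ V} (hx : x ∈ monomialSpan l) : contract v x = 0 := by
  induction l generalizing x with
  | nil =>
    obtain ⟨r, rfl⟩ := mem_monomialSpan_nil.1 hx
    exact contract_algebraMap v r
  | cons u l ih =>
    obtain ⟨a, ha, b, hb, rfl⟩ := mem_monomialSpan_cons.1 hx
    have hl : ∀ w ∈ l, inner ℂ v w = 0 := fun w hw => h w (List.mem_cons_of_mem _ hw)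
    rw [map_add, contract_wedge, ih hl ha, ih hl hb, h u List.mem_cons_self]
    simp

theorem extInner_self_of_mem {l : List V} (h1 : ∀ v ∈ l, inner ℂ v v = 1)
    (h2 : l.Pairwise fun v w => inner ℂ v w = 0) {x : ExteriorAlgebra ℂ V}
    (hx : x ∈ monomialSpan l) :
    0 ≤ (extInner x x).re ∧ ((extInner x x).re = 0 → x = 0) := by
  induction l generalizing x with
  | nil =>
    obtain ⟨r, rfl⟩ := mem_monomialSpan_nil.1 hx
    have : (extInner (algebraMap ℂ (ExteriorAlgebra ℂ V) r) (algebraMap ℂ _ r)).re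
        = Complex.normSq r := by
      rw [extInner_algebraMap_right]
      simp [ExteriorAlgebra.algebraMapInv, Complex.normSq_apply]
    rw [this]
    refine ⟨Complex.normSq_nonneg r, fun h => ?_⟩
    rw [Complex.normSq_eq_zero.1 h, map_zero]
  | cons v l ih =>
    obtain ⟨a, ha, b, hb, rfl⟩ := mem_monomialSpan_cons.1 hx
    rw [List.pairwise_cons] at h2
    have hl : ∀ w ∈ l, inner ℂ w w = (1 : ℂ) := fun w hw => h1 w (List.mem_cons_of_mem _ hw)
    have hca := contract_eq_zero_of_mem h2.1 ha
    have hcb := contract_eq_zero_of_mem h2.1 hb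
    have key : extInner (a + wedge v b) (a + wedge v b) = extInner a a + extInner b b := by
      have hv : extInner (wedge v b) (wedge v b) = extInner b b := by
        rw [extInner_wedge_left, contract_wedge, hcb, h1 v List.mem_cons_self]
        simp
      rw [extInner_add_left, extInner_add_right, extInner_add_right, hv, extInner_wedge_right,
        extInner_wedge_left, hca]
      simp [extInner]
    obtain ⟨a1, a2⟩ := ih hl h2.2 ha
    obtain ⟨b1, b2⟩ := ih hl h2.2 hb
    rw [key, Complex.add_re]
    refine ⟨by positivity, fun h => ?_⟩
    rw [a2 (by linarith), b2 (by linarith)]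
    simp

theorem wedge_mem_monomialSpan {l : List V} {u : V} (hu : u ∈ l) {x : ExteriorAlgebra ℂ V}
    (hx : x ∈ monomialSpan l) : wedge u x ∈ monomialSpan l := by
  induction l generalizing x with
  | nil => simp at hu
  | cons v l ih =>
    obtain ⟨a, ha, b, hb, rfl⟩ := mem_monomialSpan_cons.1 hx
    rw [mem_monomialSpan_cons, map_add]
    rcases List.mem_cons.1 hu with rfl | hu
    · exact ⟨0, zero_mem _, a, ha, by simp [wedge_wedge]⟩
    · refine ⟨wedge u a, ih hu ha, -wedge u b, neg_mem (ih hu hb), ?_⟩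
      have h := wedge_wedge (u + v) b
      simp only [wedge_add, map_add, wedge_wedge, zero_add, add_zero] at h
      rw [map_neg, eq_neg_of_add_eq_zero_left h, neg_neg]

theorem wedge_mem_monomialSpan_of_mem_span {l : List V} {u : V}
    (hu : u ∈ Submodule.span ℂ {v | v ∈ l}) {x : ExteriorAlgebra ℂ V}
    (hx : x ∈ monomialSpan l) : wedge u x ∈ monomialSpan l := by
  induction hu using Submodule.span_induction with
  | mem v hv => exact wedge_mem_monomialSpan hv hx
  | zero => simp [wedge]
  | add v w _ _ hv hw => rw [wedge_add]; exact add_mem hv hw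
  | smul c v _ hv => rw [wedge_smul]; exact Submodule.smul_mem _ _ hv

theorem algebraMap_mem_monomialSpan (l : List V) (r : ℂ) :
    algebraMap ℂ (ExteriorAlgebra ℂ V) r ∈ monomialSpan l := by
  induction l with
  | nil => exact mem_monomialSpan_nil.2 ⟨r, rfl⟩
  | cons v l ih => exact mem_monomialSpan_cons.2 ⟨_, ih, 0, zero_mem _, by simp⟩

theorem exists_finiteDimensional_support (x : ExteriorAlgebra ℂ V) :
    ∃ K : Submodule ℂ V, FiniteDimensional ℂ K ∧
      ∀ l : List V, K ≤ Submodule.span ℂ {v | v ∈ l} → x ∈ monomialSpan l := by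
  induction x using exterior_induction with
  | h0 r => exact ⟨⊥, inferInstance, fun l _ => algebraMap_mem_monomialSpan l r⟩
  | hadd x y hx hy =>
    obtain ⟨K, hK, h⟩ := hx
    obtain ⟨L, hL, h'⟩ := hy
    exact ⟨K ⊔ L, inferInstance, fun l hl =>
      add_mem (h l (le_sup_left.trans hl)) (h' l (le_sup_right.trans hl))⟩
  | hw v x hx =>
    obtain ⟨K, hK, h⟩ := hx
    exact ⟨K ⊔ Submodule.span ℂ {v}, inferInstance, fun l hl =>
      wedge_mem_monomialSpan_of_mem_span
        (hl (le_sup_right (a := K) (Submodule.mem_span_singleton_self v)))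
        (h l (le_sup_left.trans hl))⟩

theorem extInner_self_pos (x : ExteriorAlgebra ℂ V) :
    0 ≤ (extInner x x).re ∧ ((extInner x x).re = 0 → x = 0) := by
  obtain ⟨K, hK, h⟩ := exists_finiteDimensional_support x
  have b := stdOrthonormalBasis ℂ K
  refine extInner_self_of_mem (l := List.ofFn fun i => (b i : V)) ?_ ?_ (h _ ?_)
  · intro v hv
    obtain ⟨i, rfl⟩ := (List.mem_ofFn' _ _).1 hv
    rw [← Submodule.coe_inner, b.inner_eq_one]
  · rw [List.pairwise_ofFn]
    intro i j hij
    rw [← Submodule.coe_inner, b.inner_eq_zero hij.ne]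
  · have : {v | v ∈ List.ofFn fun i => (b i : V)} = K.subtype '' Set.range b := by
      ext v
      simp [List.mem_ofFn]
    rw [this, Submodule.span_image, ← b.coe_toBasis, b.toBasis.span_eq, Submodule.map_top,
      Submodule.range_subtype]

/-- The exterior algebra as a pre-Hilbert space. -/
@[reducible] def extCore : InnerProductSpace.Core ℂ (ExteriorAlgebra ℂ V) where
  inner := extInner
  conj_inner_symm := extInner_conj_symm
  re_inner_nonneg x := (extInner_self_pos x).1
  add_left := extInner_add_left
  smul_left x y c := extInner_smul_left c x y
  definite x h := (extInner_self_pos x).2 (by rw [h]; simp)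

instance extNormedAddCommGroup : NormedAddCommGroup (ExteriorAlgebra ℂ V) :=
  extCore.toNormedAddCommGroup

instance extInnerProductSpace : InnerProductSpace ℂ (ExteriorAlgebra ℂ V) :=
  InnerProductSpace.ofCore (extCore (V := V)).toCore

theorem ext_inner_def (x y : ExteriorAlgebra ℂ V) : inner ℂ x y = extInner x y := rfl

theorem norm_sq_wedge_add_norm_sq_contract (v : V) (x : ExteriorAlgebra ℂ V) :
    ‖wedge v x‖ ^ 2 + ‖contract v x‖ ^ 2 = (‖v‖ * ‖x‖) ^ 2 := by
  have hx : ∀ y : ExteriorAlgebra ℂ V, ((‖y‖ : ℂ)) ^ 2 = extInner y y := fun y =>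
    (inner_self_eq_norm_sq_to_K (𝕜 := ℂ) y).symm
  have hv : ((‖v‖ : ℂ)) ^ 2 = inner ℂ v v := (inner_self_eq_norm_sq_to_K (𝕜 := ℂ) v).symm
  have h : (((‖wedge v x‖ ^ 2 + ‖contract v x‖ ^ 2 : ℝ)) : ℂ) = (((‖v‖ * ‖x‖) ^ 2 : ℝ) : ℂ) := by
    push_cast
    rw [mul_pow, hx, hx, hx, hv, extInner_wedge_left, contract_wedge, ← extInner_wedge_right, extInner_sub_right,
      extInner_smul_right]
    ring
  exact_mod_cast h

theorem norm_wedge_le (v : V) (x : ExteriorAlgebra ℂ V) : ‖wedge v x‖ ≤ ‖v‖ * ‖x‖ := by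
  refine abs_le_of_sq_le_sq' ?_ (by positivity) |>.2
  nlinarith [norm_sq_wedge_add_norm_sq_contract v x, sq_nonneg ‖contract v x‖]

theorem norm_contract_le (v : V) (x : ExteriorAlgebra ℂ V) : ‖contract v x‖ ≤ ‖v‖ * ‖x‖ := by
  refine abs_le_of_sq_le_sq' ?_ (by positivity) |>.2
  nlinarith [norm_sq_wedge_add_norm_sq_contract v x, sq_nonneg ‖wedge v x‖]

variable (V) in
/-- The Hilbert space completion of the exterior algebra of `V`. -/
def Fock : Type _ := UniformSpace.Completion (ExteriorAlgebra ℂ V)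

instance : NormedAddCommGroup (Fock V) :=
  inferInstanceAs (NormedAddCommGroup (UniformSpace.Completion (ExteriorAlgebra ℂ V)))

instance : InnerProductSpace ℂ (Fock V) :=
  inferInstanceAs (InnerProductSpace ℂ (UniformSpace.Completion (ExteriorAlgebra ℂ V)))

instance : CompleteSpace (Fock V) :=
  inferInstanceAs (CompleteSpace (UniformSpace.Completion (ExteriorAlgebra ℂ V)))

/-- The dense isometric embedding of the exterior algebra into its completion. -/
def Fock.of : ExteriorAlgebra ℂ V →ₗᵢ[ℂ] Fock V :=
  UniformSpace.Completion.toComplₗᵢ (𝕜 := ℂ) (E := ExteriorAlgebra ℂ V)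

theorem Fock.denseRange_of : DenseRange (Fock.of (V := V)) :=
  UniformSpace.Completion.denseRange_coe (α := ExteriorAlgebra ℂ V)

theorem Fock.clm_ext {A B : Fock V →L[ℂ] Fock V}
    (h : ∀ x : ExteriorAlgebra ℂ V, A (Fock.of x) = B (Fock.of x)) : A = B :=
  ContinuousLinearMap.ext fun x =>
    congrFun (Fock.denseRange_of.equalizer A.continuous B.continuous (funext h)) x

/-- The continuous extension of a bounded operator on the exterior algebra. -/
def Fock.extend (A : ExteriorAlgebra ℂ V →L[ℂ] ExteriorAlgebra ℂ V) : Fock V →L[ℂ] Fock V :=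
  A.completion

theorem Fock.extend_of (A : ExteriorAlgebra ℂ V →L[ℂ] ExteriorAlgebra ℂ V)
    (x : ExteriorAlgebra ℂ V) : Fock.extend A (Fock.of x) = Fock.of (A x) :=
  UniformSpace.Completion.map_coe A.uniformContinuous x

/-- Exterior multiplication by `v`, as a bounded operator on the completed exterior algebra. -/
def creation (v : V) : Fock V →L[ℂ] Fock V :=
  Fock.extend ((wedge v).mkContinuous ‖v‖ (norm_wedge_le v))

/-- Contraction by `⟨v, ·⟩`, as a bounded operator on the completed exterior algebra. -/
def annihilation (v : V) : Fock V →L[ℂ] Fock V :=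
  Fock.extend ((contract v).mkContinuous ‖v‖ (norm_contract_le v))

theorem creation_of (v : V) (x : ExteriorAlgebra ℂ V) :
    creation v (Fock.of x) = Fock.of (wedge v x) :=
  Fock.extend_of _ x

theorem annihilation_of (v : V) (x : ExteriorAlgebra ℂ V) :
    annihilation v (Fock.of x) = Fock.of (contract v x) :=
  Fock.extend_of _ x

variable (V) in
/-- The closures in the completed exterior algebra of its even and its odd part. -/
def Fock.parity (k : ZMod 2) : Submodule ℂ (Fock V) :=
  ((CliffordAlgebra.evenOdd (0 : QuadraticForm ℂ V) k).map
    (Fock.of (V := V)).toLinearMap).topologicalClosure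

theorem creation_creation (v : V) (x : Fock V) : creation v (creation v x) = 0 := by
  have h : creation v ∘L creation v = 0 := Fock.clm_ext fun a => by
    rw [ContinuousLinearMap.comp_apply, creation_of, creation_of, wedge_wedge, map_zero,
      zero_apply]
  exact congrArg (fun A : Fock V →L[ℂ] Fock V => A x) h

theorem annihilation_annihilation (v : V) (x : Fock V) :
    annihilation v (annihilation v x) = 0 := by
  have h : annihilation v ∘L annihilation v = 0 := Fock.clm_ext fun a => by
    rw [ContinuousLinearMap.comp_apply, annihilation_of, annihilation_of, contract_contract,
      map_zero, zero_apply]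
  exact congrArg (fun A : Fock V →L[ℂ] Fock V => A x) h

theorem annihilation_creation (v w : V) (x : Fock V) :
    annihilation v (creation w x) + creation w (annihilation v x) = inner ℂ v w • x := by
  have h : annihilation v ∘L creation w + creation w ∘L annihilation v
      = inner ℂ v w • ContinuousLinearMap.id ℂ (Fock V) := by
    refine Fock.clm_ext fun a => ?_
    rw [add_apply, ContinuousLinearMap.comp_apply, ContinuousLinearMap.comp_apply, smul_apply,
      ContinuousLinearMap.id_apply, creation_of, annihilation_of, annihilation_of, creation_of,
      contract_wedge, ← map_add, sub_add_cancel, map_smul]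
  exact congrArg (fun A : Fock V →L[ℂ] Fock V => A x) h

theorem creation_add (v w : V) : creation (v + w) = creation v + creation w := by
  refine Fock.clm_ext fun a => ?_
  rw [add_apply, creation_of, creation_of, creation_of, wedge_add, map_add]

theorem creation_smul (c : ℂ) (v : V) : creation (c • v) = c • creation v := by
  refine Fock.clm_ext fun a => ?_
  rw [smul_apply, creation_of, creation_of, wedge_smul, map_smul]

theorem annihilation_add (v w : V) : annihilation (v + w) = annihilation v + annihilation w := by
  refine Fock.clm_ext fun a => ?_
  rw [add_apply, annihilation_of, annihilation_of, annihilation_of, contract_add, map_add]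

theorem annihilation_smul (c : ℂ) (v : V) :
    annihilation (c • v) = starRingEnd ℂ c • annihilation v := by
  refine Fock.clm_ext fun a => ?_
  rw [smul_apply, annihilation_of, annihilation_of, contract_smul, map_smul]

theorem creation_mem_parity (v : V) {k : ZMod 2} {x : Fock V} (hx : x ∈ Fock.parity V k) :
    creation v x ∈ Fock.parity V (1 + k) := by
  refine map_mem_closure (creation v).continuous hx ?_
  rintro _ ⟨a, ha, rfl⟩
  refine ⟨wedge v a, ?_, (creation_of v a).symm⟩
  exact CliffordAlgebra.evenOdd_mul_le (0 : QuadraticForm ℂ V) 1 k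
    (Submodule.mul_mem_mul (CliffordAlgebra.ι_mem_evenOdd_one _ v) ha)

theorem contract_mem_evenOdd (v : V) {k : ZMod 2} {a : ExteriorAlgebra ℂ V}
    (ha : a ∈ CliffordAlgebra.evenOdd (0 : QuadraticForm ℂ V) k) :
    contract v a ∈ CliffordAlgebra.evenOdd (0 : QuadraticForm ℂ V) (1 + k) := by
  have key : ∀ (w : V) (n : ZMod 2) (y : ExteriorAlgebra ℂ V),
      y ∈ CliffordAlgebra.evenOdd (0 : QuadraticForm ℂ V) n →
      wedge w y ∈ CliffordAlgebra.evenOdd (0 : QuadraticForm ℂ V) (1 + n) := fun w n y hy =>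
    CliffordAlgebra.evenOdd_mul_le (0 : QuadraticForm ℂ V) 1 n
      (Submodule.mul_mem_mul (CliffordAlgebra.ι_mem_evenOdd_one _ w) hy)
  induction a, ha using CliffordAlgebra.evenOdd_induction with
  | range_ι_pow x hx =>
    fin_cases k
    · obtain ⟨r, rfl⟩ := Submodule.mem_one.1
        (show x ∈ (1 : Submodule ℂ (CliffordAlgebra (0 : QuadraticForm ℂ V))) from hx)
      rw [contract_algebraMap]
      exact zero_mem _
    · obtain ⟨w, rfl⟩ : ∃ w, CliffordAlgebra.ι _ w = x := by
        have : x ∈ LinearMap.range (CliffordAlgebra.ι (0 : QuadraticForm ℂ V)) ^ 1 := hx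
        simpa using this
      have h : contract v (CliffordAlgebra.ι (0 : QuadraticForm ℂ V) w)
          = algebraMap ℂ _ (inner ℂ v w) :=
        CliffordAlgebra.contractLeft_ι (Q := (0 : QuadraticForm ℂ V)) (innerₛₗ ℂ v) w
      rw [h]
      exact SetLike.algebraMap_mem_graded (CliffordAlgebra.evenOdd (0 : QuadraticForm ℂ V)) _
  | add x y hx hy ihx ihy => rw [map_add]; exact add_mem ihx ihy
  | ι_mul_ι_mul m₁ m₂ x hx ih =>
    have e : CliffordAlgebra.ι (0 : QuadraticForm ℂ V) m₁ * CliffordAlgebra.ι _ m₂ * x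
        = wedge m₁ (wedge m₂ x) := mul_assoc _ _ _
    rw [e, contract_wedge, contract_wedge, map_sub]
    have h2 := key m₁ _ _ (key m₂ _ _ ih)
    have : (1 + (1 + (1 + k)) : ZMod 2) = 1 + k :=
      (by decide : ∀ k : ZMod 2, 1 + (1 + (1 + k)) = 1 + k) k
    rw [this] at h2
    exact sub_mem (Submodule.smul_mem _ _ (key m₂ _ _ hx))
      (sub_mem (by rw [map_smul]; exact Submodule.smul_mem _ _ (key m₁ _ _ hx)) h2)

theorem annihilation_mem_parity (v : V) {k : ZMod 2} {x : Fock V} (hx : x ∈ Fock.parity V k) :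
    annihilation v x ∈ Fock.parity V (1 + k) := by
  refine map_mem_closure (annihilation v).continuous hx ?_
  rintro _ ⟨a, ha, rfl⟩
  exact ⟨contract v a, contract_mem_evenOdd v ha, (annihilation_of v a).symm⟩

end Fock

section Complexification

/-- The complexification of a real vector space; `⟨x, y⟩` stands for `x + i y`. -/
@[ext] structure Cplx (H : Type*) where
  re : H
  im : H

namespace Cplx

variable {H : Type*} [NormedAddCommGroup H]

/-- The underlying pair. -/
def equivProd (H : Type*) : Cplx H ≃ H × H where
  toFun x := (x.re, x.im)
  invFun p := ⟨p.1, p.2⟩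
  left_inv _ := rfl
  right_inv _ := rfl

instance : AddCommGroup (Cplx H) := (equivProd H).addCommGroup

@[simp] theorem re_add (x y : Cplx H) : (x + y).re = x.re + y.re := rfl
@[simp] theorem im_add (x y : Cplx H) : (x + y).im = x.im + y.im := rfl
@[simp] theorem re_zero : (0 : Cplx H).re = 0 := rfl
@[simp] theorem im_zero : (0 : Cplx H).im = 0 := rfl
@[simp] theorem re_sub (x y : Cplx H) : (x - y).re = x.re - y.re := rfl
@[simp] theorem im_sub (x y : Cplx H) : (x - y).im = x.im - y.im := rfl
@[simp] theorem re_neg (x : Cplx H) : (-x).re = -x.re := rfl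
@[simp] theorem im_neg (x : Cplx H) : (-x).im = -x.im := rfl

variable [InnerProductSpace ℝ H]

instance : SMul ℂ (Cplx H) where
  smul c x := ⟨c.re • x.re - c.im • x.im, c.re • x.im + c.im • x.re⟩

@[simp] theorem re_smul (c : ℂ) (x : Cplx H) : (c • x).re = c.re • x.re - c.im • x.im := rfl
@[simp] theorem im_smul (c : ℂ) (x : Cplx H) : (c • x).im = c.re • x.im + c.im • x.re := rfl

instance : Module ℂ (Cplx H) where
  one_smul x := by ext <;> simp
  mul_smul c d x := by ext <;> simp <;> module
  smul_zero c := by ext <;> simp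
  smul_add c x y := by ext <;> simp <;> module
  add_smul c d x := by ext <;> simp <;> module
  zero_smul x := by ext <;> simp

/-- The Hermitian extension of the real inner product, conjugate-linear in the first slot. -/
@[reducible] def core : InnerProductSpace.Core ℂ (Cplx H) where
  inner x y := ⟨inner ℝ x.re y.re + inner ℝ x.im y.im, inner ℝ x.re y.im - inner ℝ x.im y.re⟩
  conj_inner_symm x y := by
    apply Complex.ext <;> simp [real_inner_comm]
  re_inner_nonneg x := add_nonneg real_inner_self_nonneg real_inner_self_nonneg
  add_left x y z := by
    apply Complex.ext <;> simp [inner_add_left] <;> ring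
  smul_left x y c := by
    apply Complex.ext <;>
      simp [inner_add_left, inner_sub_left, real_inner_smul_left] <;> ring
  definite x h := by
    have h := congrArg Complex.re h
    have h1 : (0 : ℝ) ≤ inner ℝ x.re x.re := real_inner_self_nonneg
    have h2 : (0 : ℝ) ≤ inner ℝ x.im x.im := real_inner_self_nonneg
    simp only [Complex.zero_re] at h
    ext
    · exact inner_self_eq_zero.1 (by linarith : inner ℝ x.re x.re = 0)
    · exact inner_self_eq_zero.1 (by linarith : inner ℝ x.im x.im = 0)

instance : NormedAddCommGroup (Cplx H) := (core (H := H)).toNormedAddCommGroup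

instance : InnerProductSpace ℂ (Cplx H) := InnerProductSpace.ofCore (core (H := H)).toCore

theorem inner_def (x y : Cplx H) : inner ℂ x y =
    (⟨inner ℝ x.re y.re + inner ℝ x.im y.im, inner ℝ x.re y.im - inner ℝ x.im y.re⟩ : ℂ) := rfl

/-- Complex conjugation `x + i y ↦ x - i y`. -/
def conj : Cplx H →ₗ⋆[ℂ] Cplx H where
  toFun x := ⟨x.re, -x.im⟩
  map_add' x y := by ext <;> simp; abel
  map_smul' c x := by ext <;> simp; abel

@[simp] theorem re_conj (x : Cplx H) : (conj x).re = x.re := rfl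
@[simp] theorem im_conj (x : Cplx H) : (conj x).im = -x.im := rfl

/-- The complex linear extension of a real operator. -/
def map {H₁ H₂ : Type*} [NormedAddCommGroup H₁] [InnerProductSpace ℝ H₁]
    [NormedAddCommGroup H₂] [InnerProductSpace ℝ H₂] (A : H₁ →ₗ[ℝ] H₂) :
    Cplx H₁ →ₗ[ℂ] Cplx H₂ where
  toFun x := ⟨A x.re, A x.im⟩
  map_add' x y := by ext <;> simp
  map_smul' c x := by ext <;> simp

variable (H) in
/-- The complex bilinear extension `g` of the real inner product. -/
def bilin : LinearMap.BilinForm ℂ (Cplx H) :=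
  LinearMap.mk₂ ℂ (fun x y => inner ℂ (conj x) y)
    (fun x y z => by rw [map_add, inner_add_left])
    (fun c x y => by rw [LinearMap.map_smulₛₗ, inner_smul_left, Complex.conj_conj, smul_eq_mul])
    (fun x y z => by rw [inner_add_right]) (fun c x y => by rw [inner_smul_right, smul_eq_mul])

variable (H) in
/-- The complex quadratic form `v ↦ g(v, v)`. -/
def quad : QuadraticForm ℂ (Cplx H) := (bilin H).toQuadraticMap

theorem quad_apply (x : Cplx H) : quad H x =
    (⟨inner ℝ x.re x.re - inner ℝ x.im x.im, 2 * inner ℝ x.re x.im⟩ : ℂ) := by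
  apply Complex.ext <;> simp [quad, bilin, inner_def, real_inner_comm] <;> ring

end Cplx

end Complexification

section Spinors

variable {H : Type*} [NormedAddCommGroup H] [InnerProductSpace ℝ H]

/-- The complex Clifford algebra of a real inner product space, generated by the vectors (or their
complex combinations) with the relations `v₁ v₂ + v₂ v₁ = 2 g(v₁, v₂)`, i.e. `v² = g(v, v)`. -/
abbrev Cl (H : Type*) [NormedAddCommGroup H] [InnerProductSpace ℝ H] : Type _ :=
  CliffordAlgebra (Cplx.quad H)

/-- The even (`k = 0`) and odd (`k = 1`) part of the Clifford algebra. -/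
abbrev Cl.parity (H : Type*) [NormedAddCommGroup H] [InnerProductSpace ℝ H] (k : ZMod 2) :
    Submodule ℂ (Cl H) :=
  CliffordAlgebra.evenOdd (Cplx.quad H) k

/-- The isometry of complexified quadratic spaces induced by a subspace. -/
def subspaceIsometry (K : Submodule ℝ H) : Cplx.quad K →qᵢ Cplx.quad H where
  toLinearMap := Cplx.map K.subtype
  map_app' x := by
    rw [Cplx.quad_apply, Cplx.quad_apply]
    rfl

/-- The homomorphism `Cl(K) → Cl(H)` which extends the inclusion of a subspace `K`. -/
def clIncl (K : Submodule ℝ H) : Cl K →ₐ[ℂ] Cl H := CliffordAlgebra.map (subspaceIsometry K)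

variable (H) in
/-- Orthogonal complex structures: bounded operators with `J² = -1` preserving the metric. -/
structure OrthComplexStructure where
  toCLM : H →L[ℝ] H
  sq : ∀ v, toCLM (toCLM v) = -v
  orth : ∀ v w, inner ℝ (toCLM v) (toCLM w) = inner ℝ v w

variable (J : OrthComplexStructure H)

/-- The complex linear extension of `J`. -/
def OrthComplexStructure.complexified : Module.End ℂ (Cplx H) := Cplx.map J.toCLM.toLinearMap

/-- `H⁺`, the `+i` eigenspace of `J` in the complexification. -/
def Hplus : Submodule ℂ (Cplx H) := Module.End.eigenspace J.complexified Complex.I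

/-- `H⁻`, the `-i` eigenspace of `J` in the complexification. -/
def Hminus : Submodule ℂ (Cplx H) := Module.End.eigenspace J.complexified (-Complex.I)

theorem complexified_sq (x : Cplx H) : J.complexified (J.complexified x) = -x := by
  ext <;> simp [OrthComplexStructure.complexified, Cplx.map, J.sq]

/-- The component in `H⁺` of a vector of `H ⊗ ℂ = H⁺ ⊕ H⁻`. -/
def plusPart : Cplx H →ₗ[ℂ] Hplus J :=
  LinearMap.codRestrict (Hplus J)
    ((1 / 2 : ℂ) • (LinearMap.id - Complex.I • J.complexified)) fun x => by
      rw [Hplus, Module.End.mem_eigenspace_iff]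
      simp only [LinearMap.smul_apply, LinearMap.sub_apply, LinearMap.id_apply, map_smul, map_sub,
        complexified_sq, smul_sub, smul_smul, smul_neg]
      match_scalars
      · linear_combination (1 / 2 : ℂ) * Complex.I_mul_I
      · ring

/-- The component in `H⁻` of a vector of `H ⊗ ℂ = H⁺ ⊕ H⁻`. -/
def minusPart : Cplx H →ₗ[ℂ] Hminus J :=
  LinearMap.codRestrict (Hminus J)
    ((1 / 2 : ℂ) • (LinearMap.id + Complex.I • J.complexified)) fun x => by
      rw [Hminus, Module.End.mem_eigenspace_iff]
      simp only [LinearMap.smul_apply, LinearMap.add_apply, LinearMap.id_apply, map_smul, map_add,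
        complexified_sq, smul_add, smul_smul, smul_neg]
      match_scalars
      · linear_combination (1 / 2 : ℂ) * Complex.I_mul_I
      · ring

theorem plusPart_add_minusPart (x : Cplx H) :
    (plusPart J x : Cplx H) + (minusPart J x : Cplx H) = x := by
  simp only [plusPart, minusPart, LinearMap.codRestrict_apply, LinearMap.smul_apply,
    LinearMap.add_apply, LinearMap.sub_apply, LinearMap.id_apply]
  module

/-- Conjugation maps `H⁻` to `H⁺`. -/
def conjMinus : Hminus J →ₗ⋆[ℂ] Hplus J :=
  LinearMap.codRestrict (Hplus J) (Cplx.conj.comp (Hminus J).subtype) fun x => by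
    have hx := Module.End.mem_eigenspace_iff.1 x.2
    have h : J.complexified (Cplx.conj x) = Cplx.conj (J.complexified x) := by
      ext <;> simp [OrthComplexStructure.complexified, Cplx.map]
    rw [Hplus, Module.End.mem_eigenspace_iff]
    change J.complexified (Cplx.conj x) = Complex.I • Cplx.conj x
    rw [h, hx, LinearMap.map_smulₛₗ]
    simp

/-- The Hilbert space `S_{H,J}`, the completed exterior algebra of `H⁺`. -/
abbrev Spinor : Type _ := Fock (Hplus J)

/-- The even (`k = 0`) and odd (`k = 1`) spinors. -/
abbrev Spinor.parity (k : ZMod 2) : Submodule ℂ (Spinor J) := Fock.parity (Hplus J) k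

/-- The action of complex combinations of vectors: `v ∈ H⁺` acts by exterior multiplication and
`v ∈ H⁻` by contraction with `g(v, ·) = ⟨conj v, ·⟩`. The factor `√2` is the normalization for
which `v` squares to `g(v, v)` and real vectors act by self-adjoint operators. -/
def vectorAction : Cplx H →ₗ[ℂ] (Spinor J →L[ℂ] Spinor J) where
  toFun x := ((√2 : ℝ) : ℂ) •
    (creation (plusPart J x) + annihilation (conjMinus J (minusPart J x)))
  map_add' x y := by
    simp only [map_add, creation_add, annihilation_add]
    module
  map_smul' c x := by
    simp only [map_smul, LinearMap.map_smulₛₗ, creation_smul, annihilation_smul, RingHom.id_apply,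
      Complex.conj_conj]
    module

theorem inner_conjMinus_plusPart (x : Cplx H) :
    2 * inner ℂ (conjMinus J (minusPart J x)) (plusPart J x) = Cplx.quad H x := by
  rw [Cplx.quad_apply, Submodule.coe_inner]
  change 2 * inner ℂ (Cplx.conj ((1 / 2 : ℂ) • (x + Complex.I • J.complexified x)))
    ((1 / 2 : ℂ) • (x - Complex.I • J.complexified x)) = _
  rw [LinearMap.map_smulₛₗ, inner_smul_left, inner_smul_right, Cplx.inner_def]
  have h1 := J.orth x.re x.re
  have h2 := J.orth x.im x.im
  have h3 := J.orth x.re x.im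
  have h4 := J.orth x.im x.re
  have c1 := real_inner_comm x.re x.im
  have c2 := real_inner_comm x.re (J.toCLM x.re)
  have c3 := real_inner_comm x.re (J.toCLM x.im)
  have c4 := real_inner_comm x.im (J.toCLM x.re)
  have c5 := real_inner_comm x.im (J.toCLM x.im)
  apply Complex.ext <;>
    simp [OrthComplexStructure.complexified, Cplx.map, inner_add_left,
      inner_add_right, inner_sub_right, h1, h2, h3, h4, -inner_self_eq_norm_sq_to_K] <;> linarith

theorem vectorAction_sq (x : Cplx H) :
    vectorAction J x * vectorAction J x = algebraMap ℂ _ (Cplx.quad H x) := by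
  ext s
  have h2 : ((√2 : ℝ) : ℂ) * ((√2 : ℝ) : ℂ) = 2 := by
    rw [← Complex.ofReal_mul, Real.mul_self_sqrt (by norm_num)]; norm_num
  have h := annihilation_creation (conjMinus J (minusPart J x)) (plusPart J x) s
  rw [Algebra.algebraMap_eq_smul_one, ← inner_conjMinus_plusPart J, mul_smul]
  have e : vectorAction J x * vectorAction J x = (2 : ℂ) •
      ((creation (plusPart J x) + annihilation (conjMinus J (minusPart J x))) *
        (creation (plusPart J x) + annihilation (conjMinus J (minusPart J x)))) := by
    rw [← h2, ← smul_mul_smul_comm]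
    rfl
  rw [e]
  change (2 : ℂ) • ((creation (plusPart J x) + annihilation (conjMinus J (minusPart J x)))
    (creation (plusPart J x) s + annihilation (conjMinus J (minusPart J x)) s)) =
      (2 : ℂ) • inner ℂ (conjMinus J (minusPart J x)) (plusPart J x) • s
  rw [← h, add_apply, map_add, map_add, creation_creation, annihilation_annihilation]
  congr 1
  abel

/-- The action of the Clifford algebra on the spinor module. -/
def cliffordAction : Cl H →ₐ[ℂ] (Spinor J →L[ℂ] Spinor J) :=
  CliffordAlgebra.lift (Cplx.quad H) ⟨vectorAction J, vectorAction_sq J⟩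

theorem cliffordAction_ι (x : Cplx H) :
    cliffordAction J (CliffordAlgebra.ι (Cplx.quad H) x) = vectorAction J x :=
  CliffordAlgebra.lift_ι_apply _ _ x

theorem vectorAction_mem_parity (x : Cplx H) {k : ZMod 2} {s : Spinor J}
    (hs : s ∈ Spinor.parity J k) : vectorAction J x s ∈ Spinor.parity J (1 + k) :=
  Submodule.smul_mem _ _ (add_mem (creation_mem_parity _ hs) (annihilation_mem_parity _ hs))

/-- The action of the Clifford algebra is compatible with the gradings. -/
theorem cliffordAction_mem_parity {i k : ZMod 2} {a : Cl H} (ha : a ∈ Cl.parity H i)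
    {s : Spinor J} (hs : s ∈ Spinor.parity J k) :
    cliffordAction J a s ∈ Spinor.parity J (i + k) := by
  induction a, ha using CliffordAlgebra.evenOdd_induction with
  | range_ι_pow x hx =>
    fin_cases i
    · obtain ⟨r, rfl⟩ := Submodule.mem_one.1
        (show x ∈ (1 : Submodule ℂ (Cl H)) from hx)
      have h : cliffordAction J (algebraMap ℂ (Cl H) r) s = r • s := by
        rw [AlgHom.commutes]; rfl
      rw [h]
      have e : (0 : ZMod 2) + k = k := zero_add k
      exact e.symm ▸ Submodule.smul_mem _ r hs
    · obtain ⟨w, rfl⟩ : ∃ w, CliffordAlgebra.ι _ w = x := by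
        have : x ∈ LinearMap.range (CliffordAlgebra.ι (Cplx.quad H)) ^ 1 := hx
        simpa using this
      rw [cliffordAction_ι]
      exact vectorAction_mem_parity J w hs
  | add x y hx hy ihx ihy => rw [map_add]; exact add_mem ihx ihy
  | ι_mul_ι_mul m₁ m₂ x hx ih =>
    rw [map_mul, map_mul, cliffordAction_ι, cliffordAction_ι]
    have h := vectorAction_mem_parity J m₁ (vectorAction_mem_parity J m₂ ih)
    have e : (1 + (1 + (i + k)) : ZMod 2) = i + k :=
      (by decide : ∀ i k : ZMod 2, 1 + (1 + (i + k)) = i + k) i k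
    rw [e] at h
    exact h

end Spinors

section Polarization

variable {H : Type*} [NormedAddCommGroup H] [InnerProductSpace ℝ H]

/-- Hilbert–Schmidt operators: the squared norms of the images of the members of some
(equivalently, of every) orthonormal basis are summable. -/
def IsHilbertSchmidt (A : H →L[ℝ] H) : Prop :=
  ∃ (s : Set H) (b : HilbertBasis s ℝ H), Summable fun i => ‖A (b i)‖ ^ 2

/-- The relation `A ∼ B`: the difference is Hilbert–Schmidt. -/
def HSEquiv (A B : H →L[ℝ] H) : Prop := IsHilbertSchmidt (A - B)

/-- An operator on `Wᗮ`, regarded as an operator on `H` acting as zero on `W`. -/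
def extendByZero (W : Submodule ℝ H) [W.HasOrthogonalProjection] (A : Wᗮ →L[ℝ] Wᗮ) : H →L[ℝ] H :=
  Wᗮ.subtypeL ∘L A ∘L Wᗮ.orthogonalProjectionOnto

end Polarization

section Intertwiners

variable {H : Type*} [NormedAddCommGroup H] [InnerProductSpace ℝ H]
  (W : Submodule ℝ H) (J : OrthComplexStructure H) (J' : OrthComplexStructure Wᗮ)

/-- The bounded operators `S_{H'} → S_H`, where `H' = Wᗮ`, which commute with the action of
`Cl(H')` (with no signs). -/
def ungradedHom : Submodule ℂ (Spinor J' →L[ℂ] Spinor J) where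
  carrier := {T | ∀ a : Cl Wᗮ,
    ∀ s, T (cliffordAction J' a s) = cliffordAction J (clIncl Wᗮ a) (T s)}
  add_mem' := fun hS hT a s => by rw [add_apply, add_apply, hS a s, hT a s, map_add]
  zero_mem' := fun a s => by rw [zero_apply, zero_apply, map_zero]
  smul_mem' := fun c T hT a s => by rw [smul_apply, smul_apply, hT a s, map_smul]

/-- The homogeneous elements of degree `k` in the graded space `Hom_{Cl(H')}(S_{H'}, S_H)`,
`H' = Wᗮ`: the bounded operators of parity `k` which commute in the graded sense with `Cl(H')`,
that is `T a = (-1)^{k j} a T` for `a` of parity `j`. -/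
def gradedHom (k : ZMod 2) : Submodule ℂ (Spinor J' →L[ℂ] Spinor J) where
  carrier := {T | (∀ j, ∀ s ∈ Spinor.parity J' j, T s ∈ Spinor.parity J (k + j)) ∧
    ∀ j, ∀ a ∈ Cl.parity Wᗮ j, ∀ s,
      T (cliffordAction J' a s) = ((-1 : ℤˣ) ^ (k * j)) • cliffordAction J (clIncl Wᗮ a) (T s)}
  add_mem' := fun hS hT => ⟨fun j s hs => add_mem (hS.1 j s hs) (hT.1 j s hs),
    fun j a ha s => by
      rw [add_apply, add_apply, hS.2 j a ha, hT.2 j a ha, map_add, smul_add]⟩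
  zero_mem' := ⟨fun j s _ => zero_mem _, fun j a _ s => by
    rw [zero_apply, zero_apply, map_zero, smul_zero]⟩
  smul_mem' := fun c T hT => ⟨fun j s hs => Submodule.smul_mem _ c (hT.1 j s hs),
    fun j a ha s => by
      rw [smul_apply, smul_apply, hT.2 j a ha, map_smul, smul_comm]⟩

/-- The space `S_W = Hom_{Cl(H')}(S_{H'}, S_H)`, `H' = Wᗮ`, with the operator norm: the sum of its
even and its odd part. -/
def spinorHom : Submodule ℂ (Spinor J' →L[ℂ] Spinor J) :=
  gradedHom W J J' 0 ⊔ gradedHom W J J' 1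

/-- The even and odd part of `S_W`, as subspaces of `S_W`. -/
def spinorHomParity (k : ZMod 2) : Submodule ℂ (spinorHom W J J') :=
  (gradedHom W J J' k).submoduleOf (spinorHom W J J')

theorem gradedHom_le (k : ZMod 2) : gradedHom W J J' k ≤ spinorHom W J J' := by
  fin_cases k
  · exact le_sup_left
  · exact le_sup_right

theorem clIncl_mem_parity {i : ZMod 2} {a : Cl W} (ha : a ∈ Cl.parity W i) :
    clIncl W a ∈ Cl.parity H i := by
  induction a, ha using CliffordAlgebra.evenOdd_induction with
  | range_ι_pow x hx =>
    fin_cases i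
    · obtain ⟨r, rfl⟩ := Submodule.mem_one.1
        (show x ∈ (1 : Submodule ℂ (Cl W)) from hx)
      rw [AlgHom.commutes]
      exact SetLike.algebraMap_mem_graded (CliffordAlgebra.evenOdd (Cplx.quad H)) r
    · obtain ⟨w, rfl⟩ : ∃ w, CliffordAlgebra.ι _ w = x := by
        have : x ∈ LinearMap.range (CliffordAlgebra.ι (Cplx.quad W)) ^ 1 := hx
        simpa using this
      rw [clIncl, CliffordAlgebra.map_apply_ι]
      exact CliffordAlgebra.ι_mem_evenOdd_one _ _
  | add x y hx hy ihx ihy => rw [map_add]; exact add_mem ihx ihy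
  | ι_mul_ι_mul m₁ m₂ x hx ih =>
    rw [map_mul, map_mul, clIncl, CliffordAlgebra.map_apply_ι, CliffordAlgebra.map_apply_ι]
    exact zero_add i ▸ SetLike.mul_mem_graded
      (CliffordAlgebra.ι_mul_ι_mem_evenOdd_zero (Cplx.quad H) _ _) ih

theorem clIncl_mul_clIncl {i j : ZMod 2} {a : Cl W} (ha : a ∈ Cl.parity W i) {b : Cl Wᗮ}
    (hb : b ∈ Cl.parity Wᗮ j) :
    clIncl W a * clIncl Wᗮ b = (-1 : ℤˣ) ^ (j * i) • (clIncl Wᗮ b * clIncl W a) := by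
  refine CliffordAlgebra.map_mul_map_of_isOrtho_of_mem_evenOdd _ _ (fun x y => ?_) _ _ ha hb
  have h1 : inner ℝ (x.re : H) (y.re : H) = 0 := y.re.2 _ x.re.2
  have h2 : inner ℝ (x.re : H) (y.im : H) = 0 := y.im.2 _ x.re.2
  have h3 : inner ℝ (x.im : H) (y.re : H) = 0 := y.re.2 _ x.im.2
  have h4 : inner ℝ (x.im : H) (y.im : H) = 0 := y.im.2 _ x.im.2
  change Cplx.quad H (Cplx.map W.subtype x + Cplx.map Wᗮ.subtype y)
    = Cplx.quad H (Cplx.map W.subtype x) + Cplx.quad H (Cplx.map Wᗮ.subtype y)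
  rw [Cplx.quad_apply, Cplx.quad_apply, Cplx.quad_apply]
  apply Complex.ext
  · change inner ℝ ((x.re : H) + y.re) ((x.re : H) + y.re)
        - inner ℝ ((x.im : H) + y.im) ((x.im : H) + y.im)
      = (inner ℝ (x.re : H) (x.re : H) - inner ℝ (x.im : H) (x.im : H))
        + (inner ℝ (y.re : H) (y.re : H) - inner ℝ (y.im : H) (y.im : H))
    rw [inner_add_add_self, inner_add_add_self,
      real_inner_comm (x.re : H) (y.re : H), real_inner_comm (x.im : H) (y.im : H), h1, h4]
    ring
  · change 2 * inner ℝ ((x.re : H) + y.re) ((x.im : H) + y.im)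
      = 2 * inner ℝ (x.re : H) (x.im : H) + 2 * inner ℝ (y.re : H) (y.im : H)
    rw [inner_add_left, inner_add_right, inner_add_right, h2,
      real_inner_comm (x.im : H) (y.re : H), h3]
    ring

theorem comp_mem_gradedHom {i k : ZMod 2} {a : Cl W} (ha : a ∈ Cl.parity W i)
    {T : Spinor J' →L[ℂ] Spinor J} (hT : T ∈ gradedHom W J J' k) :
    cliffordAction J (clIncl W a) ∘L T ∈ gradedHom W J J' (i + k) := by
  refine ⟨fun j s hs => ?_, fun j b hb s => ?_⟩
  · change cliffordAction J (clIncl W a) (T s) ∈ _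
    rw [add_assoc]
    exact cliffordAction_mem_parity J (clIncl_mem_parity W ha) (hT.1 j s hs)
  · change cliffordAction J (clIncl W a) (T (cliffordAction J' b s))
      = _ • cliffordAction J (clIncl Wᗮ b) (cliffordAction J (clIncl W a) (T s))
    have h := congrArg (fun A : Spinor J →L[ℂ] Spinor J => A (T s))
      (congrArg (cliffordAction J) (clIncl_mul_clIncl W ha hb))
    have h' : cliffordAction J (clIncl W a) (cliffordAction J (clIncl Wᗮ b) (T s))
        = ((-1 : ℤˣ) ^ (j * i)) •
          cliffordAction J (clIncl Wᗮ b) (cliffordAction J (clIncl W a) (T s)) := by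
      rcases Int.units_eq_one_or ((-1 : ℤˣ) ^ (j * i)) with e | e <;> rw [e] at h ⊢
      · rw [one_smul, map_mul, map_mul] at h
        rw [one_smul]
        exact h
      · rw [Units.neg_smul, one_smul, map_neg, map_mul, map_mul] at h
        rw [Units.neg_smul, one_smul]
        exact h
    rw [hT.2 j b hb]
    have e : ∀ (u : ℤˣ) (y : Spinor J),
        cliffordAction J (clIncl W a) (u • y) = u • cliffordAction J (clIncl W a) y := by
      intro u y
      rcases Int.units_eq_one_or u with rfl | rfl
      · rw [one_smul, one_smul]
      · rw [Units.neg_smul, one_smul, map_neg, Units.neg_smul, one_smul]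
    rw [e, h', smul_smul, ← uzpow_add]
    congr 2
    ring

/-- Left multiplication by elements of `Cl(W)` preserves `S_W`. -/
theorem comp_mem_spinorHom (a : Cl W) {T : Spinor J' →L[ℂ] Spinor J}
    (hT : T ∈ spinorHom W J J') :
    cliffordAction J (clIncl W a) ∘L T ∈ spinorHom W J J' := by
  have ha : a ∈ Cl.parity W 0 ⊔ Cl.parity W 1 :=
    (CliffordAlgebra.evenOdd_isCompl (Cplx.quad W)).sup_eq_top ▸ Submodule.mem_top
  obtain ⟨a₀, h₀, a₁, h₁, rfl⟩ := Submodule.mem_sup.1 ha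
  obtain ⟨T₀, k₀, T₁, k₁, rfl⟩ := Submodule.mem_sup.1 hT
  rw [map_add, map_add, ContinuousLinearMap.add_comp, ContinuousLinearMap.comp_add,
    ContinuousLinearMap.comp_add]
  exact add_mem
    (add_mem (gradedHom_le W J J' _ (comp_mem_gradedHom W J J' h₀ k₀))
      (gradedHom_le W J J' _ (comp_mem_gradedHom W J J' h₀ k₁)))
    (add_mem (gradedHom_le W J J' _ (comp_mem_gradedHom W J J' h₁ k₀))
      (gradedHom_le W J J' _ (comp_mem_gradedHom W J J' h₁ k₁)))

/-- The action of `Cl(W)` on `S_W`: composition with the action on `S_H`. -/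
def spinorHomAction : Cl W →ₐ[ℂ] Module.End ℂ (spinorHom W J J') where
  toFun a :=
    { toFun := fun T => ⟨cliffordAction J (clIncl W a) ∘L T.1, comp_mem_spinorHom W J J' a T.2⟩
      map_add' := fun S T => Subtype.ext (ContinuousLinearMap.comp_add _ _ _)
      map_smul' := fun c T => Subtype.ext (ContinuousLinearMap.comp_smul _ _ _) }
  map_one' := by ext T s; simp
  map_mul' a b := by ext T s; simp
  map_zero' := by ext T s; simp
  map_add' a b := by ext T s; simp
  commutes' r := by ext T s; simp [Algebra.algebraMap_eq_smul_one]

end Intertwiners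

section SpinorModule

/-- A graded normed space `N` with an action of `Cl(W)` is a spinor module over `Cl(W)`, for `W` a
Euclidean space of even dimension: it is unitarily equivalent to `S_{W,J}` by an equivalence
which intertwines the actions and preserves or reverses the parity, for every orthogonal complex
structure `J` on `W`; and such `J` exist. -/
def IsSpinorModule {W : Type*} [NormedAddCommGroup W] [InnerProductSpace ℝ W]
    {N : Type*} [NormedAddCommGroup N] [NormedSpace ℂ N]
    (act : Cl W →ₐ[ℂ] Module.End ℂ N) (parity : ZMod 2 → Submodule ℂ N) : Prop :=
  Nonempty (OrthComplexStructure W) ∧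
    ∀ J : OrthComplexStructure W, ∃ Φ : Spinor J ≃ₗᵢ[ℂ] N,
      (∀ (a : Cl W) (s : Spinor J), Φ (cliffordAction J a s) = act a (Φ s)) ∧
      ∃ p : ZMod 2, ∀ k, (Spinor.parity J k).map Φ.toLinearEquiv.toLinearMap = parity (p + k)

end SpinorModule

end SpinorModules

end

/-!
The proof translates operators into vectors. An intertwiner `T : S_{H',J'} → S_{H,J}` for `Cl(H')`
is determined by the image `Ω` of the vacuum, which is killed by the annihilation operators of `H'`
(relative to `J'`) on `S_{H,J}`. Conversely each such *vacuum vector* `Ω` is the image of the vacuum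
under an intertwiner, which is `‖Ω‖` times an isometry (`CARRep.exists_isIntertwiner`,
`CARRep.IsIntertwiner.norm_map`). Composition with the grading operator turns odd operators which
commute with `Cl(H')` in the graded sense into operators which commute in the ungraded sense. So the
evaluation at the vacuum identifies `S_W` isometrically with the space of vacuum vectors
(`range_evalVac`), and both nonvanishing claims say that a nonzero vacuum vector exists.

Existence of a vacuum vector is equivalent to the Hilbert–Schmidt condition.

* If `J - J'` is Hilbert–Schmidt, then for an orthonormal sequence `e n` which spans a dense subspace
  of the `+i` eigenspace of `J'`, the sum of the `‖an (e n) vac‖²`, that is, the expected number of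
  `J'`-particles in the vacuum of `S_{H,J}`, is finite. Discarding finitely many `e n` makes it less
  than `1`; then the successive projections of the vacuum to the kernels of the remaining `an (e n)`
  converge to a nonzero vector, and finitely many further annihilation operators always have a common
  kernel (`CARRep.exists_an_eq_zero`, `vacua_ne_bot_of_isHilbertSchmidt`).
* If `Ω` is a nonzero vacuum vector, then `creation p + annihilation q` kills `Ω` for all pairs
  `(p, q)` of projections of a vector of the `-i` eigenspace of `J'` to the eigenspaces of `J`
  (conjugated in the case of `q`), where `p` measures `J - J'`. For a homogeneous `ψ` which is not
  orthogonal to `Ω`, this relation expresses `⟨f, p⟩ ⟨ψ, Ω⟩` by matrix coefficients between vectors of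
  bounded degree. They are square summable over `f` and `p`, because the number operator is bounded
  in each degree (`exists_bound_of_annihilated`, `hsEquiv_of_vacua_ne_bot`).

For the spinor module, let `K` be an orthogonal complex structure on `W`. The space of vacuum vectors
is invariant under `Cl(W)`, and if it is not zero, then finitely many annihilation operators of `W`
have a common kernel in it: there is a unit vector `Ω` which is a vacuum vector for `K ⊕ J'` on all of
`H`. By irreducibility of the Fock space such a vector is unique up to scalars
(`Fock.irreducible`, `exists_eq_smul_of_mem_vacua`), hence homogeneous, as the grading operator
preserves vacuum vectors. It defines an isometry `S_{W,K} → S_{H,J}` of `Cl(W)`-modules into the space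
of vacuum vectors. This isometry is onto, since otherwise the orthogonal complement of its range would
contain another vacuum vector for `K ⊕ J'` (`exists_linearIsometry_range_eq_vacua`).
-/

noncomputable section

namespace SpinorModules

/-! ### The vacuum of a Fock space -/

section FockSpace

variable {V : Type*} [NormedAddCommGroup V] [InnerProductSpace ℂ V]

theorem Fock.induction {P : Fock V → Prop} (hc : IsClosed {s | P s}) (h : ∀ x, P (Fock.of x))
    (s : Fock V) : P s :=
  isClosed_property Fock.denseRange_of hc h s

theorem inner_creation_left (v : V) (s t : Fock V) :
    inner ℂ (creation v s) t = inner ℂ s (annihilation v t) := by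
  refine Fock.induction (P := fun s => inner ℂ (creation v s) t = inner ℂ s (annihilation v t))
    (isClosed_eq (by fun_prop) (by fun_prop)) (fun x => ?_) s
  refine Fock.induction (P := fun t => inner ℂ (creation v (Fock.of x)) t
    = inner ℂ (Fock.of x) (annihilation v t))
    (isClosed_eq (by fun_prop) (by fun_prop)) (fun y => ?_) t
  rw [creation_of, annihilation_of, Fock.of.inner_map_map, Fock.of.inner_map_map, ext_inner_def,
    ext_inner_def, extInner_wedge_left]

theorem adjoint_creation (v : V) :
    ContinuousLinearMap.adjoint (creation v) = annihilation v :=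
  ((ContinuousLinearMap.eq_adjoint_iff _ _).2 fun s t => by
    rw [← inner_conj_symm, ← inner_creation_left, inner_conj_symm]).symm

theorem inner_annihilation_left (v : V) (s t : Fock V) :
    inner ℂ (annihilation v s) t = inner ℂ s (creation v t) := by
  rw [← inner_conj_symm, ← inner_creation_left, inner_conj_symm]

variable (V) in
/-- The vacuum vector `1` of the Fock space. -/
def vac : Fock V := Fock.of 1

theorem norm_vac : ‖vac V‖ = 1 := by
  have h : ((‖(1 : ExteriorAlgebra ℂ V)‖ : ℂ)) ^ 2 = extInner (1 : ExteriorAlgebra ℂ V) 1 :=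
    (inner_self_eq_norm_sq_to_K (𝕜 := ℂ) (1 : ExteriorAlgebra ℂ V)).symm
  have h1 : extInner (1 : ExteriorAlgebra ℂ V) 1 = 1 := by
    have := extInner_algebraMap_right (1 : ExteriorAlgebra ℂ V) 1
    simpa [ExteriorAlgebra.algebraMapInv] using this
  rw [h1] at h
  have h2 : ‖(1 : ExteriorAlgebra ℂ V)‖ ^ 2 = 1 := by exact_mod_cast h
  rw [vac, Fock.of.norm_map]
  nlinarith [norm_nonneg (1 : ExteriorAlgebra ℂ V)]

theorem vac_ne_zero : vac V ≠ 0 := fun h => by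
  have := norm_vac (V := V)
  rw [h, norm_zero] at this
  exact zero_ne_one this

theorem annihilation_vac (v : V) : annihilation v (vac V) = 0 := by
  rw [vac, annihilation_of, contract_one, map_zero]

theorem Fock.of_algebraMap (r : ℂ) : Fock.of (algebraMap ℂ (ExteriorAlgebra ℂ V) r) = r • vac V := by
  rw [Algebra.algebraMap_eq_smul_one, map_smul, vac]

/-- A vector killed by all annihilation operators and orthogonal to the vacuum is zero. -/
theorem eq_zero_of_annihilation {s : Fock V} (hs : ∀ v, annihilation v s = 0)
    (h0 : inner ℂ (vac V) s = 0) : s = 0 := by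
  have key : ∀ t : Fock V, inner ℂ t s = 0 := by
    refine Fock.induction (isClosed_eq (by fun_prop) (by fun_prop)) fun x => ?_
    induction x using exterior_induction with
    | h0 r => rw [Fock.of_algebraMap, inner_smul_left, h0, mul_zero]
    | hadd x y hx hy => rw [map_add, inner_add_left, hx, hy, add_zero]
    | hw v x _ => rw [← creation_of, inner_creation_left, hs, inner_zero_right]
  exact inner_self_eq_zero.1 (key s)

theorem eq_smul_vac {s : Fock V} (hs : ∀ v, annihilation v s = 0) :
    s = inner ℂ (vac V) s • vac V := by
  refine sub_eq_zero.1 (eq_zero_of_annihilation (fun v => ?_) ?_)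
  · rw [map_sub, map_smul, hs, annihilation_vac, smul_zero, sub_zero]
  · rw [inner_sub_right, inner_smul_right, inner_self_eq_norm_sq_to_K, norm_vac]
    simp

/-- The Fock space is irreducible: a closed subspace which is invariant under all creation and
annihilation operators is trivial. For the components of the vacuum in the subspace and in its
orthogonal complement are both killed by all annihilation operators, so they are multiples of the
vacuum, and one of the two subspaces contains the vacuum. -/
theorem Fock.irreducible {M : Submodule ℂ (Fock V)} (hM : IsClosed (M : Set (Fock V)))
    (h0 : M ≠ ⊥) (hc : ∀ v, ∀ s ∈ M, creation v s ∈ M) (ha : ∀ v, ∀ s ∈ M, annihilation v s ∈ M) :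
    M = ⊤ := by
  have hvac : ∀ N : Submodule ℂ (Fock V), IsClosed (N : Set (Fock V)) →
      (∀ v, ∀ s ∈ N, creation v s ∈ N) → vac V ∈ N → N = ⊤ := by
    intro N hN hcN hv
    refine eq_top_iff.2 fun s _ => ?_
    refine Fock.induction (P := fun s => s ∈ N) hN (fun x => ?_) s
    induction x using exterior_induction with
    | h0 r => rw [Fock.of_algebraMap]; exact N.smul_mem r hv
    | hadd x y hx hy => rw [map_add]; exact add_mem hx hy
    | hw v x hx => rw [← creation_of]; exact hcN v _ hx
  have : CompleteSpace M := hM.completeSpace_coe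
  have hc' : ∀ v, ∀ s ∈ Mᗮ, creation v s ∈ Mᗮ := fun v s hs t ht => by
    rw [← inner_annihilation_left]; exact hs _ (ha v t ht)
  have ha' : ∀ v, ∀ s ∈ Mᗮ, annihilation v s ∈ Mᗮ := fun v s hs t ht => by
    rw [← inner_creation_left]; exact hs _ (hc v t ht)
  obtain ⟨m, hm, n, hn, hmn⟩ := M.exists_add_mem_mem_orthogonal (vac V)
  have hz : ∀ v, annihilation v m = 0 := by
    intro v
    have h1 : annihilation v m + annihilation v n = 0 := by
      rw [← map_add, ← hmn, annihilation_vac]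
    have h2 : annihilation v m ∈ Mᗮ := by
      rw [eq_neg_of_add_eq_zero_left h1]; exact neg_mem (ha' v n hn)
    exact inner_self_eq_zero.1 (h2 _ (ha v m hm))
  have hm' := eq_smul_vac hz
  by_cases hl : inner ℂ (vac V) m = 0
  · rw [hl, zero_smul] at hm'
    rw [hm', zero_add] at hmn
    have := hvac Mᗮ M.isClosed_orthogonal hc' (hmn ▸ hn)
    exact absurd (by rw [← M.orthogonal_orthogonal, this, Submodule.top_orthogonal_eq_bot]) h0
  · refine hvac M hM hc ?_
    rw [hm'] at hm
    exact (M.smul_mem_iff hl).1 hm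

end FockSpace

/-! ### Representations of the canonical anticommutation relations -/

section CAR

variable (V S : Type*) [NormedAddCommGroup V] [InnerProductSpace ℂ V]
  [NormedAddCommGroup S] [InnerProductSpace ℂ S] [CompleteSpace S]

/-- A representation on the Hilbert space `S` of the canonical anticommutation relations over `V`:
creation operators depending linearly on `v : V`, which together with their adjoints satisfy the
relations of exterior multiplication and contraction. -/
structure CARRep where
  cr : V →ₗ[ℂ] (S →L[ℂ] S)
  cr_cr : ∀ v s, cr v (cr v s) = 0
  adjoint_cr_cr : ∀ v w s, ContinuousLinearMap.adjoint (cr v) (cr w s)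
    + cr w (ContinuousLinearMap.adjoint (cr v) s) = inner ℂ v w • s

namespace CARRep

variable {V S} (R : CARRep V S)

/-- The annihilation operators, adjoint to the creation operators. -/
def an (v : V) : S →L[ℂ] S := ContinuousLinearMap.adjoint (R.cr v)

theorem inner_cr_left (v : V) (s t : S) : inner ℂ (R.cr v s) t = inner ℂ s (R.an v t) :=
  (ContinuousLinearMap.adjoint_inner_right _ _ _).symm

theorem inner_an_left (v : V) (s t : S) : inner ℂ (R.an v s) t = inner ℂ s (R.cr v t) :=
  ContinuousLinearMap.adjoint_inner_left _ _ _

theorem an_cr (v w : V) (s : S) : R.an v (R.cr w s) = inner ℂ v w • s - R.cr w (R.an v s) :=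
  eq_sub_of_add_eq (R.adjoint_cr_cr v w s)

/-- The vectors killed by all annihilation operators. -/
def vacua : Submodule ℂ S where
  carrier := {s | ∀ v, R.an v s = 0}
  add_mem' := fun hs ht v => by rw [map_add, hs v, ht v, add_zero]
  zero_mem' := fun v => map_zero _
  smul_mem' := fun c s hs v => by rw [map_smul, hs v, smul_zero]

theorem mem_vacua {s : S} : s ∈ R.vacua ↔ ∀ v, R.an v s = 0 := Iff.rfl

/-- The bounded operators from the Fock space to `S` which intertwine the creation operators and
the annihilation operators. -/
structure IsIntertwiner (T : Fock V →L[ℂ] S) : Prop where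
  map_creation : ∀ v s, T (creation v s) = R.cr v (T s)
  map_annihilation : ∀ v s, T (annihilation v s) = R.an v (T s)

/-- Both sides transform in the same way when a factor of `y` is moved to the other side of the
inner product as a contraction, so it is enough to compare them on the scalars. -/
theorem inner_map_map_of_wedge {f g : ExteriorAlgebra ℂ V →ₗ[ℂ] S}
    (hf : ∀ v x, f (wedge v x) = R.cr v (f x)) (hf' : ∀ v x, f (contract v x) = R.an v (f x))
    (hg : ∀ v x, g (wedge v x) = R.cr v (g x)) (hg' : ∀ v x, g (contract v x) = R.an v (g x))
    (x y : ExteriorAlgebra ℂ V) :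
    inner ℂ (f x) (g y) = inner ℂ (f 1) (g 1) * extInner x y := by
  induction y using exterior_induction generalizing x with
  | h0 r =>
    induction x using exterior_induction with
    | h0 s =>
      rw [extInner_algebraMap_right, Algebra.algebraMap_eq_smul_one,
        Algebra.algebraMap_eq_smul_one, map_smul, map_smul, inner_smul_left, inner_smul_right]
      simp [ExteriorAlgebra.algebraMapInv]
      ring
    | hadd a b ha hb => rw [map_add, inner_add_left, ha, hb, extInner_add_left, mul_add]
    | hw v x _ =>
      rw [hf, inner_cr_left, ← hg', extInner_wedge_left, contract_algebraMap]
      simp [extInner]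
  | hadd a b ha hb => rw [map_add, inner_add_right, ha, hb, extInner_add_right, mul_add]
  | hw v y ih => rw [hg, ← inner_an_left, ← hf', ih, extInner_wedge_right]

/-- Intertwiners are multiples of isometries, and they are determined by the image of the
vacuum. -/
theorem IsIntertwiner.inner_map_map {T T' : Fock V →L[ℂ] S} (hT : R.IsIntertwiner T)
    (hT' : R.IsIntertwiner T') (s t : Fock V) :
    inner ℂ (T s) (T' t) = inner ℂ (T (vac V)) (T' (vac V)) * inner ℂ s t := by
  refine Fock.induction (P := fun s => inner ℂ (T s) (T' t)
    = inner ℂ (T (vac V)) (T' (vac V)) * inner ℂ s t)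
    (isClosed_eq (by fun_prop) (by fun_prop)) (fun x => ?_) s
  refine Fock.induction (P := fun t => inner ℂ (T (Fock.of x)) (T' t)
    = inner ℂ (T (vac V)) (T' (vac V)) * inner ℂ (Fock.of x) t)
    (isClosed_eq (by fun_prop) (by fun_prop)) (fun y => ?_) t
  rw [Fock.of.inner_map_map]
  exact R.inner_map_map_of_wedge (f := T.toLinearMap ∘ₗ Fock.of.toLinearMap)
    (g := T'.toLinearMap ∘ₗ Fock.of.toLinearMap)
    (fun v x => (congrArg T (creation_of v x).symm).trans (hT.map_creation v _))
    (fun v x => (congrArg T (annihilation_of v x).symm).trans (hT.map_annihilation v _))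
    (fun v x => (congrArg T' (creation_of v x).symm).trans (hT'.map_creation v _))
    (fun v x => (congrArg T' (annihilation_of v x).symm).trans (hT'.map_annihilation v _)) x y

variable {R}

theorem IsIntertwiner.norm_map {T : Fock V →L[ℂ] S} (hT : R.IsIntertwiner T) (s : Fock V) :
    ‖T s‖ = ‖T (vac V)‖ * ‖s‖ := by
  have h := hT.inner_map_map R hT s s
  simp only [inner_self_eq_norm_sq_to_K] at h
  have h2 : ‖T s‖ ^ 2 = (‖T (vac V)‖ * ‖s‖) ^ 2 := by
    rw [mul_pow]; exact_mod_cast h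
  exact (sq_eq_sq₀ (norm_nonneg _) (by positivity)).1 h2

theorem IsIntertwiner.sub {T T' : Fock V →L[ℂ] S} (hT : R.IsIntertwiner T)
    (hT' : R.IsIntertwiner T') : R.IsIntertwiner (T - T') where
  map_creation v s := by
    rw [sub_apply, sub_apply, hT.map_creation, hT'.map_creation, map_sub]
  map_annihilation v s := by
    rw [sub_apply, sub_apply, hT.map_annihilation, hT'.map_annihilation, map_sub]

theorem IsIntertwiner.ext {T T' : Fock V →L[ℂ] S} (hT : R.IsIntertwiner T)
    (hT' : R.IsIntertwiner T') (h : T (vac V) = T' (vac V)) : T = T' := by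
  refine ContinuousLinearMap.ext fun s => sub_eq_zero.1 (norm_eq_zero.1 ?_)
  have := (hT.sub hT').norm_map s
  rwa [sub_apply, sub_apply, h, sub_self, norm_zero, zero_mul] at this

theorem IsIntertwiner.map_vac_mem {T : Fock V →L[ℂ] S} (hT : R.IsIntertwiner T) :
    T (vac V) ∈ R.vacua := fun v => by
  rw [← hT.map_annihilation, annihilation_vac, map_zero]

variable (R) in
theorem isClosed_vacua : IsClosed (R.vacua : Set S) := by
  have : (R.vacua : Set S) = ⋂ v, {s | R.an v s = 0} := by
    ext s
    simp only [SetLike.mem_coe, mem_vacua, Set.mem_iInter]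
    rfl
  rw [this]
  exact isClosed_iInter fun v => isClosed_eq (R.an v).continuous continuous_const

/-- The range of an intertwiner is contained in every closed subspace which is invariant under the
creation operators and contains the image of the vacuum. -/
theorem IsIntertwiner.range_le {T : Fock V →L[ℂ] S} (hT : R.IsIntertwiner T) {M : Submodule ℂ S}
    (hM : IsClosed (M : Set S)) (h : T (vac V) ∈ M) (hc : ∀ v, ∀ s ∈ M, R.cr v s ∈ M) :
    LinearMap.range T.toLinearMap ≤ M := by
  rintro _ ⟨s, rfl⟩
  refine Fock.induction (P := fun s => T s ∈ M) (hM.preimage T.continuous) (fun x => ?_) s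
  induction x using exterior_induction with
  | h0 r => rw [Fock.of_algebraMap, map_smul]; exact M.smul_mem r h
  | hadd x y hx hy => rw [map_add, map_add]; exact add_mem hx hy
  | hw v x hx => rw [← creation_of, hT.map_creation]; exact hc v _ hx

variable (R) in
/-- Every vector killed by the annihilation operators is the image of the vacuum under an
intertwiner: apply the creation operators of the representation to it. -/
theorem exists_isIntertwiner {Ω : S} (hΩ : Ω ∈ R.vacua) :
    ∃ T, R.IsIntertwiner T ∧ T (vac V) = Ω := by
  let L : ExteriorAlgebra ℂ V →ₐ[ℂ] (S →L[ℂ] S) :=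
    ExteriorAlgebra.lift ℂ ⟨R.cr, fun v => ContinuousLinearMap.ext fun s => R.cr_cr v s⟩
  let f : ExteriorAlgebra ℂ V →ₗ[ℂ] S :=
    (ContinuousLinearMap.apply ℂ S Ω).toLinearMap ∘ₗ L.toLinearMap
  have f1 : f 1 = Ω := by
    change L 1 Ω = Ω
    rw [map_one]; rfl
  have fw : ∀ v x, f (wedge v x) = R.cr v (f x) := fun v x => by
    change L (ExteriorAlgebra.ι ℂ v * x) Ω = R.cr v (L x Ω)
    rw [map_mul, ExteriorAlgebra.lift_ι_apply]; rfl
  have fa : ∀ r, f (algebraMap ℂ _ r) = r • Ω := fun r => by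
    rw [Algebra.algebraMap_eq_smul_one, map_smul, f1]
  have fc : ∀ v x, f (contract v x) = R.an v (f x) := fun v x => by
    induction x using exterior_induction with
    | h0 r => rw [contract_algebraMap, map_zero, fa, map_smul, hΩ v, smul_zero]
    | hadd x y hx hy => rw [map_add, map_add, hx, hy, map_add, map_add]
    | hw w x ih => rw [contract_wedge, map_sub, map_smul, fw, fw, ih, an_cr]
  have hn : ∀ x, ‖f x‖ ≤ ‖Ω‖ * ‖Fock.of x‖ := fun x => by
    have h := R.inner_map_map_of_wedge fw fc fw fc x x
    rw [← ext_inner_def, f1, inner_self_eq_norm_sq_to_K, inner_self_eq_norm_sq_to_K,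
      inner_self_eq_norm_sq_to_K] at h
    have h2 : ‖f x‖ ^ 2 = (‖Ω‖ * ‖x‖) ^ 2 := by
      rw [mul_pow]; exact_mod_cast h
    rw [Fock.of.norm_map]
    exact ((sq_eq_sq₀ (norm_nonneg _) (by positivity)).1 h2).le
  let T : Fock V →L[ℂ] S := f.extendOfNorm Fock.of.toLinearMap
  have hT : ∀ x, T (Fock.of x) = f x := fun x =>
    LinearMap.extendOfNorm_eq (e := Fock.of.toLinearMap) Fock.denseRange_of ⟨‖Ω‖, hn⟩ x
  refine ⟨T, ⟨fun v => ?_, fun v => ?_⟩, (hT 1).trans f1⟩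
  · refine Fock.induction (isClosed_eq (by fun_prop) (by fun_prop)) fun x => ?_
    rw [creation_of, hT, hT, fw]
  · refine Fock.induction (isClosed_eq (by fun_prop) (by fun_prop)) fun x => ?_
    rw [annihilation_of, hT, hT, fc]

end CARRep

end CAR

/-! ### The grading operator of a Fock space -/

section Grading

variable {V : Type*} [NormedAddCommGroup V] [InnerProductSpace ℂ V]

variable (V) in
/-- The representation on the Fock space in which the sign of all operators is changed. The grading
operator is its intertwiner which fixes the vacuum. -/
def negRep : CARRep V (Fock V) where
  cr := -
    { toFun := creation
      map_add' := creation_add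
      map_smul' := creation_smul }
  cr_cr v s := by
    change -creation v (-creation v s) = 0
    rw [map_neg, creation_creation, neg_neg]
  adjoint_cr_cr v w s := by
    have h : ContinuousLinearMap.adjoint (-creation v) = -annihilation v := by
      rw [map_neg, adjoint_creation]
    change ContinuousLinearMap.adjoint (-creation v) (-creation w s)
      + -creation w (ContinuousLinearMap.adjoint (-creation v) s) = _
    rw [h, ← annihilation_creation, neg_apply, neg_apply, map_neg, map_neg, neg_neg, neg_neg]

theorem vac_mem_vacua_negRep : vac V ∈ (negRep V).vacua := fun v => by
  change ContinuousLinearMap.adjoint (-creation v) _ = 0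
  rw [map_neg, adjoint_creation, neg_apply, annihilation_vac, neg_zero]

variable (V) in
/-- The grading operator: it fixes the vacuum and anticommutes with the creation and annihilation
operators. -/
def grading : Fock V →L[ℂ] Fock V :=
  ((negRep V).exists_isIntertwiner vac_mem_vacua_negRep).choose

theorem isIntertwiner_grading : (negRep V).IsIntertwiner (grading V) :=
  ((negRep V).exists_isIntertwiner vac_mem_vacua_negRep).choose_spec.1

theorem grading_vac : grading V (vac V) = vac V :=
  ((negRep V).exists_isIntertwiner vac_mem_vacua_negRep).choose_spec.2

theorem grading_creation (v : V) (s : Fock V) :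
    grading V (creation v s) = -creation v (grading V s) :=
  isIntertwiner_grading.map_creation v s

theorem grading_annihilation (v : V) (s : Fock V) :
    grading V (annihilation v s) = -annihilation v (grading V s) := by
  refine (isIntertwiner_grading.map_annihilation v s).trans ?_
  change ContinuousLinearMap.adjoint (-creation v) _ = _
  rw [map_neg, adjoint_creation, neg_apply]

theorem inner_grading_grading (s t : Fock V) :
    inner ℂ (grading V s) (grading V t) = inner ℂ s t := by
  rw [isIntertwiner_grading.inner_map_map (negRep V) isIntertwiner_grading, grading_vac,
    inner_self_eq_norm_sq_to_K, norm_vac]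
  simp

theorem norm_grading (s : Fock V) : ‖grading V s‖ = ‖s‖ := by
  rw [isIntertwiner_grading.norm_map, grading_vac, norm_vac, one_mul]

theorem grading_of (x : ExteriorAlgebra ℂ V) :
    grading V (Fock.of x)
      = Fock.of (CliffordAlgebra.involute (Q := (0 : QuadraticForm ℂ V)) x) := by
  induction x using exterior_induction with
  | h0 r =>
    rw [Fock.of_algebraMap, map_smul, grading_vac]
    exact (Fock.of_algebraMap r).symm.trans
      (congrArg Fock.of ((CliffordAlgebra.involute (Q := (0 : QuadraticForm ℂ V))).commutes r).symm)
  | hadd x y hx hy =>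
    rw [map_add, map_add, hx, hy, ← map_add]
    exact congrArg Fock.of (map_add (CliffordAlgebra.involute (Q := (0 : QuadraticForm ℂ V))) x y).symm
  | hw v x ih =>
    rw [← creation_of, grading_creation, ih, creation_of, ← map_neg]
    refine congrArg Fock.of ?_
    refine Eq.trans ?_ (map_mul (CliffordAlgebra.involute (Q := (0 : QuadraticForm ℂ V)))
      (CliffordAlgebra.ι _ v) x).symm
    rw [CliffordAlgebra.involute_ι, neg_mul]
    rfl

theorem grading_grading (s : Fock V) : grading V (grading V s) = s := by
  refine Fock.induction (P := fun s => grading V (grading V s) = s)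
    (isClosed_eq (by fun_prop) (by fun_prop)) (fun x => ?_) s
  rw [grading_of, grading_of]
  exact congrArg Fock.of (CliffordAlgebra.involute_involute (Q := (0 : QuadraticForm ℂ V)) x)

/-- The even and odd spinors are the eigenvectors of the grading operator. -/
theorem mem_parity_iff {k : ZMod 2} {s : Fock V} :
    s ∈ Fock.parity V k ↔ grading V s = (-1 : ℤˣ) ^ k • s := by
  have h01 : ∀ k : ZMod 2, k = 0 ∨ k = 1 := by decide
  have hsum : ∀ x : ExteriorAlgebra ℂ V, ∃ a ∈ CliffordAlgebra.evenOdd (0 : QuadraticForm ℂ V) 0,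
      ∃ b ∈ CliffordAlgebra.evenOdd (0 : QuadraticForm ℂ V) 1, a + b = x := fun x =>
    Submodule.mem_sup.1
      ((CliffordAlgebra.evenOdd_isCompl (0 : QuadraticForm ℂ V)).sup_eq_top ▸ Submodule.mem_top)
  have h0 : ∀ x ∈ CliffordAlgebra.evenOdd (0 : QuadraticForm ℂ V) 0,
      grading V (Fock.of x) = Fock.of x := fun x hx => by
    rw [grading_of]
    exact congrArg Fock.of (CliffordAlgebra.involute_eq_of_mem_even hx)
  have h1 : ∀ x ∈ CliffordAlgebra.evenOdd (0 : QuadraticForm ℂ V) 1,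
      grading V (Fock.of x) = -Fock.of x := fun x hx => by
    rw [grading_of, ← map_neg]
    exact congrArg Fock.of (CliffordAlgebra.involute_eq_of_mem_odd hx)
  constructor
  · intro hs
    refine closure_minimal (t := {s | grading V s = (-1 : ℤˣ) ^ k • s}) ?_ ?_ hs
    · rintro _ ⟨x, hx, rfl⟩
      rcases h01 k with rfl | rfl
      · change grading V (Fock.of x) = (-1 : ℤˣ) ^ (0 : ZMod 2) • Fock.of x
        rw [uzpow_zero, one_smul]
        exact h0 x hx
      · change grading V (Fock.of x) = (-1 : ℤˣ) ^ (1 : ZMod 2) • Fock.of x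
        rw [uzpow_one, Units.neg_smul, one_smul]
        exact h1 x hx
    · rcases h01 k with rfl | rfl
      · simp only [uzpow_zero, one_smul]
        exact isClosed_eq (by fun_prop) (by fun_prop)
      · simp only [uzpow_one, Units.neg_smul, one_smul]
        exact isClosed_eq (by fun_prop) (by fun_prop)
  · intro hs
    rcases h01 k with rfl | rfl
    · rw [uzpow_zero, one_smul] at hs
      have hs' : ((1 / 2 : ℂ) • (ContinuousLinearMap.id ℂ (Fock V) + grading V)) s = s := by
        rw [smul_apply, add_apply, ContinuousLinearMap.id_apply, hs]; module
      rw [← hs']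
      refine map_mem_closure (ContinuousLinearMap.continuous _) (Fock.denseRange_of s) ?_
      rintro _ ⟨x, rfl⟩
      obtain ⟨a, ha, b, hb, rfl⟩ := hsum x
      refine ⟨a, ha, ?_⟩
      change Fock.of a = (1 / 2 : ℂ) • (Fock.of (a + b) + grading V (Fock.of (a + b)))
      rw [map_add, map_add, h0 a ha, h1 b hb]; module
    · rw [uzpow_one, Units.neg_smul, one_smul] at hs
      have hs' : ((1 / 2 : ℂ) • (ContinuousLinearMap.id ℂ (Fock V) - grading V)) s = s := by
        rw [smul_apply, sub_apply, ContinuousLinearMap.id_apply, hs]; module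
      rw [← hs']
      refine map_mem_closure (ContinuousLinearMap.continuous _) (Fock.denseRange_of s) ?_
      rintro _ ⟨x, rfl⟩
      obtain ⟨a, ha, b, hb, rfl⟩ := hsum x
      refine ⟨b, hb, ?_⟩
      change Fock.of b = (1 / 2 : ℂ) • (Fock.of (a + b) - grading V (Fock.of (a + b)))
      rw [map_add, map_add, h0 a ha, h1 b hb]; module

theorem vac_mem_parity : vac V ∈ Fock.parity V 0 := by
  rw [mem_parity_iff, grading_vac, uzpow_zero, one_smul]

/-- The even and odd components of a spinor. -/
theorem exists_add_mem_parity (s : Fock V) :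
    (1 / 2 : ℂ) • (s + grading V s) ∈ Fock.parity V 0 ∧
      (1 / 2 : ℂ) • (s - grading V s) ∈ Fock.parity V 1 := by
  constructor
  · rw [mem_parity_iff, uzpow_zero, one_smul, map_smul, map_add, grading_grading]; module
  · rw [mem_parity_iff, uzpow_one, Units.neg_smul, one_smul, map_smul, map_sub, grading_grading]
    module

theorem inner_eq_zero_of_mem_parity {s t : Fock V} (hs : s ∈ Fock.parity V 0)
    (ht : t ∈ Fock.parity V 1) : inner ℂ s t = 0 := by
  rw [mem_parity_iff, uzpow_zero, one_smul] at hs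
  rw [mem_parity_iff, uzpow_one, Units.neg_smul, one_smul] at ht
  have h := inner_grading_grading s t
  rw [hs, ht, inner_neg_right] at h
  linear_combination (-1 / 2 : ℂ) * h

end Grading

/-! ### Bessel families and the number operator -/

section Degree

variable {V : Type*} [NormedAddCommGroup V] [InnerProductSpace ℂ V]

/-- A finite family of vectors which satisfies Bessel's inequality, for example the image of an
orthonormal family under a contraction. -/
def IsBessel {ι : Type*} [Fintype ι] (v : ι → V) : Prop :=
  ∀ z, ∑ i, ‖inner ℂ (v i) z‖ ^ 2 ≤ ‖z‖ ^ 2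

theorem _root_.Orthonormal.isBessel {ι : Type*} [Fintype ι] {v : ι → V} (hv : Orthonormal ℂ v) :
    IsBessel v := fun z => hv.sum_inner_products_le z

theorem exists_orthonormal_span_eq (K : Submodule ℂ V) [FiniteDimensional ℂ K] :
    ∃ u : Fin (Module.finrank ℂ K) → V, Orthonormal ℂ u ∧ Submodule.span ℂ (Set.range u) = K := by
  refine ⟨fun j => (stdOrthonormalBasis ℂ K j : V),
    (stdOrthonormalBasis ℂ K).orthonormal.comp_linearIsometry K.subtypeₗᵢ, ?_⟩
  have : Set.range (fun j => (stdOrthonormalBasis ℂ K j : V))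
      = K.subtype '' Set.range (stdOrthonormalBasis ℂ K) := by
    ext v; simp
  rw [this, Submodule.span_image, ← (stdOrthonormalBasis ℂ K).coe_toBasis,
    (stdOrthonormalBasis ℂ K).toBasis.span_eq, Submodule.map_top, Submodule.range_subtype]

theorem _root_.Orthonormal.sum_inner_smul {κ : Type*} [Fintype κ] {u : κ → V}
    (hu : Orthonormal ℂ u) {v : V} (hv : v ∈ Submodule.span ℂ (Set.range u)) :
    ∑ j, inner ℂ (u j) v • u j = v := by
  induction hv using Submodule.span_induction with
  | mem v hv =>
    obtain ⟨i, rfl⟩ := hv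
    classical
    simp [orthonormal_iff_ite.1 hu]
  | zero => simp
  | add v w _ _ hv hw => simp only [inner_add_right, add_smul, Finset.sum_add_distrib, hv, hw]
  | smul c v _ hv => simp only [inner_smul_right, mul_smul, ← Finset.smul_sum, hv]

theorem _root_.Orthonormal.sum_norm_inner_sq {κ : Type*} [Fintype κ] {u : κ → V}
    (hu : Orthonormal ℂ u) {v : V} (hv : v ∈ Submodule.span ℂ (Set.range u)) :
    ∑ j, ‖inner ℂ (u j) v‖ ^ 2 = ‖v‖ ^ 2 := by
  have h : inner ℂ v (∑ j, inner ℂ (u j) v • u j) = inner ℂ v v := by rw [hu.sum_inner_smul hv]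
  rw [inner_sum, inner_self_eq_norm_sq_to_K] at h
  have h2 : ∀ j, inner ℂ v (inner ℂ (u j) v • u j) = ((‖inner ℂ (u j) v‖ ^ 2 : ℝ) : ℂ) := fun j => by
    rw [inner_smul_right, ← inner_conj_symm v, Complex.mul_conj, Complex.normSq_eq_norm_sq]
  rw [Finset.sum_congr rfl fun j _ => h2 j, ← Complex.ofReal_sum] at h
  refine Complex.ofReal_injective (h.trans ?_)
  rw [Complex.ofReal_pow]
  rfl

/-- The matrix of inner products of a Bessel family with an orthonormal family is a contraction,
also when it acts on families of vectors of an inner product space. -/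
theorem IsBessel.sum_norm_sq_le {E : Type*} [NormedAddCommGroup E] [InnerProductSpace ℂ E]
    {ι κ : Type*} [Fintype ι] [Fintype κ] {v : ι → V} (hv : IsBessel v) {u : κ → V}
    (hu : Orthonormal ℂ u) (y : κ → E) :
    ∑ i, ‖∑ j, inner ℂ (v i) (u j) • y j‖ ^ 2 ≤ ∑ j, ‖y j‖ ^ 2 := by
  have : FiniteDimensional ℂ (Submodule.span ℂ (Set.range y)) :=
    FiniteDimensional.span_of_finite ℂ (Set.finite_range y)
  -- in coordinates with respect to an orthonormal basis `b` of the span of the `y j`, this is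
  -- Bessel's inequality for each coordinate
  obtain ⟨b, hb, hbs⟩ := exists_orthonormal_span_eq (Submodule.span ℂ (Set.range y))
  have hy : ∀ j, y j ∈ Submodule.span ℂ (Set.range b) := fun j => by
    rw [hbs]; exact Submodule.subset_span ⟨j, rfl⟩
  have hl : ∀ l, ∑ i, ‖inner ℂ (b l) (∑ j, inner ℂ (v i) (u j) • y j)‖ ^ 2
      ≤ ∑ j, ‖inner ℂ (b l) (y j)‖ ^ 2 := fun l => by
    have hz := hv (∑ j, inner ℂ (b l) (y j) • u j)
    have hn : ‖∑ j, inner ℂ (b l) (y j) • u j‖ ^ 2 = ∑ j, ‖inner ℂ (b l) (y j)‖ ^ 2 := by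
      rw [← hu.sum_norm_inner_sq (Submodule.sum_mem _ fun j _ =>
        Submodule.smul_mem _ _ (Submodule.subset_span ⟨j, rfl⟩))]
      refine Finset.sum_congr rfl fun j _ => ?_
      rw [hu.inner_right_fintype]
    rw [hn] at hz
    refine le_trans (le_of_eq ?_) hz
    refine Finset.sum_congr rfl fun i _ => ?_
    simp only [inner_sum, inner_smul_right, mul_comm]
  have h1 : ∀ i, ‖∑ j, inner ℂ (v i) (u j) • y j‖ ^ 2
      = ∑ l, ‖inner ℂ (b l) (∑ j, inner ℂ (v i) (u j) • y j)‖ ^ 2 := fun i =>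
    (hb.sum_norm_inner_sq (Submodule.sum_mem _ fun j _ => Submodule.smul_mem _ _ (hy j))).symm
  have h2 : ∀ j, ‖y j‖ ^ 2 = ∑ l, ‖inner ℂ (b l) (y j)‖ ^ 2 := fun j =>
    (hb.sum_norm_inner_sq (hy j)).symm
  rw [Finset.sum_congr rfl fun i _ => h1 i, Finset.sum_congr rfl fun j _ => h2 j, Finset.sum_comm,
    Finset.sum_comm (s := (Finset.univ : Finset κ))]
  exact Finset.sum_le_sum fun l _ => hl l

theorem wedge_comm (v w : V) (x : ExteriorAlgebra ℂ V) :
    wedge v (wedge w x) = -wedge w (wedge v x) := by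
  have h := wedge_wedge (v + w) x
  simp only [wedge_add, map_add, wedge_wedge, zero_add, add_zero] at h
  exact eq_neg_of_add_eq_zero_left (by rw [add_comm]; exact h)

theorem sum_smul_wedge {κ : Type*} [Fintype κ] (c : κ → ℂ) (u : κ → V)
    (x : ExteriorAlgebra ℂ V) : ∑ j, c j • wedge (u j) x = wedge (∑ j, c j • u j) x := by
  simp [wedge, Finset.sum_mul]

theorem sum_smul_contract {κ : Type*} [Fintype κ] (c : κ → ℂ) (u : κ → V)
    (x : ExteriorAlgebra ℂ V) :
    ∑ j, starRingEnd ℂ (c j) • contract (u j) x = contract (∑ j, c j • u j) x := by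
  simp [contract]

/-- The number operator of a finite orthonormal family. -/
def number {κ : Type*} [Fintype κ] (u : κ → V) (x : ExteriorAlgebra ℂ V) : ExteriorAlgebra ℂ V :=
  ∑ j, wedge (u j) (contract (u j) x)

theorem number_wedge {κ : Type*} [Fintype κ] {u : κ → V} (hu : Orthonormal ℂ u) {v : V}
    (hv : v ∈ Submodule.span ℂ (Set.range u)) (x : ExteriorAlgebra ℂ V) :
    number u (wedge v x) = wedge v x + wedge v (number u x) := by
  have h : ∀ j, wedge (u j) (contract (u j) (wedge v x))
      = inner ℂ (u j) v • wedge (u j) x + wedge v (wedge (u j) (contract (u j) x)) := fun j => by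
    rw [contract_wedge, map_sub, map_smul, wedge_comm (u j) v, sub_neg_eq_add]
  simp only [number, h, Finset.sum_add_distrib, sum_smul_wedge, hu.sum_inner_smul hv, map_sum]

theorem number_contract {κ : Type*} [Fintype κ] {u : κ → V} (hu : Orthonormal ℂ u) {v : V}
    (hv : v ∈ Submodule.span ℂ (Set.range u)) (x : ExteriorAlgebra ℂ V) :
    number u (contract v x) = contract v (number u x) - contract v x := by
  have h : ∀ j, contract v (wedge (u j) (contract (u j) x))
      = starRingEnd ℂ (inner ℂ (u j) v) • contract (u j) x
        + wedge (u j) (contract (u j) (contract v x)) := fun j => by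
    rw [contract_wedge, contract_comm v (u j), map_neg, sub_neg_eq_add, inner_conj_symm]
  simp only [number, map_sum, h, Finset.sum_add_distrib, sum_smul_contract, hu.sum_inner_smul hv]
  abel

variable (V) in
/-- The homogeneous elements of degree `k` of the exterior algebra, encoded as the eigenvectors for the
eigenvalue `k` of the number operators of all sufficiently large finite orthonormal families. -/
def degree (k : ℕ) : Submodule ℂ (ExteriorAlgebra ℂ V) where
  carrier := {x | ∃ K : Submodule ℂ V, FiniteDimensional ℂ K ∧ ∀ (n : ℕ) (u : Fin n → V),
    Orthonormal ℂ u → K ≤ Submodule.span ℂ (Set.range u) → number u x = (k : ℂ) • x}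
  add_mem' := by
    rintro x y ⟨K, hK, hx⟩ ⟨L, hL, hy⟩
    refine ⟨K ⊔ L, inferInstance, fun n u hu h => ?_⟩
    have := hx n u hu (le_sup_left.trans h)
    have := hy n u hu (le_sup_right.trans h)
    simp_all [number, Finset.sum_add_distrib]
  zero_mem' := ⟨⊥, inferInstance, fun n u _ _ => by simp [number]⟩
  smul_mem' := by
    rintro c x ⟨K, hK, hx⟩
    refine ⟨K, hK, fun n u hu h => ?_⟩
    have := hx n u hu h
    simp only [number] at this
    simp only [number, map_smul, ← Finset.smul_sum, this, smul_comm c]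

theorem algebraMap_mem_degree (r : ℂ) : algebraMap ℂ (ExteriorAlgebra ℂ V) r ∈ degree V 0 :=
  ⟨⊥, inferInstance, fun n u _ _ => by simp [number, contract_algebraMap]⟩

theorem wedge_mem_degree (v : V) {k : ℕ} {x : ExteriorAlgebra ℂ V} (hx : x ∈ degree V k) :
    wedge v x ∈ degree V (k + 1) := by
  obtain ⟨K, hK, hx⟩ := hx
  refine ⟨K ⊔ Submodule.span ℂ {v}, inferInstance, fun n u hu h => ?_⟩
  rw [number_wedge hu (h (Submodule.mem_sup_right (Submodule.mem_span_singleton_self v))),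
    hx n u hu (le_sup_left.trans h), map_smul]
  push_cast
  module

theorem contract_mem_degree (v : V) {k : ℕ} {x : ExteriorAlgebra ℂ V} (hx : x ∈ degree V (k + 1)) :
    contract v x ∈ degree V k := by
  obtain ⟨K, hK, hx⟩ := hx
  refine ⟨K ⊔ Submodule.span ℂ {v}, inferInstance, fun n u hu h => ?_⟩
  rw [number_contract hu (h (Submodule.mem_sup_right (Submodule.mem_span_singleton_self v))),
    hx n u hu (le_sup_left.trans h), map_smul]
  push_cast
  module

theorem wedge_contract_mem_degree (v w : V) {k : ℕ} {x : ExteriorAlgebra ℂ V}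
    (hx : x ∈ degree V k) : wedge v (contract w x) ∈ degree V k := by
  obtain ⟨K, hK, hx⟩ := hx
  refine ⟨K ⊔ (Submodule.span ℂ {v} ⊔ Submodule.span ℂ {w}), inferInstance, fun n u hu h => ?_⟩
  rw [number_wedge hu (h (Submodule.mem_sup_right
      (Submodule.mem_sup_left (Submodule.mem_span_singleton_self v)))),
    number_contract hu (h (Submodule.mem_sup_right
      (Submodule.mem_sup_right (Submodule.mem_span_singleton_self w)))),
    hx n u hu (le_sup_left.trans h), map_smul, map_sub, map_smul]
  module

theorem iSup_degree : ⨆ k, degree V k = ⊤ := by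
  refine eq_top_iff.2 fun x _ => ?_
  induction x using exterior_induction with
  | h0 r => exact Submodule.mem_iSup_of_mem 0 (algebraMap_mem_degree r)
  | hadd x y hx hy => exact add_mem (hx trivial) (hy trivial)
  | hw v x hx =>
    have h : (⨆ k, degree V k).map (wedge v) ≤ ⨆ k, degree V k := by
      rw [Submodule.map_iSup]
      refine iSup_le fun k => ?_
      rintro _ ⟨y, hy, rfl⟩
      exact Submodule.mem_iSup_of_mem (k + 1) (wedge_mem_degree v hy)
    exact h ⟨x, hx trivial, rfl⟩

/-- In degree `k`, the number operator is bounded by `k`. -/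
theorem IsBessel.sum_norm_contract_sq_le {ι : Type*} [Fintype ι] {v : ι → V} (hv : IsBessel v)
    {k : ℕ} {x : ExteriorAlgebra ℂ V} (hx : x ∈ degree V k) :
    ∑ i, ‖contract (v i) x‖ ^ 2 ≤ k * ‖x‖ ^ 2 := by
  obtain ⟨K, hK, hx⟩ := hx
  have : FiniteDimensional ℂ (Submodule.span ℂ (Set.range v)) :=
    FiniteDimensional.span_of_finite ℂ (Set.finite_range v)
  obtain ⟨u, hu, hus⟩ := exists_orthonormal_span_eq (K ⊔ Submodule.span ℂ (Set.range v))
  have hvu : ∀ i, v i ∈ Submodule.span ℂ (Set.range u) := fun i => by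
    rw [hus]
    exact Submodule.mem_sup_right (Submodule.subset_span ⟨i, rfl⟩)
  have h1 := hv.sum_norm_sq_le hu (fun j => contract (u j) x)
  have h2 : ∀ i, ∑ j, inner ℂ (v i) (u j) • contract (u j) x = contract (v i) x := fun i => by
    conv_rhs => rw [← hu.sum_inner_smul (hvu i), ← sum_smul_contract]
    simp only [inner_conj_symm]
  simp only [h2] at h1
  refine h1.trans (le_of_eq ?_)
  have h3 : ∀ j, ((‖contract (u j) x‖ : ℂ)) ^ 2 = inner ℂ x (wedge (u j) (contract (u j) x)) :=
    fun j => by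
      rw [ext_inner_def, extInner_wedge_right]
      exact (inner_self_eq_norm_sq_to_K (𝕜 := ℂ) (contract (u j) x)).symm
  have h4 : ∑ j, ((‖contract (u j) x‖ : ℂ)) ^ 2 = k * (‖x‖ : ℂ) ^ 2 := by
    simp only [h3, ← inner_sum]
    refine (congrArg (inner ℂ x) (hx _ u hu (le_sup_left.trans hus.ge))).trans ?_
    rw [inner_smul_right, inner_self_eq_norm_sq_to_K]
    rfl
  exact_mod_cast h4

variable (V) in
/-- The closure of the homogeneous elements of degree `k` in the Fock space. -/
def Fock.degree (k : ℕ) : Submodule ℂ (Fock V) :=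
  ((SpinorModules.degree V k).map (Fock.of (V := V)).toLinearMap).topologicalClosure

theorem Fock.of_mem_degree {k : ℕ} {x : ExteriorAlgebra ℂ V} (hx : x ∈ SpinorModules.degree V k) :
    Fock.of x ∈ Fock.degree V k :=
  Submodule.le_topologicalClosure _ ⟨x, hx, rfl⟩

theorem annihilation_mem_degree (v : V) {k : ℕ} {s : Fock V} (hs : s ∈ Fock.degree V (k + 1)) :
    annihilation v s ∈ Fock.degree V k := by
  refine map_mem_closure (annihilation v).continuous hs ?_
  rintro _ ⟨a, ha, rfl⟩
  exact ⟨contract v a, contract_mem_degree v ha, (annihilation_of v a).symm⟩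

theorem IsBessel.sum_norm_annihilation_sq_le {ι : Type*} [Fintype ι] {v : ι → V} (hv : IsBessel v)
    {k : ℕ} {s : Fock V} (hs : s ∈ Fock.degree V k) :
    ∑ i, ‖annihilation (v i) s‖ ^ 2 ≤ k * ‖s‖ ^ 2 := by
  refine closure_minimal (t := {s | ∑ i, ‖annihilation (v i) s‖ ^ 2 ≤ k * ‖s‖ ^ 2}) ?_ ?_ hs
  · rintro _ ⟨x, hx, rfl⟩
    change ∑ i, ‖annihilation (v i) (Fock.of x)‖ ^ 2 ≤ k * ‖Fock.of x‖ ^ 2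
    simp only [annihilation_of, Fock.of.norm_map]
    exact hv.sum_norm_contract_sq_le hx
  · exact isClosed_le (by fun_prop) (by fun_prop)

theorem exists_homogeneous_inner_ne_zero {Ω : Fock V} (hΩ : Ω ≠ 0) :
    ∃ k, ∃ x ∈ degree V k, inner ℂ (Fock.of x) Ω ≠ 0 := by
  by_contra! h
  have h2 : (⊤ : Submodule ℂ (ExteriorAlgebra ℂ V))
      ≤ (Submodule.span ℂ {Ω})ᗮ.comap (Fock.of (V := V)).toLinearMap := by
    rw [← iSup_degree]
    refine iSup_le fun k x hx => ?_
    exact Submodule.mem_orthogonal_singleton_iff_inner_left.2 (h k x hx)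
  have h3 : ∀ s : Fock V, inner ℂ s Ω = 0 := by
    refine Fock.induction (isClosed_eq (by fun_prop) (by fun_prop)) fun x => ?_
    exact Submodule.mem_orthogonal_singleton_iff_inner_left.1 (h2 (Submodule.mem_top (x := x)))
  exact hΩ (inner_self_eq_zero.1 (h3 Ω))

/-- The homogeneous component `φ` of degree `k` of `Ω`. -/
theorem exists_mem_degree_inner_eq (k : ℕ) (Ω : Fock V) :
    ∃ φ ∈ Fock.degree V k, ∀ s ∈ Fock.degree V k, inner ℂ s Ω = inner ℂ s φ := by
  have : CompleteSpace (Fock.degree V k) :=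
    (Submodule.isClosed_topologicalClosure _).completeSpace_coe
  obtain ⟨φ, hφ, φ', hφ', h⟩ := (Fock.degree V k).exists_add_mem_mem_orthogonal Ω
  exact ⟨φ, hφ, fun s hs => by rw [h, inner_add_right, hφ' s hs, add_zero]⟩

/-- If `Ω ≠ 0` is killed by the operators `creation (p i) + annihilation (q i)`, then the sum of
the `‖p i‖²` has a bound which depends on `Ω` only. For a homogeneous `ψ` not orthogonal to `Ω`,
the relations express `⟨f, p i⟩ ⟨ψ, Ω⟩` by matrix coefficients between `ψ` and two homogeneous
components of `Ω`, and these are square summable because the number operator is bounded in each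
degree. -/
theorem exists_bound_of_annihilated {Ω : Fock V} (hΩ : Ω ≠ 0) :
    ∃ C : ℝ, ∀ (ι : Type*) [Fintype ι] (p q : ι → V), IsBessel p → IsBessel q →
      (∀ i, creation (p i) Ω + annihilation (q i) Ω = 0) → ∑ i, ‖p i‖ ^ 2 ≤ C := by
  obtain ⟨k, x, hx, hne⟩ := exists_homogeneous_inner_ne_zero hΩ
  obtain ⟨φ, hφ, hφi⟩ := exists_mem_degree_inner_eq k Ω
  obtain ⟨χ, hχ, hχi⟩ := exists_mem_degree_inner_eq (k + 1 + 1) Ω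
  set ψ : Fock V := Fock.of x with hψ
  set N : ℝ := ‖inner ℂ ψ Ω‖ ^ 2 with hN
  have hNpos : 0 < N := by positivity
  refine ⟨(2 * ((k * ‖ψ‖ ^ 2) * (k * ‖φ‖ ^ 2))
    + 2 * (‖ψ‖ ^ 2 * (((k + 1 : ℕ) : ℝ) * (((k + 1 + 1 : ℕ) : ℝ) * ‖χ‖ ^ 2)))) / N, ?_⟩
  intro ι _ p q hp hq h
  have : FiniteDimensional ℂ (Submodule.span ℂ (Set.range p)) :=
    FiniteDimensional.span_of_finite ℂ (Set.finite_range p)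
  obtain ⟨f, hf, hfs⟩ := exists_orthonormal_span_eq (Submodule.span ℂ (Set.range p))
  have hpf : ∀ i, ∑ j, ‖inner ℂ (f j) (p i)‖ ^ 2 = ‖p i‖ ^ 2 := fun i =>
    hf.sum_norm_inner_sq (by rw [hfs]; exact Submodule.subset_span ⟨i, rfl⟩)
  -- pair the hypothesis for `i` with `creation (f j) ψ`, and use that the inner products of `Ω`
  -- with elements of degree `k` and `k + 2` only see the components `φ` and `χ`
  have key : ∀ i j, inner ℂ (f j) (p i) * inner ℂ ψ Ω
      = inner ℂ (annihilation (p i) ψ) (annihilation (f j) φ)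
        - inner ℂ ψ (annihilation (f j) (annihilation (q i) χ)) := fun i j => by
    have e := congrArg (inner ℂ (creation (f j) ψ)) (h i)
    have m1 : creation (f j) (annihilation (p i) ψ) ∈ Fock.degree V k := by
      rw [hψ, annihilation_of, creation_of]
      exact Fock.of_mem_degree (wedge_contract_mem_degree _ _ hx)
    have m2 : creation (q i) (creation (f j) ψ) ∈ Fock.degree V (k + 1 + 1) := by
      rw [hψ, creation_of, creation_of]
      exact Fock.of_mem_degree (wedge_mem_degree _ (wedge_mem_degree _ hx))
    have e1 := hφi _ m1
    have e2 := hχi _ m2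
    rw [inner_add_right, inner_zero_right, ← inner_creation_left, e2, inner_creation_left,
      inner_creation_left, inner_creation_left, eq_sub_of_add_eq (annihilation_creation (f j) (p i) Ω),
      inner_sub_right, inner_smul_right, ← inner_annihilation_left (p i) ψ, ← inner_creation_left,
      e1, inner_creation_left] at e
    linear_combination e
  have hA : ∑ i, ∑ j, ‖inner ℂ (annihilation (p i) ψ) (annihilation (f j) φ)‖ ^ 2
      ≤ (k * ‖ψ‖ ^ 2) * (k * ‖φ‖ ^ 2) := by
    calc _ ≤ ∑ i, ∑ j, ‖annihilation (p i) ψ‖ ^ 2 * ‖annihilation (f j) φ‖ ^ 2 := by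
          refine Finset.sum_le_sum fun i _ => Finset.sum_le_sum fun j _ => ?_
          rw [← mul_pow]
          exact pow_le_pow_left₀ (norm_nonneg _) (norm_inner_le_norm _ _) 2
      _ = (∑ i, ‖annihilation (p i) ψ‖ ^ 2) * ∑ j, ‖annihilation (f j) φ‖ ^ 2 := by
          rw [Finset.sum_mul_sum]
      _ ≤ _ := mul_le_mul (hp.sum_norm_annihilation_sq_le (Fock.of_mem_degree hx))
          (hf.isBessel.sum_norm_annihilation_sq_le hφ) (by positivity) (by positivity)
  have hB : ∑ i, ∑ j, ‖inner ℂ ψ (annihilation (f j) (annihilation (q i) χ))‖ ^ 2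
      ≤ ‖ψ‖ ^ 2 * (((k + 1 : ℕ) : ℝ) * (((k + 1 + 1 : ℕ) : ℝ) * ‖χ‖ ^ 2)) := by
    calc _ ≤ ∑ i, ∑ j, ‖ψ‖ ^ 2 * ‖annihilation (f j) (annihilation (q i) χ)‖ ^ 2 := by
          refine Finset.sum_le_sum fun i _ => Finset.sum_le_sum fun j _ => ?_
          rw [← mul_pow]
          exact pow_le_pow_left₀ (norm_nonneg _) (norm_inner_le_norm _ _) 2
      _ ≤ ∑ i, ‖ψ‖ ^ 2 * (((k + 1 : ℕ) : ℝ) * ‖annihilation (q i) χ‖ ^ 2) := by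
          refine Finset.sum_le_sum fun i _ => ?_
          rw [← Finset.mul_sum]
          exact mul_le_mul_of_nonneg_left (hf.isBessel.sum_norm_annihilation_sq_le
            (annihilation_mem_degree _ hχ)) (by positivity)
      _ ≤ _ := by
          rw [← Finset.mul_sum, ← Finset.mul_sum]
          exact mul_le_mul_of_nonneg_left (mul_le_mul_of_nonneg_left
            (hq.sum_norm_annihilation_sq_le hχ) (by positivity)) (by positivity)
  rw [le_div_iff₀ hNpos]
  calc (∑ i, ‖p i‖ ^ 2) * N = ∑ i, ∑ j, ‖inner ℂ (f j) (p i) * inner ℂ ψ Ω‖ ^ 2 := by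
        rw [Finset.sum_mul]
        refine Finset.sum_congr rfl fun i _ => ?_
        rw [← hpf i, Finset.sum_mul]
        exact Finset.sum_congr rfl fun j _ => by rw [norm_mul, mul_pow]
    _ ≤ ∑ i, ∑ j, (2 * ‖inner ℂ (annihilation (p i) ψ) (annihilation (f j) φ)‖ ^ 2
          + 2 * ‖inner ℂ ψ (annihilation (f j) (annihilation (q i) χ))‖ ^ 2) := by
        refine Finset.sum_le_sum fun i _ => Finset.sum_le_sum fun j _ => ?_
        rw [key]
        set a := inner ℂ (annihilation (p i) ψ) (annihilation (f j) φ)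
        set b := inner ℂ ψ (annihilation (f j) (annihilation (q i) χ))
        have hab := norm_sub_le a b
        nlinarith [norm_nonneg (a - b), sq_nonneg (‖a‖ - ‖b‖), norm_nonneg a, norm_nonneg b]
    _ ≤ _ := by
        simp only [Finset.sum_add_distrib, ← Finset.mul_sum]
        linarith

end Degree

/-! ### Existence of vacuum vectors in representations of the anticommutation relations -/

namespace CARRep

variable {V S : Type*} [NormedAddCommGroup V] [InnerProductSpace ℂ V]
  [NormedAddCommGroup S] [InnerProductSpace ℂ S] [CompleteSpace S] (R : CARRep V S)

theorem an_add (v w : V) : R.an (v + w) = R.an v + R.an w := by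
  rw [an, map_add, map_add]; rfl

theorem an_smul (c : ℂ) (v : V) : R.an (c • v) = starRingEnd ℂ c • R.an v := by
  rw [an, map_smul, map_smulₛₗ]; rfl

theorem an_zero : R.an 0 = 0 := by rw [an, map_zero, map_zero]

theorem an_an_self (v : V) (s : S) : R.an v (R.an v s) = 0 := by
  refine ext_inner_left ℂ fun t => ?_
  rw [← inner_cr_left, ← inner_cr_left, cr_cr, inner_zero_left, inner_zero_right]

theorem an_an (v w : V) (s : S) : R.an v (R.an w s) = -R.an w (R.an v s) := by
  have h := R.an_an_self (v + w) s
  simp only [an_add, add_apply, map_add, an_an_self, zero_add, add_zero] at h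
  rw [add_comm] at h
  exact eq_neg_of_add_eq_zero_left h

/-- A nonzero subspace which is invariant under finitely many annihilation operators contains a
nonzero vector killed by all of them. -/
theorem exists_mem_an_eq_zero {ι : Type*} (v : ι → V) (F : Finset ι) {M : Submodule ℂ S}
    (hM : M ≠ ⊥) (hv : ∀ i ∈ F, ∀ s ∈ M, R.an (v i) s ∈ M) :
    ∃ s ∈ M, s ≠ 0 ∧ ∀ i ∈ F, R.an (v i) s = 0 := by
  classical
  induction F using Finset.induction_on with
  | empty =>
    obtain ⟨s, hs, h0⟩ := M.exists_mem_ne_zero_of_ne_bot hM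
    exact ⟨s, hs, h0, by simp⟩
  | insert i F _ ih =>
    obtain ⟨s, hs, h0, h⟩ := ih fun j hj => hv j (Finset.mem_insert_of_mem hj)
    by_cases hi : R.an (v i) s = 0
    · exact ⟨s, hs, h0, fun j hj => (Finset.mem_insert.1 hj).elim (fun e => e ▸ hi) (h j)⟩
    · refine ⟨R.an (v i) s, hv i (Finset.mem_insert_self i F) s hs, hi, fun j hj => ?_⟩
      rcases Finset.mem_insert.1 hj with rfl | hj
      · exact R.an_an_self _ s
      · rw [an_an, h j hj, map_zero, neg_zero]

theorem an_eq_zero_of_mem_span {A : Set V} {s : S} (h : ∀ v ∈ A, R.an v s = 0) {v : V}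
    (hv : v ∈ Submodule.span ℂ A) : R.an v s = 0 := by
  induction hv using Submodule.span_induction with
  | mem v hv => exact h v hv
  | zero => rw [an_zero, zero_apply]
  | add v w _ _ hv hw => rw [an_add, add_apply, hv, hw, add_zero]
  | smul c v _ hv => rw [an_smul, smul_apply, hv, smul_zero]

/-- For finite-dimensional `V`, a nonzero subspace which is invariant under the annihilation
operators contains a vacuum vector. -/
theorem exists_mem_vacua [FiniteDimensional ℂ V] {M : Submodule ℂ S} (hM : M ≠ ⊥)
    (hv : ∀ v, ∀ s ∈ M, R.an v s ∈ M) : ∃ s ∈ M, s ≠ 0 ∧ s ∈ R.vacua := by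
  obtain ⟨s, hs, h0, h⟩ := R.exists_mem_an_eq_zero (Module.finBasis ℂ V) Finset.univ hM
    fun i _ => hv _
  refine ⟨s, hs, h0, fun v => R.an_eq_zero_of_mem_span (A := Set.range (Module.finBasis ℂ V)) ?_ ?_⟩
  · rintro _ ⟨i, rfl⟩
    exact h i (Finset.mem_univ i)
  · rw [(Module.finBasis ℂ V).span_eq]; exact Submodule.mem_top

/-- The projection onto the kernel of the annihilation operator of a unit vector `v`. It is the
identity for `v = 0`. -/
def kerProj (v : V) (s : S) : S := s - R.cr v (R.an v s)

variable {R}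

/-- Families produced by the Gram–Schmidt process may contain zero vectors, so these are allowed
besides the unit vectors here and below. -/
theorem an_cr_an {v : V} (hv : v = 0 ∨ ‖v‖ = 1) (s : S) :
    R.an v (R.cr v (R.an v s)) = R.an v s := by
  rcases hv with rfl | hv
  · rw [an_zero]; rfl
  · rw [an_cr, an_an_self, map_zero, sub_zero, inner_self_eq_norm_sq_to_K, hv]
    simp

theorem an_kerProj {v : V} (hv : v = 0 ∨ ‖v‖ = 1) (s : S) : R.an v (R.kerProj v s) = 0 := by
  rw [kerProj, map_sub, an_cr_an hv, sub_self]

theorem an_kerProj_of_inner_eq_zero {v w : V} (h : inner ℂ w v = 0) (s : S) :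
    R.an w (R.kerProj v s) = R.kerProj v (R.an w s) := by
  rw [kerProj, kerProj, map_sub, an_cr, h, zero_smul, zero_sub, an_an, map_neg, neg_neg]

theorem norm_kerProj_sq {v : V} (hv : v = 0 ∨ ‖v‖ = 1) (s : S) :
    ‖R.kerProj v s‖ ^ 2 = ‖s‖ ^ 2 - ‖R.an v s‖ ^ 2 := by
  have h1 : inner ℂ s (R.cr v (R.an v s)) = ((‖R.an v s‖ ^ 2 : ℝ) : ℂ) := by
    rw [← inner_an_left, inner_self_eq_norm_sq_to_K]
    push_cast
    rfl
  have h2 : ‖R.cr v (R.an v s)‖ ^ 2 = ‖R.an v s‖ ^ 2 := by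
    have : inner ℂ (R.cr v (R.an v s)) (R.cr v (R.an v s)) = inner ℂ (R.an v s) (R.an v s) := by
      rw [inner_cr_left, an_cr_an hv]
    rw [inner_self_eq_norm_sq_to_K, inner_self_eq_norm_sq_to_K] at this
    exact_mod_cast this
  rw [kerProj, norm_sub_sq (𝕜 := ℂ), h1, h2, RCLike.re_to_complex, Complex.ofReal_re]
  ring

theorem inner_kerProj {v : V} {t : S} (ht : R.an v t = 0) (s : S) :
    inner ℂ t (R.kerProj v s) = inner ℂ t s := by
  rw [kerProj, inner_sub_right, ← inner_an_left, ht, inner_zero_left, sub_zero]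

/-- If the expected number `∑ ‖an (e n) ψ‖²` of particles in the state `ψ` is less than
`‖ψ‖²`, then the successive projections of `ψ` to the kernels of the operators `an (e n)` converge
to a nonzero vector in their intersection. -/
theorem exists_an_eq_zero_of_sum_le {e : ℕ → V} (he : ∀ n, e n = 0 ∨ ‖e n‖ = 1)
    (hee : ∀ m n, m ≠ n → inner ℂ (e m) (e n) = 0) {ψ : S} {c : ℝ} (hc : c < ‖ψ‖ ^ 2)
    (hsum : ∀ n, ∑ m ∈ Finset.range n, ‖R.an (e m) ψ‖ ^ 2 ≤ c) :
    ∃ φ : S, φ ≠ 0 ∧ ∀ n, R.an (e n) φ = 0 := by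
  let φ : ℕ → S := fun n => Nat.rec ψ (fun n s => R.kerProj (e n) s) n
  have φ0 : φ 0 = ψ := rfl
  have φs : ∀ n, φ (n + 1) = R.kerProj (e n) (φ n) := fun n => rfl
  have hker : ∀ n, ∀ m < n, R.an (e m) (φ n) = 0 := by
    intro n
    induction n with
    | zero => intro m hm; omega
    | succ n ih =>
      intro m hm
      rw [φs]
      rcases Nat.lt_succ_iff_lt_or_eq.1 hm with hm | rfl
      · rw [an_kerProj_of_inner_eq_zero (hee m n hm.ne), ih m hm, kerProj, map_zero, map_zero,
          sub_zero]
      · exact an_kerProj (he m) _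
  have hle : ∀ n m, n ≤ m → ‖R.an (e m) (φ n)‖ ^ 2 ≤ ‖R.an (e m) ψ‖ ^ 2 := by
    intro n
    induction n with
    | zero => intro m _; rfl
    | succ n ih =>
      intro m hm
      rw [φs, an_kerProj_of_inner_eq_zero (hee m n (by omega)), norm_kerProj_sq (he n)]
      have := ih m (by omega)
      nlinarith [sq_nonneg ‖R.an (e n) (R.an (e m) (φ n))‖]
  have hlow : ∀ n, ‖ψ‖ ^ 2 - ∑ m ∈ Finset.range n, ‖R.an (e m) ψ‖ ^ 2 ≤ ‖φ n‖ ^ 2 := by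
    intro n
    induction n with
    | zero => simp [φ0]
    | succ n ih =>
      rw [φs, norm_kerProj_sq (he n), Finset.sum_range_succ]
      linarith [hle n n le_rfl]
  -- the differences of the projected vectors are orthogonal, so their norms are controlled by the
  -- decreasing sequence of the `‖φ n‖²`
  have hinner : ∀ m n, n ≤ m → inner ℂ (φ m) (φ n) = inner ℂ (φ m) ψ := by
    intro m n
    induction n with
    | zero => intro _; rfl
    | succ n ih =>
      intro hn
      rw [φs, inner_kerProj (hker m n hn), ih (by omega)]
  have hdiff : ∀ m n, n ≤ m → ‖φ m - φ n‖ ^ 2 = ‖φ n‖ ^ 2 - ‖φ m‖ ^ 2 := fun m n hn => by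
    have h : inner ℂ (φ m) (φ n) = ((‖φ m‖ ^ 2 : ℝ) : ℂ) := by
      rw [hinner m n hn, ← hinner m m le_rfl, inner_self_eq_norm_sq_to_K]
      push_cast
      rfl
    rw [norm_sub_sq (𝕜 := ℂ), h, RCLike.re_to_complex, Complex.ofReal_re]
    ring
  have hanti : Antitone fun n => ‖φ n‖ ^ 2 :=
    antitone_nat_of_succ_le fun n => by
      rw [φs, norm_kerProj_sq (he n)]
      linarith [sq_nonneg ‖R.an (e n) (φ n)‖]
  have hconv := tendsto_atTop_ciInf hanti ⟨0, by rintro _ ⟨n, rfl⟩; positivity⟩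
  have hcauchy : CauchySeq φ := by
    rw [Metric.cauchySeq_iff']
    intro ε hε
    obtain ⟨N, hN⟩ := Metric.cauchySeq_iff'.1 hconv.cauchySeq (ε ^ 2) (by positivity)
    refine ⟨N, fun n hn => ?_⟩
    have h1 := hN n hn
    rw [Real.dist_eq, abs_sub_comm] at h1
    have h2 := (le_abs_self _).trans_lt h1
    rw [← hdiff n N hn] at h2
    rw [dist_eq_norm]
    exact lt_of_pow_lt_pow_left₀ 2 hε.le h2
  obtain ⟨χ, hχ⟩ := cauchySeq_tendsto_of_complete hcauchy
  refine ⟨χ, ?_, fun n => ?_⟩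
  · rintro rfl
    have h1 : Filter.Tendsto (fun n => ‖φ n‖ ^ 2) Filter.atTop (nhds (‖(0 : S)‖ ^ 2)) :=
      (hχ.norm).pow 2
    have h2 : ‖ψ‖ ^ 2 - c ≤ ‖(0 : S)‖ ^ 2 :=
      ge_of_tendsto' h1 fun n => by linarith [hlow n, hsum n]
    rw [norm_zero] at h2
    linarith
  · have h1 : Filter.Tendsto (fun m => R.an (e n) (φ m)) Filter.atTop (nhds (R.an (e n) χ)) :=
      ((R.an (e n)).continuous.tendsto χ).comp hχ
    have h2 : Filter.Tendsto (fun m => R.an (e n) (φ m)) Filter.atTop (nhds 0) :=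
      tendsto_const_nhds.congr' (Filter.eventually_atTop.2
        ⟨n + 1, fun m hm => (hker m n (by omega)).symm⟩)
    exact tendsto_nhds_unique h1 h2

/-- If the expected number of particles in some nonzero state is finite, then the operators
`an (e n)` have a common nonzero vector in their kernels. -/
theorem exists_an_eq_zero {e : ℕ → V} (he : ∀ n, e n = 0 ∨ ‖e n‖ = 1)
    (hee : ∀ m n, m ≠ n → inner ℂ (e m) (e n) = 0) {ψ : S} (hψ : ψ ≠ 0)
    (hsum : Summable fun n => ‖R.an (e n) ψ‖ ^ 2) :
    ∃ φ : S, φ ≠ 0 ∧ ∀ n, R.an (e n) φ = 0 := by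
  have hpos : 0 < ‖ψ‖ ^ 2 := by positivity
  -- discard finitely many of the vectors `e n`, to make the sum small
  obtain ⟨N, hN⟩ := ((tendsto_sum_nat_add fun n => ‖R.an (e n) ψ‖ ^ 2).eventually
    (gt_mem_nhds hpos)).exists
  obtain ⟨χ, hχ, hχe⟩ := exists_an_eq_zero_of_sum_le (R := R) (e := fun n => e (n + N))
    (fun n => he _) (fun m n h => hee _ _ (by omega)) hN fun n =>
      ((summable_nat_add_iff N).2 hsum).sum_le_tsum _ fun i _ => by positivity
  let M : Submodule ℂ S :=
    { carrier := {s | ∀ n, R.an (e (n + N)) s = 0}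
      add_mem' := fun hs ht n => by rw [map_add, hs n, ht n, add_zero]
      zero_mem' := fun n => map_zero _
      smul_mem' := fun c s hs n => by rw [map_smul, hs n, smul_zero] }
  obtain ⟨φ, hφM, hφ, hφe⟩ := R.exists_mem_an_eq_zero e (Finset.range N) (M := M)
    (fun h => hχ ((Submodule.eq_bot_iff M).1 h χ hχe))
    (fun i _ s hs n => by rw [an_an, hs n, map_zero, neg_zero])
  refine ⟨φ, hφ, fun n => ?_⟩
  rcases lt_or_ge n N with h | h
  · exact hφe n (Finset.mem_range.2 h)
  · have := hφM (n - N)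
    rwa [Nat.sub_add_cancel h] at this

end CARRep

/-! ### Clifford multiplication -/

namespace Cplx

variable {E H : Type*} [NormedAddCommGroup E] [InnerProductSpace ℝ E]
  [NormedAddCommGroup H] [InnerProductSpace ℝ H]

@[simp] theorem re_map (A : E →ₗ[ℝ] H) (x : Cplx E) : (map A x).re = A x.re := rfl
@[simp] theorem im_map (A : E →ₗ[ℝ] H) (x : Cplx E) : (map A x).im = A x.im := rfl

theorem conj_conj (x : Cplx H) : conj (conj x) = x := by ext <;> simp

theorem conj_map (A : E →ₗ[ℝ] H) (x : Cplx E) : conj (map A x) = map A (conj x) := by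
  ext <;> simp

theorem inner_map_map (j : E →ₗᵢ[ℝ] H) (x y : Cplx E) :
    inner ℂ (map j.toLinearMap x) (map j.toLinearMap y) = inner ℂ x y := by
  simp [inner_def]

theorem norm_sq_eq (x : Cplx H) : ‖x‖ ^ 2 = ‖x.re‖ ^ 2 + ‖x.im‖ ^ 2 := by
  have h : (‖x‖ : ℂ) ^ 2 = inner ℂ x x := (inner_self_eq_norm_sq_to_K (𝕜 := ℂ) x).symm
  have h2 := congrArg Complex.re h
  rw [inner_def, ← Complex.ofReal_pow, Complex.ofReal_re] at h2
  rw [h2]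
  simp

end Cplx

section VectorAction

variable {H : Type*} [NormedAddCommGroup H] [InnerProductSpace ℝ H] (J : OrthComplexStructure H)

theorem mem_Hplus_iff {x : Cplx H} : x ∈ Hplus J ↔ J.toCLM x.re = -x.im ∧ J.toCLM x.im = x.re := by
  rw [Hplus, Module.End.mem_eigenspace_iff, Cplx.ext_iff]
  simp [OrthComplexStructure.complexified]

theorem mem_Hminus_iff {x : Cplx H} : x ∈ Hminus J ↔ J.toCLM x.re = x.im ∧ J.toCLM x.im = -x.re := by
  rw [Hminus, Module.End.mem_eigenspace_iff, Cplx.ext_iff]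
  simp [OrthComplexStructure.complexified]

theorem OrthComplexStructure.inner_apply_left (x y : H) :
    inner ℝ (J.toCLM x) y = -inner ℝ x (J.toCLM y) := by
  rw [← J.orth x (J.toCLM y), J.sq, inner_neg_right, neg_neg]

theorem OrthComplexStructure.norm_apply (x : H) : ‖J.toCLM x‖ = ‖x‖ := by
  have h := J.orth x x
  rw [real_inner_self_eq_norm_sq, real_inner_self_eq_norm_sq] at h
  exact (sq_eq_sq₀ (norm_nonneg _) (norm_nonneg _)).1 h

/-- `H⁺` and `H⁻` are orthogonal. -/
theorem inner_eq_zero_of_mem_Hplus {x y : Cplx H} (hx : x ∈ Hplus J) (hy : y ∈ Hminus J) :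
    inner ℂ x y = 0 := by
  obtain ⟨h1, h2⟩ := (mem_Hplus_iff J).1 hx
  obtain ⟨h3, h4⟩ := (mem_Hminus_iff J).1 hy
  have e1 := J.orth x.re y.re
  have e2 := J.orth x.re y.im
  rw [h1, h3, inner_neg_left] at e1
  rw [h1, h4, inner_neg_neg] at e2
  rw [Cplx.inner_def]
  apply Complex.ext <;> simp <;> linarith

theorem conj_mem_Hminus {x : Cplx H} (hx : x ∈ Hplus J) : Cplx.conj x ∈ Hminus J := by
  obtain ⟨h1, h2⟩ := (mem_Hplus_iff J).1 hx
  rw [mem_Hminus_iff]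
  simp [h1, h2]

theorem coe_plusPart (x : Cplx H) :
    (plusPart J x : Cplx H) = (1 / 2 : ℂ) • (x - Complex.I • J.complexified x) := rfl

theorem coe_minusPart (x : Cplx H) :
    (minusPart J x : Cplx H) = (1 / 2 : ℂ) • (x + Complex.I • J.complexified x) := rfl

/-- `plusPart` is the orthogonal projection onto `H⁺`. -/
theorem inner_plusPart_left (x : Cplx H) (v : Hplus J) :
    inner ℂ (plusPart J x) v = inner ℂ x (v : Cplx H) := by
  conv_rhs => rw [← plusPart_add_minusPart J x, inner_add_left]
  rw [← inner_conj_symm (minusPart J x : Cplx H),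
    inner_eq_zero_of_mem_Hplus J v.2 (minusPart J x).2, map_zero, add_zero]
  rfl

theorem conjMinus_minusPart (x : Cplx H) : conjMinus J (minusPart J x) = plusPart J (Cplx.conj x) := by
  refine Subtype.ext ?_
  change Cplx.conj (minusPart J x : Cplx H) = plusPart J (Cplx.conj x)
  rw [coe_plusPart, coe_minusPart]
  ext <;> simp [OrthComplexStructure.complexified] <;> module

theorem vectorAction_apply (x : Cplx H) (s : Spinor J) : vectorAction J x s
    = ((√2 : ℝ) : ℂ) • (creation (plusPart J x) s + annihilation (plusPart J (Cplx.conj x)) s) := by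
  rw [← conjMinus_minusPart]
  rfl

theorem plusPart_of_mem {x : Cplx H} (hx : x ∈ Hplus J) : plusPart J x = ⟨x, hx⟩ := by
  refine Subtype.ext ?_
  have := Module.End.mem_eigenspace_iff.1 hx
  rw [coe_plusPart, this, smul_smul, Complex.I_mul_I]
  module

theorem plusPart_eq_zero_of_mem {x : Cplx H} (hx : x ∈ Hminus J) : plusPart J x = 0 := by
  refine Subtype.ext ?_
  have := Module.End.mem_eigenspace_iff.1 hx
  rw [coe_plusPart, this, smul_smul, mul_neg, Complex.I_mul_I, neg_neg, one_smul, sub_self,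
    smul_zero]
  rfl

theorem sqrt_two_mul_inv : ((√2 : ℝ) : ℂ)⁻¹ * ((√2 : ℝ) : ℂ) = 1 :=
  inv_mul_cancel₀ (by simp)

theorem sqrt_two_inv_mul_self : ((√2 : ℝ) : ℂ)⁻¹ * ((√2 : ℝ) : ℂ)⁻¹ = 1 / 2 := by
  rw [← mul_inv, ← Complex.ofReal_mul, Real.mul_self_sqrt (by norm_num)]
  norm_num

theorem creation_eq (v : Hplus J) (s : Spinor J) :
    creation v s = ((√2 : ℝ) : ℂ)⁻¹ • vectorAction J v s := by
  rw [vectorAction_apply, plusPart_of_mem J v.2, plusPart_eq_zero_of_mem J (conj_mem_Hminus J v.2),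
    smul_smul, sqrt_two_mul_inv, one_smul]
  have : annihilation (0 : Hplus J) = 0 := by
    have := annihilation_smul 0 (0 : Hplus J)
    simpa using this
  rw [this, zero_apply, add_zero]

theorem annihilation_eq (v : Hplus J) (s : Spinor J) :
    annihilation v s = ((√2 : ℝ) : ℂ)⁻¹ • vectorAction J (Cplx.conj (v : Cplx H)) s := by
  rw [vectorAction_apply, Cplx.conj_conj, plusPart_of_mem J v.2,
    plusPart_eq_zero_of_mem J (conj_mem_Hminus J v.2), smul_smul, sqrt_two_mul_inv, one_smul]
  have : creation (0 : Hplus J) = 0 := by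
    have := creation_smul 0 (0 : Hplus J)
    simpa using this
  rw [this, zero_apply, zero_add]

theorem inner_vectorAction_left (x : Cplx H) (s t : Spinor J) :
    inner ℂ (vectorAction J x s) t = inner ℂ s (vectorAction J (Cplx.conj x) t) := by
  rw [vectorAction_apply, vectorAction_apply, inner_smul_left, inner_smul_right, inner_add_left,
    inner_add_right, inner_creation_left, inner_annihilation_left, Cplx.conj_conj,
    Complex.conj_ofReal, add_comm]

theorem adjoint_vectorAction (x : Cplx H) :
    ContinuousLinearMap.adjoint (vectorAction J x) = vectorAction J (Cplx.conj x) :=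
  ((ContinuousLinearMap.eq_adjoint_iff _ _).2 fun s t => by
    rw [inner_vectorAction_left, Cplx.conj_conj]).symm

theorem adjoint_smul_vectorAction (x : Cplx H) :
    ContinuousLinearMap.adjoint (((√2 : ℝ) : ℂ)⁻¹ • vectorAction J x)
      = ((√2 : ℝ) : ℂ)⁻¹ • vectorAction J (Cplx.conj x) := by
  rw [map_smulₛₗ, adjoint_vectorAction, map_inv₀, Complex.conj_ofReal]

/-- The Clifford relation, in terms of the hermitian inner product: the complex bilinear extension
of the inner product of `H` is `⟨conj x, y⟩`. -/
theorem vectorAction_add_swap (x y : Cplx H) (s : Spinor J) :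
    vectorAction J x (vectorAction J y s) + vectorAction J y (vectorAction J x s)
      = (2 * inner ℂ (Cplx.conj x) y) • s := by
  have h : ∀ x s, vectorAction J x (vectorAction J x s) = Cplx.quad H x • s := fun x s => by
    have := congrArg (fun A : Spinor J →L[ℂ] Spinor J => A s) (vectorAction_sq J x)
    simpa [Algebra.algebraMap_eq_smul_one] using this
  have h2 := h (x + y) s
  simp only [map_add, add_apply, h] at h2
  have h3 : Cplx.quad H (x + y) = Cplx.quad H x + Cplx.quad H y + 2 * inner ℂ (Cplx.conj x) y := by
    rw [Cplx.quad_apply, Cplx.quad_apply, Cplx.quad_apply, Cplx.inner_def]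
    have c1 := real_inner_comm x.re y.re
    have c2 := real_inner_comm x.im y.im
    have c3 := real_inner_comm x.re y.im
    have c4 := real_inner_comm x.im y.re
    apply Complex.ext <;>
      simp [inner_add_left, inner_add_right,
        -inner_self_eq_norm_sq_to_K] <;> linarith
  rw [h3, add_smul, add_smul, ← sub_eq_zero] at h2
  rw [← sub_eq_zero, ← h2]
  abel

theorem norm_vectorAction_le (x : Cplx H) (s : Spinor J) :
    ‖vectorAction J x s‖ ≤ 2 * (‖x‖ * ‖s‖) := by
  have h := congrArg (inner ℂ s) (vectorAction_add_swap J (Cplx.conj x) x s)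
  have h1 := inner_vectorAction_left J x s (vectorAction J x s)
  have h2 := inner_vectorAction_left J (Cplx.conj x) s (vectorAction J (Cplx.conj x) s)
  rw [Cplx.conj_conj] at h2
  rw [inner_add_right, ← h1, ← h2, inner_smul_right, Cplx.conj_conj] at h
  simp only [inner_self_eq_norm_sq_to_K] at h
  have h3 : ‖vectorAction J x s‖ ^ 2 + ‖vectorAction J (Cplx.conj x) s‖ ^ 2
      = 2 * ‖x‖ ^ 2 * ‖s‖ ^ 2 := Complex.ofReal_injective (by push_cast; exact h)
  refine (abs_le_of_sq_le_sq' ?_ (by positivity)).2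
  nlinarith [sq_nonneg ‖vectorAction J (Cplx.conj x) s‖, sq_nonneg (‖x‖ * ‖s‖)]

theorem continuous_vectorAction_apply (s : Spinor J) : Continuous fun x => vectorAction J x s :=
  AddMonoidHomClass.continuous_of_bound
    ((ContinuousLinearMap.apply ℂ (Spinor J) s).toLinearMap ∘ₗ vectorAction J) (2 * ‖s‖) fun x => by
      refine (norm_vectorAction_le J x s).trans (le_of_eq ?_)
      ring

theorem grading_vectorAction (x : Cplx H) (s : Spinor J) :
    grading _ (vectorAction J x s) = -vectorAction J x (grading _ s) := by
  rw [vectorAction_apply, vectorAction_apply, map_smul, map_add, grading_creation,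
    grading_annihilation, ← neg_add, smul_neg]

end VectorAction

/-! ### Spinors over a subspace -/

section SubRep

variable {E H : Type*} [NormedAddCommGroup E] [InnerProductSpace ℝ E]
  [NormedAddCommGroup H] [InnerProductSpace ℝ H] (J : OrthComplexStructure H)
  (j : E →ₗᵢ[ℝ] H) (K : OrthComplexStructure E)

/-- For an isometric embedding `j : E → H` and an orthogonal complex structure `K` on `E`, the
representation on `S_{H,J}` of the anticommutation relations over `E⁺` which is given by Clifford
multiplication. -/
def subRep : CARRep (Hplus K) (Spinor J) where
  cr := ((√2 : ℝ) : ℂ)⁻¹ • (vectorAction J ∘ₗ Cplx.map j.toLinearMap ∘ₗ (Hplus K).subtype)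
  cr_cr v s := by
    change ((√2 : ℝ) : ℂ)⁻¹ • vectorAction J (Cplx.map j.toLinearMap v)
      (((√2 : ℝ) : ℂ)⁻¹ • vectorAction J (Cplx.map j.toLinearMap v) s) = 0
    have h := vectorAction_add_swap J (Cplx.map j.toLinearMap v) (Cplx.map j.toLinearMap v) s
    rw [Cplx.conj_map, Cplx.inner_map_map, ← inner_conj_symm,
      inner_eq_zero_of_mem_Hplus K v.2 (conj_mem_Hminus K v.2), map_zero, mul_zero, zero_smul,
      ← two_smul ℂ, smul_eq_zero_iff_right two_ne_zero] at h
    rw [map_smul, h, smul_zero, smul_zero]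
  adjoint_cr_cr v w s := by
    change ContinuousLinearMap.adjoint (((√2 : ℝ) : ℂ)⁻¹ • vectorAction J (Cplx.map j.toLinearMap v))
        (((√2 : ℝ) : ℂ)⁻¹ • vectorAction J (Cplx.map j.toLinearMap w) s)
      + ((√2 : ℝ) : ℂ)⁻¹ • vectorAction J (Cplx.map j.toLinearMap w)
        (ContinuousLinearMap.adjoint (((√2 : ℝ) : ℂ)⁻¹ • vectorAction J (Cplx.map j.toLinearMap v)) s)
      = _
    rw [adjoint_smul_vectorAction, smul_apply, smul_apply, map_smul, map_smul, ← smul_add,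
      ← smul_add, vectorAction_add_swap, smul_smul, smul_smul,
      sqrt_two_inv_mul_self, Cplx.conj_conj, Cplx.inner_map_map, ← mul_assoc, Submodule.coe_inner]
    norm_num

theorem subRep_cr (v : Hplus K) (s : Spinor J) :
    (subRep J j K).cr v s = ((√2 : ℝ) : ℂ)⁻¹ • vectorAction J (Cplx.map j.toLinearMap v) s := rfl

theorem subRep_an (v : Hplus K) (s : Spinor J) : (subRep J j K).an v s
    = ((√2 : ℝ) : ℂ)⁻¹ • vectorAction J (Cplx.conj (Cplx.map j.toLinearMap v)) s := by
  change ContinuousLinearMap.adjoint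
    (((√2 : ℝ) : ℂ)⁻¹ • vectorAction J (Cplx.map j.toLinearMap v)) s = _
  rw [adjoint_smul_vectorAction, smul_apply]

theorem subRep_an_eq_zero_iff {v : Hplus K} {s : Spinor J} : (subRep J j K).an v s = 0
    ↔ vectorAction J (Cplx.conj (Cplx.map j.toLinearMap v)) s = 0 := by
  rw [subRep_an, smul_eq_zero_iff_right (by simp)]

/-- A description of the vacuum vectors by the vectors `h + i K h`, for `h : E`, which span `E⁻`. -/
theorem mem_vacua_iff {s : Spinor J} : s ∈ (subRep J j K).vacua
    ↔ ∀ h, vectorAction J ⟨j h, j (K.toCLM h)⟩ s = 0 := by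
  rw [CARRep.mem_vacua]
  constructor
  · intro hs h
    have hm : (⟨h, -K.toCLM h⟩ : Cplx E) ∈ Hplus K := by
      rw [mem_Hplus_iff]
      simp [K.sq]
    have := (subRep_an_eq_zero_iff J j K).1 (hs ⟨_, hm⟩)
    convert this using 3
    simp [Cplx.map, Cplx.conj]
  · intro hs v
    obtain ⟨h1, h2⟩ := (mem_Hplus_iff K).1 v.2
    rw [subRep_an_eq_zero_iff]
    convert hs (v : Cplx E).re using 3
    rw [h1]
    simp [Cplx.map, Cplx.conj]

variable {J j K}

/-- Intertwiners commute with the Clifford multiplication by vectors. -/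
theorem map_vectorAction {T : Spinor K →L[ℂ] Spinor J} (hT : (subRep J j K).IsIntertwiner T)
    (x : Cplx E) (s : Spinor K) :
    T (vectorAction K x s) = vectorAction J (Cplx.map j.toLinearMap x) (T s) := by
  rw [vectorAction_apply, map_smul, map_add, hT.map_creation, hT.map_annihilation, subRep_cr,
    subRep_an, ← conjMinus_minusPart, ← smul_add, smul_smul, mul_comm, sqrt_two_mul_inv, one_smul,
    ← add_apply, ← map_add, Cplx.conj_map, ← map_add]
  congr 3
  conv_rhs => rw [← plusPart_add_minusPart K x]
  congr 1
  exact Cplx.conj_conj _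

theorem isIntertwiner_of_map_vectorAction {T : Spinor K →L[ℂ] Spinor J}
    (hT : ∀ x s, T (vectorAction K x s) = vectorAction J (Cplx.map j.toLinearMap x) (T s)) :
    (subRep J j K).IsIntertwiner T where
  map_creation v s := by rw [creation_eq, map_smul, hT, subRep_cr]
  map_annihilation v s := by rw [annihilation_eq, map_smul, hT, subRep_an, Cplx.conj_map]

/-- The Clifford multiplication by a vector which is orthogonal to the image of `E⁺`, and so
anticommutes with the annihilation operators, preserves the space of vacuum vectors. -/
theorem vectorAction_mem_vacua {x : Cplx H} (hx : ∀ h, inner ℂ (Cplx.conj x)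
    (⟨j h, j (K.toCLM h)⟩ : Cplx H) = 0) {s : Spinor J} (hs : s ∈ (subRep J j K).vacua) :
    vectorAction J x s ∈ (subRep J j K).vacua := by
  rw [mem_vacua_iff] at hs ⊢
  intro h
  have := vectorAction_add_swap J x ⟨j h, j (K.toCLM h)⟩ s
  rwa [hx, mul_zero, zero_smul, hs, map_zero, zero_add] at this

theorem grading_mem_vacua {s : Spinor J} (hs : s ∈ (subRep J j K).vacua) :
    grading _ s ∈ (subRep J j K).vacua := by
  rw [mem_vacua_iff] at hs ⊢
  intro h
  have := grading_vectorAction J ⟨j h, j (K.toCLM h)⟩ s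
  rw [hs, map_zero] at this
  exact neg_eq_zero.1 this.symm

end SubRep

/-! ### Vacuum vectors and the Hilbert–Schmidt condition -/

namespace Cplx

variable {E H : Type*} [NormedAddCommGroup E] [InnerProductSpace ℝ E]
  [NormedAddCommGroup H] [InnerProductSpace ℝ H]

theorem norm_map (j : E →ₗᵢ[ℝ] H) (x : Cplx E) : ‖map j.toLinearMap x‖ = ‖x‖ := by
  refine (sq_eq_sq₀ (norm_nonneg _) (norm_nonneg _)).1 ?_
  rw [norm_sq_eq, norm_sq_eq]
  simp

theorem continuous_mk {X : Type*} [TopologicalSpace X] {f g : X → H} (hf : Continuous f)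
    (hg : Continuous g) : Continuous fun x => (⟨f x, g x⟩ : Cplx H) := by
  have h : Continuous fun a : H => (⟨a, 0⟩ : Cplx H) :=
    AddMonoidHomClass.continuous_of_bound
      (AddMonoidHom.mk' (fun a : H => (⟨a, 0⟩ : Cplx H)) fun a b => by ext <;> simp) 1 fun a => by
        refine (abs_le_of_sq_le_sq' ?_ (by positivity)).2
        rw [norm_sq_eq]
        simp
  have e : (fun x => (⟨f x, g x⟩ : Cplx H))
      = fun x => (⟨f x, 0⟩ : Cplx H) + Complex.I • (⟨g x, 0⟩ : Cplx H) := by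
    funext x
    ext <;> simp
  rw [e]
  exact (h.comp hf).add ((h.comp hg).const_smul Complex.I)

end Cplx

theorem coe_plusPart_mk_zero {E : Type*} [NormedAddCommGroup E] [InnerProductSpace ℝ E]
    (K : OrthComplexStructure E) (h : E) :
    (plusPart K ⟨h, 0⟩ : Cplx E) = (1 / 2 : ℂ) • (⟨h, -K.toCLM h⟩ : Cplx E) := by
  rw [coe_plusPart]
  ext <;> simp [OrthComplexStructure.complexified]

section HilbertSchmidt

variable {E H : Type*} [NormedAddCommGroup E] [InnerProductSpace ℝ E]
  [NormedAddCommGroup H] [InnerProductSpace ℝ H] (J : OrthComplexStructure H)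
  (j : E →ₗᵢ[ℝ] H) (K : OrthComplexStructure E)

/-- The component in `H⁺` of a vector of `E⁻` measures the difference of the two complex
structures. -/
theorem norm_plusPart_conj_map_sq (v : Hplus K) :
    ‖plusPart J (Cplx.conj (Cplx.map j.toLinearMap v))‖ ^ 2
      = 1 / 4 * (‖J.toCLM (j (v : Cplx E).re) - j (K.toCLM (v : Cplx E).re)‖ ^ 2
        + ‖J.toCLM (j (v : Cplx E).im) - j (K.toCLM (v : Cplx E).im)‖ ^ 2) := by
  obtain ⟨h1, h2⟩ := (mem_Hplus_iff K).1 v.2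
  have e : (plusPart J (Cplx.conj (Cplx.map j.toLinearMap v)) : Cplx H)
      = ⟨-(1 / 2 : ℝ) • (J.toCLM (j (v : Cplx E).im) - j (K.toCLM (v : Cplx E).im)),
        -(1 / 2 : ℝ) • (J.toCLM (j (v : Cplx E).re) - j (K.toCLM (v : Cplx E).re))⟩ := by
    rw [coe_plusPart, h1, h2]
    ext <;> simp [OrthComplexStructure.complexified] <;> module
  rw [show ‖plusPart J (Cplx.conj (Cplx.map j.toLinearMap v))‖
    = ‖(plusPart J (Cplx.conj (Cplx.map j.toLinearMap v)) : Cplx H)‖ from rfl, e,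
    Cplx.norm_sq_eq, norm_smul, norm_smul]
  norm_num
  ring

theorem annihilation_conj_map_vac (v : Hplus K) : (subRep J j K).an v (vac _)
    = creation (plusPart J (Cplx.conj (Cplx.map j.toLinearMap v))) (vac _) := by
  rw [subRep_an, vectorAction_apply, smul_smul, sqrt_two_mul_inv, one_smul, annihilation_vac,
    add_zero]

theorem norm_creation_vac_le {V : Type*} [NormedAddCommGroup V] [InnerProductSpace ℂ V] (v : V) :
    ‖creation v (vac V)‖ ≤ ‖v‖ := by
  have h := norm_wedge_le v (1 : ExteriorAlgebra ℂ V)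
  rw [← Fock.of.norm_map, ← Fock.of.norm_map (1 : ExteriorAlgebra ℂ V), ← creation_of] at h
  refine h.trans (le_of_eq ?_)
  rw [show Fock.of (1 : ExteriorAlgebra ℂ V) = vac V from rfl, norm_vac, mul_one]

/-- A skew operator maps Bessel families to families whose sum of squares is bounded by the square
of its Hilbert–Schmidt norm. -/
theorem sum_norm_sq_le_tsum {B : H →L[ℝ] H} (hB : ∀ x y, inner ℝ (B x) y = -inner ℝ x (B y))
    {ι : Type*} (b : HilbertBasis ι ℝ H) (hs : Summable fun i => ‖B (b i)‖ ^ 2)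
    {κ : Type*} [Fintype κ] {e : κ → Cplx H} (he : IsBessel e) :
    ∑ k, (‖B (e k).re‖ ^ 2 + ‖B (e k).im‖ ^ 2) ≤ ∑' i, ‖B (b i)‖ ^ 2 := by
  have h1 : ∀ z, HasSum (fun i => inner ℝ (B (b i)) z ^ 2) (‖B z‖ ^ 2) := fun z => by
    have := b.hasSum_inner_mul_inner (B z) (B z)
    rw [real_inner_self_eq_norm_sq] at this
    have h : ∀ i, inner ℝ (B z) (b i) * inner ℝ (b i) (B z) = inner ℝ (B (b i)) z ^ 2 := fun i => by
      rw [hB (b i) z, real_inner_comm (b i) (B z)]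
      ring
    simpa only [h] using this
  have h2 := hasSum_sum fun k (_ : k ∈ Finset.univ) => (h1 (e k).re).add (h1 (e k).im)
  refine hasSum_le (fun i => ?_) h2 hs.hasSum
  have h3 := he ⟨B (b i), 0⟩
  have h4 : ‖(⟨B (b i), 0⟩ : Cplx H)‖ ^ 2 = ‖B (b i)‖ ^ 2 := by
    rw [Cplx.norm_sq_eq]; simp
  rw [h4] at h3
  refine le_trans (le_of_eq (Finset.sum_congr rfl fun k _ => ?_)) h3
  rw [← Complex.normSq_eq_norm_sq, Complex.normSq_apply, Cplx.inner_def]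
  simp only [inner_zero_right, add_zero, zero_sub]
  rw [real_inner_comm (B (b i)), real_inner_comm (B (b i)) (e k).im]
  ring

/-- Bessel's inequality for orthogonal families of unit vectors and zero vectors. -/
theorem isBessel_of_orthogonal {V : Type*} [NormedAddCommGroup V] [InnerProductSpace ℂ V]
    {κ : Type*} [Fintype κ] {v : κ → V} (h1 : ∀ k, v k = 0 ∨ ‖v k‖ = 1)
    (h2 : ∀ k l, k ≠ l → inner ℂ (v k) (v l) = 0) : IsBessel v := by
  classical
  intro z
  have ho : Orthonormal ℂ fun k : {k // v k ≠ 0} => v k :=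
    ⟨fun k => (h1 k).resolve_left k.2, fun k l hkl => h2 k l fun h => hkl (Subtype.ext h)⟩
  have h := ho.sum_inner_products_le
    (s := (Finset.univ : Finset κ).subtype fun k => v k ≠ 0) z
  rw [Finset.sum_subtype_eq_sum_filter (f := fun k => ‖inner ℂ (v k) z‖ ^ 2)] at h
  rwa [Finset.sum_filter_of_ne] at h
  intro k _ hk h0
  rw [h0] at hk
  simp at hk

theorem inner_gramSchmidtNormed_eq_zero {V : Type*} [NormedAddCommGroup V] [InnerProductSpace ℂ V]
    (f : ℕ → V) {m n : ℕ} (h : m ≠ n) : inner ℂ (InnerProductSpace.gramSchmidtNormed ℂ f m)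
      (InnerProductSpace.gramSchmidtNormed ℂ f n) = 0 := by
  rw [InnerProductSpace.gramSchmidtNormed, InnerProductSpace.gramSchmidtNormed, inner_smul_left,
    inner_smul_right, InnerProductSpace.gramSchmidt_orthogonal ℂ f h]
  simp

/-- If `B` is a skew Hilbert–Schmidt operator which is `J ∘ j - j ∘ K` on `E`, then the expected
number of particles, relative to `K`, in the vacuum of `S_{H,J}` is finite, and so a vacuum vector
for `K` exists. -/
theorem vacua_ne_bot_of_isHilbertSchmidt [TopologicalSpace.SeparableSpace E] {B : H →L[ℝ] H}
    (hB : ∀ x y, inner ℝ (B x) y = -inner ℝ x (B y))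
    (hBj : ∀ h, B (j h) = J.toCLM (j h) - j (K.toCLM h)) (hHS : IsHilbertSchmidt B) :
    (subRep J j K).vacua ≠ ⊥ := by
  obtain ⟨s, b, hs⟩ := hHS
  -- an orthonormal sequence, up to zeros, whose span is dense in `E⁺`
  let f : ℕ → Hplus K := fun n => plusPart K ⟨TopologicalSpace.denseSeq E n, 0⟩
  let e := InnerProductSpace.gramSchmidtNormed ℂ f
  have hunit : ∀ n, e n = 0 ∨ ‖e n‖ = 1 := fun n =>
    or_iff_not_imp_left.2 fun h => InnerProductSpace.gramSchmidtNormed_unit_length' h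
  have hle : ∀ v : Hplus K, ‖(subRep J j K).an v (vac _)‖ ^ 2
      ≤ ‖B (Cplx.map j.toLinearMap v).re‖ ^ 2 + ‖B (Cplx.map j.toLinearMap v).im‖ ^ 2 := fun v => by
    have h1 := norm_plusPart_conj_map_sq J j K v
    have h2 := norm_creation_vac_le (plusPart J (Cplx.conj (Cplx.map j.toLinearMap v)))
    rw [← annihilation_conj_map_vac] at h2
    have h3 := pow_le_pow_left₀ (norm_nonneg _) h2 2
    rw [← hBj, ← hBj] at h1
    change _ ≤ ‖B (j (v : Cplx E).re)‖ ^ 2 + ‖B (j (v : Cplx E).im)‖ ^ 2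
    nlinarith [sq_nonneg ‖B (j (v : Cplx E).re)‖, sq_nonneg ‖B (j (v : Cplx E).im)‖]
  have hsum : Summable fun n => ‖(subRep J j K).an (e n) (vac _)‖ ^ 2 := by
    refine summable_of_sum_range_le (c := ∑' i, ‖B (b i)‖ ^ 2) (fun n => by positivity) fun n => ?_
    refine (Finset.sum_le_sum fun k _ => hle (e k)).trans ?_
    rw [← Fin.sum_univ_eq_sum_range (fun k => ‖B (Cplx.map j.toLinearMap (e k : Cplx E)).re‖ ^ 2
      + ‖B (Cplx.map j.toLinearMap (e k : Cplx E)).im‖ ^ 2) n]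
    refine sum_norm_sq_le_tsum hB b hs
      (e := fun k : Fin n => Cplx.map j.toLinearMap (e k : Cplx E)) ?_
    refine isBessel_of_orthogonal (fun k => ?_) fun k l hkl => ?_
    · rcases hunit k with h | h
      · left; rw [h]; exact map_zero _
      · right; rw [Cplx.norm_map]; exact h
    · rw [Cplx.inner_map_map]
      exact inner_gramSchmidtNormed_eq_zero f fun h => hkl (Fin.ext h)
  obtain ⟨φ, hφ, h⟩ := CARRep.exists_an_eq_zero (R := subRep J j K) (e := e)
    hunit
    (fun m n hmn => inner_gramSchmidtNormed_eq_zero f hmn) vac_ne_zero hsum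
  refine fun hbot => hφ ((Submodule.eq_bot_iff _).1 hbot φ ?_)
  rw [mem_vacua_iff]
  have hf : ∀ n, (subRep J j K).an (f n) φ = 0 := fun n => by
    refine (subRep J j K).an_eq_zero_of_mem_span (A := Set.range e) ?_ ?_
    · rintro _ ⟨n, rfl⟩; exact h n
    · rw [InnerProductSpace.span_gramSchmidtNormed_range, InnerProductSpace.span_gramSchmidt]
      exact Submodule.subset_span ⟨n, rfl⟩
  have hd : ∀ n, vectorAction J ⟨j (TopologicalSpace.denseSeq E n),
      j (K.toCLM (TopologicalSpace.denseSeq E n))⟩ φ = 0 := fun n => by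
    have h1 := (subRep_an_eq_zero_iff J j K).1 (hf n)
    have h2 : Cplx.conj (Cplx.map j.toLinearMap (f n : Cplx E)) = (1 / 2 : ℂ) •
        (⟨j (TopologicalSpace.denseSeq E n), j (K.toCLM (TopologicalSpace.denseSeq E n))⟩ :
          Cplx H) := by
      rw [coe_plusPart_mk_zero]
      ext <;> simp
    rw [h2, map_smul, smul_apply] at h1
    exact (smul_eq_zero_iff_right (by norm_num)).1 h1
  have hc : Continuous fun h => vectorAction J ⟨j h, j (K.toCLM h)⟩ φ :=
    (continuous_vectorAction_apply J φ).comp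
      (Cplx.continuous_mk j.continuous (j.continuous.comp K.toCLM.continuous))
  exact congrFun ((TopologicalSpace.denseRange_denseSeq E).equalizer hc continuous_const (funext hd))

/-- Families of the form `(M b + i N b) / 2`, for an orthonormal family `b` and contractions `M`
and `N`, satisfy Bessel's inequality. -/
theorem isBessel_half_mk [CompleteSpace H] {ι : Type*} [Fintype ι] {b : ι → H}
    (hb : Orthonormal ℝ b) {M N : H →L[ℝ] H} (hM : ‖M‖ ≤ 1) (hN : ‖N‖ ≤ 1) :
    IsBessel fun i => (1 / 2 : ℂ) • (⟨M (b i), N (b i)⟩ : Cplx H) := by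
  intro z
  set M' := ContinuousLinearMap.adjoint M with hM'
  set N' := ContinuousLinearMap.adjoint N with hN'
  have hM'' : ∀ x, ‖M' x‖ ≤ ‖x‖ := fun x => by
    refine (M'.le_opNorm x).trans ?_
    rw [hM', LinearIsometryEquiv.norm_map]
    exact mul_le_of_le_one_left (norm_nonneg _) hM
  have hN'' : ∀ x, ‖N' x‖ ≤ ‖x‖ := fun x => by
    refine (N'.le_opNorm x).trans ?_
    rw [hN', LinearIsometryEquiv.norm_map]
    exact mul_le_of_le_one_left (norm_nonneg _) hN
  have h1 : ∀ i, ‖inner ℂ ((1 / 2 : ℂ) • (⟨M (b i), N (b i)⟩ : Cplx H)) z‖ ^ 2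
      = 1 / 4 * (‖inner ℝ (b i) (M' z.re + N' z.im)‖ ^ 2
        + ‖inner ℝ (b i) (M' z.im - N' z.re)‖ ^ 2) := fun i => by
    rw [inner_smul_left, norm_mul, mul_pow, ← Complex.normSq_eq_norm_sq (inner ℂ _ z),
      Complex.normSq_apply, Cplx.inner_def, inner_add_right, inner_sub_right, hM', hN',
      ContinuousLinearMap.adjoint_inner_right, ContinuousLinearMap.adjoint_inner_right,
      ContinuousLinearMap.adjoint_inner_right, ContinuousLinearMap.adjoint_inner_right,
      Real.norm_eq_abs, Real.norm_eq_abs, sq_abs, sq_abs]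
    norm_num
    ring
  rw [Finset.sum_congr rfl fun i _ => h1 i, ← Finset.mul_sum, Finset.sum_add_distrib,
    Cplx.norm_sq_eq]
  have h2 := hb.sum_inner_products_le (s := Finset.univ) (M' z.re + N' z.im)
  have h3 := hb.sum_inner_products_le (s := Finset.univ) (M' z.im - N' z.re)
  have h4 : ‖M' z.re + N' z.im‖ ≤ ‖z.re‖ + ‖z.im‖ :=
    (norm_add_le _ _).trans (add_le_add (hM'' _) (hN'' _))
  have h5 : ‖M' z.im - N' z.re‖ ≤ ‖z.im‖ + ‖z.re‖ :=
    (norm_sub_le _ _).trans (add_le_add (hM'' _) (hN'' _))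
  have h6 := pow_le_pow_left₀ (norm_nonneg _) h4 2
  have h7 := pow_le_pow_left₀ (norm_nonneg _) h5 2
  nlinarith [sq_nonneg (‖z.re‖ - ‖z.im‖)]

variable (W : Submodule ℝ H) [FiniteDimensional ℝ W] (J' : OrthComplexStructure Wᗮ)

theorem extendByZero_apply (x : H) :
    extendByZero W J'.toCLM x = J'.toCLM (Wᗮ.orthogonalProjectionOnto x) := rfl

theorem extendByZero_coe (x : Wᗮ) : extendByZero W J'.toCLM x = J'.toCLM x := by
  rw [extendByZero_apply, Submodule.orthogonalProjectionOnto_mem_subspace_eq_self]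

theorem extendByZero_coe_of_mem {x : H} (hx : x ∈ W) : extendByZero W J'.toCLM x = 0 := by
  rw [extendByZero_apply, Submodule.orthogonalProjectionOnto_orthogonal_apply_eq_zero hx, map_zero]
  rfl

theorem inner_extendByZero_left (x y : H) : inner ℝ (extendByZero W J'.toCLM x) y
    = -inner ℝ x (extendByZero W J'.toCLM y) := by
  rw [extendByZero_apply, extendByZero_apply,
    ← Submodule.inner_orthogonalProjectionOnto_eq_of_mem_left,
    ← Submodule.inner_orthogonalProjectionOnto_eq_of_mem_right, J'.inner_apply_left]

theorem norm_extendByZero_le : ‖extendByZero W J'.toCLM‖ ≤ 1 := by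
  refine ContinuousLinearMap.opNorm_le_bound _ zero_le_one fun x => ?_
  rw [extendByZero_apply, one_mul, ← Submodule.coe_norm, J'.norm_apply]
  exact Wᗮ.norm_orthogonalProjectionOnto_apply_le x

theorem sum_norm_orthogonalProjectionOnto_sq_le {ι : Type*} [Fintype ι] {b : ι → H}
    (hb : Orthonormal ℝ b) :
    ∑ i, ‖W.orthogonalProjectionOnto (b i)‖ ^ 2 ≤ Module.finrank ℝ W := by
  have h1 : ∀ i, ‖W.orthogonalProjectionOnto (b i)‖ ^ 2
      = ∑ k, ‖inner ℝ (b i) (stdOrthonormalBasis ℝ W k : H)‖ ^ 2 := fun i => by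
    rw [← (stdOrthonormalBasis ℝ W).sum_sq_norm_inner_left]
    refine Finset.sum_congr rfl fun k _ => ?_
    rw [Submodule.inner_orthogonalProjectionOnto_eq_of_mem_right]
  rw [Finset.sum_congr rfl fun i _ => h1 i, Finset.sum_comm]
  refine (Finset.sum_le_sum fun k _ => hb.sum_inner_products_le (s := Finset.univ) _).trans ?_
  have h2 : ∀ k, ‖(stdOrthonormalBasis ℝ W k : H)‖ ^ 2 = 1 := fun k => by
    rw [← Submodule.coe_norm, (stdOrthonormalBasis ℝ W).norm_eq_one, one_pow]
  simp [h2]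

/-- If there is a vacuum vector, then the difference of the complex structures is
Hilbert–Schmidt. -/
theorem hsEquiv_of_vacua_ne_bot [CompleteSpace H]
    (hne : (subRep J Wᗮ.subtypeₗᵢ J').vacua ≠ ⊥) :
    HSEquiv J.toCLM (extendByZero W J'.toCLM) := by
  obtain ⟨Ω, hΩ, hΩ0⟩ := Submodule.exists_mem_ne_zero_of_ne_bot hne
  obtain ⟨C, hC⟩ := exists_bound_of_annihilated hΩ0
  obtain ⟨w, b, -⟩ := exists_hilbertBasis ℝ H
  refine ⟨w, b, summable_of_sum_le (c := 32 * C + 2 * Module.finrank ℝ W)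
    (fun i => by positivity) fun F => ?_⟩
  set B := J.toCLM - extendByZero W J'.toCLM with hB
  have hb : Orthonormal ℝ fun i : F => b i := b.orthonormal.comp _ Subtype.val_injective
  -- the vacuum vector is killed by the annihilation operators of the `v i`, which are the
  -- operators `creation (p i) + annihilation (q i)`; up to the contribution of the part of `b i` in
  -- `W`, the norm of `B (b i)` is bounded by a multiple of the norm of `p i`
  let v : F → Hplus J' := fun i => plusPart J' ⟨Wᗮ.orthogonalProjectionOnto (b i), 0⟩
  let p : F → Hplus J := fun i =>
    plusPart J (Cplx.conj (Cplx.map Wᗮ.subtypeₗᵢ.toLinearMap (v i)))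
  let q : F → Hplus J := fun i => plusPart J (Cplx.map Wᗮ.subtypeₗᵢ.toLinearMap (v i))
  have hP : ‖Wᗮ.starProjection‖ ≤ 1 := Wᗮ.starProjection_norm_le
  have hp : IsBessel p := fun z => by
    have h := isBessel_half_mk hb hP (norm_extendByZero_le W J') (z : Cplx H)
    refine le_trans (le_of_eq (Finset.sum_congr rfl fun i _ => ?_)) h
    rw [inner_plusPart_left]
    congr 3
    simp only [v]
    rw [coe_plusPart_mk_zero]
    ext <;> simp [extendByZero_apply]
  have hq : IsBessel q := fun z => by
    have h := isBessel_half_mk hb hP (N := -extendByZero W J'.toCLM)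
      (by rw [norm_neg]; exact norm_extendByZero_le W J') (z : Cplx H)
    refine le_trans (le_of_eq (Finset.sum_congr rfl fun i _ => ?_)) h
    rw [inner_plusPart_left]
    congr 3
    simp only [v]
    rw [coe_plusPart_mk_zero]
    ext <;> simp [extendByZero_apply]
  have hpq : ∀ i, creation (p i) Ω + annihilation (q i) Ω = 0 := fun i => by
    have h := (subRep_an_eq_zero_iff J Wᗮ.subtypeₗᵢ J').1 (hΩ (v i))
    rw [vectorAction_apply, Cplx.conj_conj, smul_eq_zero_iff_right (by simp)] at h
    exact h
  have hsum := hC F p q hp hq hpq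
  have hle : ∀ i : F, ‖B (b i)‖ ^ 2 ≤ 32 * ‖p i‖ ^ 2 + 2 * ‖W.orthogonalProjectionOnto (b i)‖ ^ 2 :=
    fun i => by
      have h1 : B (b i) = B (Wᗮ.orthogonalProjectionOnto (b i))
          + J.toCLM (W.orthogonalProjectionOnto (b i)) := by
        have e : B (W.orthogonalProjectionOnto (b i)) = J.toCLM (W.orthogonalProjectionOnto (b i)) := by
          rw [hB, sub_apply, extendByZero_coe_of_mem W J' (W.orthogonalProjectionOnto (b i)).2,
            sub_zero]
        rw [← e, ← map_add]
        congr 1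
        exact (by
          rw [add_comm]
          exact (W.starProjection_add_starProjection_orthogonal (b i)).symm)
      have h2 : ‖B (Wᗮ.orthogonalProjectionOnto (b i))‖ ^ 2 ≤ 16 * ‖p i‖ ^ 2 := by
        have e := norm_plusPart_conj_map_sq J Wᗮ.subtypeₗᵢ J' (v i)
        have e1 : ((v i : Cplx Wᗮ)).re = (1 / 2 : ℝ) • Wᗮ.orthogonalProjectionOnto (b i) := by
          simp only [v]
          rw [coe_plusPart_mk_zero]
          simp
        have e2 : J.toCLM (Wᗮ.subtypeₗᵢ (v i : Cplx Wᗮ).re)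
            - Wᗮ.subtypeₗᵢ (J'.toCLM (v i : Cplx Wᗮ).re)
            = (1 / 2 : ℝ) • B (Wᗮ.orthogonalProjectionOnto (b i)) := by
          rw [e1, hB, sub_apply, extendByZero_coe, map_smul, map_smul, map_smul, map_smul,
            smul_sub]
          rfl
        rw [e2, norm_smul, mul_pow] at e
        change ‖p i‖ ^ 2 = _ at e
        rw [e]
        norm_num
        nlinarith [sq_nonneg ‖J.toCLM (Wᗮ.subtypeₗᵢ (v i : Cplx Wᗮ).im)
          - Wᗮ.subtypeₗᵢ (J'.toCLM (v i : Cplx Wᗮ).im)‖]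
      have h3 := norm_add_le (B (Wᗮ.orthogonalProjectionOnto (b i)))
        (J.toCLM (W.orthogonalProjectionOnto (b i)))
      rw [← h1, J.norm_apply, ← Submodule.coe_norm] at h3
      have h4 := pow_le_pow_left₀ (norm_nonneg _) h3 2
      nlinarith [sq_nonneg (‖B (Wᗮ.orthogonalProjectionOnto (b i))‖
        - ‖W.orthogonalProjectionOnto (b i)‖)]
  rw [← Finset.sum_coe_sort F]
  refine (Finset.sum_le_sum fun i _ => hle i).trans ?_
  rw [Finset.sum_add_distrib, ← Finset.mul_sum, ← Finset.mul_sum]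
  have := sum_norm_orthogonalProjectionOnto_sq_le W hb
  linarith

end HilbertSchmidt

/-! ### Intertwiners and vacuum vectors -/

section Intertwining

variable {E H : Type*} [NormedAddCommGroup E] [InnerProductSpace ℝ E]
  [NormedAddCommGroup H] [InnerProductSpace ℝ H] {J : OrthComplexStructure H}
  {j : E →ₗᵢ[ℝ] H} {K : OrthComplexStructure E}

theorem zmod_two_eq (k : ZMod 2) : k = 0 ∨ k = 1 := by
  revert k
  decide

theorem CARRep.IsIntertwiner.neg {V S : Type*} [NormedAddCommGroup V] [InnerProductSpace ℂ V]
    [NormedAddCommGroup S] [InnerProductSpace ℂ S] [CompleteSpace S] {R : CARRep V S}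
    {T : Fock V →L[ℂ] S} (hT : R.IsIntertwiner T) : R.IsIntertwiner (-T) where
  map_creation v s := by rw [neg_apply, neg_apply, hT.map_creation, map_neg]
  map_annihilation v s := by rw [neg_apply, neg_apply, hT.map_annihilation, map_neg]

theorem grading_mem_parity {V : Type*} [NormedAddCommGroup V] [InnerProductSpace ℂ V] {k : ZMod 2}
    {s : Fock V} (hs : s ∈ Fock.parity V k) : grading V s ∈ Fock.parity V k := by
  have hs' := mem_parity_iff.1 hs
  rw [hs']
  rcases zmod_two_eq k with rfl | rfl
  · rwa [uzpow_zero, one_smul]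
  · rw [uzpow_one, Units.neg_smul, one_smul]
    exact neg_mem hs

/-- An intertwiner which maps the vacuum to a vector of parity `p` shifts the parity by `p`. -/
theorem grading_map {T : Spinor K →L[ℂ] Spinor J} (hT : (subRep J j K).IsIntertwiner T)
    {p : ZMod 2} (hp : T (vac _) ∈ Spinor.parity J p) (s : Spinor K) :
    grading _ (T s) = (-1 : ℤˣ) ^ p • T (grading _ s) := by
  have h1 : (subRep J j K).IsIntertwiner (grading _ ∘L T ∘L grading _) :=
    isIntertwiner_of_map_vectorAction fun x s => by
      change grading _ (T (grading _ (vectorAction K x s))) = vectorAction J _ (grading _ (T (grading _ s)))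
      rw [grading_vectorAction, map_neg, map_neg, map_vectorAction hT, grading_vectorAction, neg_neg]
  have h2 : (grading _ ∘L T ∘L grading _) (vac _) = grading _ (T (vac _)) := by
    change grading _ (T (grading _ (vac _))) = _
    rw [grading_vac]
  rw [mem_parity_iff] at hp
  rcases zmod_two_eq p with rfl | rfl
  · rw [uzpow_zero, one_smul] at hp ⊢
    have h3 := h1.ext hT (h2.trans hp)
    conv_rhs => rw [← h3]
    exact congrArg (fun s => grading _ (T s)) (grading_grading s).symm
  · rw [uzpow_one, Units.neg_smul, one_smul] at hp ⊢
    have h3 := h1.ext hT.neg (h2.trans hp)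
    rw [← neg_apply, ← h3]
    exact congrArg (fun s => grading _ (T s)) (grading_grading s).symm

theorem map_mem_parity_iff {T : Spinor K →L[ℂ] Spinor J} (hT : (subRep J j K).IsIntertwiner T)
    {p : ZMod 2} (hp : T (vac _) ∈ Spinor.parity J p) (h0 : T (vac _) ≠ 0) {k : ZMod 2}
    {s : Spinor K} : T s ∈ Spinor.parity J (p + k) ↔ s ∈ Spinor.parity K k := by
  have hinj : Function.Injective T := (injective_iff_map_eq_zero T).2 fun s hs => by
    have := hT.norm_map s
    rw [hs, norm_zero, eq_comm, mul_eq_zero] at this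
    exact norm_eq_zero.1 (this.resolve_left (norm_ne_zero_iff.2 h0))
  have hu : ∀ (u : ℤˣ) s, T (u • s) = u • T s := fun u s => by
    rcases Int.units_eq_one_or u with rfl | rfl <;> simp [Units.neg_smul]
  rw [mem_parity_iff, mem_parity_iff, grading_map hT hp, uzpow_add, mul_smul, smul_left_cancel_iff,
    ← hu, hinj.eq_iff]

theorem map_mem_parity {T : Spinor K →L[ℂ] Spinor J} (hT : (subRep J j K).IsIntertwiner T)
    {p : ZMod 2} (hp : T (vac _) ∈ Spinor.parity J p) {k : ZMod 2} {s : Spinor K}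
    (hs : s ∈ Spinor.parity K k) : T s ∈ Spinor.parity J (p + k) := by
  by_cases h0 : T (vac _) = 0
  · have := hT.norm_map s
    rw [h0, norm_zero, zero_mul, norm_eq_zero] at this
    rw [this]
    exact zero_mem _
  · exact (map_mem_parity_iff hT hp h0).2 hs

theorem map_cliffordAction {U : Submodule ℝ H} {K : OrthComplexStructure U}
    {T : Spinor K →L[ℂ] Spinor J} (hT : (subRep J U.subtypeₗᵢ K).IsIntertwiner T) (a : Cl U)
    (s : Spinor K) : T (cliffordAction K a s) = cliffordAction J (clIncl U a) (T s) := by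
  induction a using CliffordAlgebra.induction generalizing s with
  | algebraMap r =>
    rw [AlgHom.commutes, AlgHom.commutes, AlgHom.commutes, Algebra.algebraMap_eq_smul_one,
      Algebra.algebraMap_eq_smul_one]
    exact map_smul T r s
  | ι x =>
    rw [cliffordAction_ι, map_vectorAction hT, clIncl, CliffordAlgebra.map_apply_ι,
      cliffordAction_ι]
    rfl
  | mul a b ha hb =>
    rw [map_mul, map_mul, map_mul]
    exact (ha _).trans (congrArg _ (hb s))
  | add a b ha hb => rw [map_add, map_add, map_add, add_apply, add_apply, map_add, ha, hb]

theorem grading_cliffordAction {j : ZMod 2} {a : Cl H} (ha : a ∈ Cl.parity H j) (s : Spinor J) :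
    grading _ (cliffordAction J a s) = (-1 : ℤˣ) ^ j • cliffordAction J a (grading _ s) := by
  have h : ∀ a s, grading _ (cliffordAction J a s)
      = cliffordAction J (CliffordAlgebra.involute a) (grading _ s) := fun a => by
    induction a using CliffordAlgebra.induction with
    | algebraMap r =>
      intro s
      rw [AlgHom.commutes, AlgHom.commutes, AlgHom.commutes, Algebra.algebraMap_eq_smul_one]
      exact map_smul (grading _) r s
    | ι x =>
      intro s
      rw [CliffordAlgebra.involute_ι, map_neg, cliffordAction_ι, grading_vectorAction]
      rfl
    | mul a b ha hb =>
      intro s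
      rw [map_mul, map_mul, map_mul]
      exact (ha _).trans (congrArg _ (hb s))
    | add a b ha hb =>
      intro s
      rw [map_add, map_add, map_add, add_apply, add_apply, map_add, ha, hb]
  rcases zmod_two_eq j with rfl | rfl
  · rw [h, CliffordAlgebra.involute_eq_of_mem_even ha, uzpow_zero, one_smul]
  · rw [h, CliffordAlgebra.involute_eq_of_mem_odd ha, uzpow_one, Units.neg_smul, one_smul, map_neg]
    rfl

variable (W : Submodule ℝ H) {J' : OrthComplexStructure Wᗮ}

theorem mem_ungradedHom_iff {T : Spinor J' →L[ℂ] Spinor J} :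
    T ∈ ungradedHom W J J' ↔ (subRep J Wᗮ.subtypeₗᵢ J').IsIntertwiner T := by
  refine ⟨fun hT => isIntertwiner_of_map_vectorAction fun x s => ?_,
    fun hT a s => map_cliffordAction hT a s⟩
  have h := hT (CliffordAlgebra.ι _ x) s
  rwa [cliffordAction_ι, clIncl, CliffordAlgebra.map_apply_ι, cliffordAction_ι] at h

theorem nontrivial_ungradedHom_iff :
    Nontrivial (ungradedHom W J J') ↔ (subRep J Wᗮ.subtypeₗᵢ J').vacua ≠ ⊥ := by
  rw [Submodule.nontrivial_iff_ne_bot, Submodule.ne_bot_iff, Submodule.ne_bot_iff]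
  constructor
  · rintro ⟨T, hT, h0⟩
    rw [mem_ungradedHom_iff] at hT
    refine ⟨T (vac _), hT.map_vac_mem, fun h => h0 (ContinuousLinearMap.ext fun s => ?_)⟩
    have := hT.norm_map s
    rw [h, norm_zero, zero_mul, norm_eq_zero] at this
    rw [this, zero_apply]
  · rintro ⟨Ω, hΩ, h0⟩
    obtain ⟨T, hT, hTΩ⟩ := CARRep.exists_isIntertwiner _ hΩ
    refine ⟨T, (mem_ungradedHom_iff W).2 hT, ?_⟩
    rintro rfl
    exact h0 (by rw [← hTΩ, zero_apply])

/-- Odd operators which commute in the graded sense with the Clifford algebra become intertwiners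
after composition with the grading operator. -/
theorem isIntertwiner_of_mem_gradedHom {T : Spinor J' →L[ℂ] Spinor J} :
    (T ∈ gradedHom W J J' 0 → (subRep J Wᗮ.subtypeₗᵢ J').IsIntertwiner T) ∧
    (T ∈ gradedHom W J J' 1 → (subRep J Wᗮ.subtypeₗᵢ J').IsIntertwiner (T ∘L grading _)) := by
  refine ⟨fun hT => isIntertwiner_of_map_vectorAction fun x s => ?_,
    fun hT => isIntertwiner_of_map_vectorAction fun x s => ?_⟩
  · have h := hT.2 1 (CliffordAlgebra.ι _ x) (CliffordAlgebra.ι_mem_evenOdd_one _ x) s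
    rwa [cliffordAction_ι, clIncl, CliffordAlgebra.map_apply_ι, cliffordAction_ι, zero_mul,
      uzpow_zero, one_smul] at h
  · have h := hT.2 1 (CliffordAlgebra.ι _ x) (CliffordAlgebra.ι_mem_evenOdd_one _ x) (grading _ s)
    rw [cliffordAction_ι, clIncl, CliffordAlgebra.map_apply_ι, cliffordAction_ι, mul_one,
      uzpow_one, Units.neg_smul, one_smul] at h
    change T (grading _ (vectorAction J' x s)) = vectorAction J _ (T (grading _ s))
    rw [grading_vectorAction, map_neg, h, neg_neg]
    rfl

/-- Every homogeneous vacuum vector is the image of the vacuum under a homogeneous element of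
`S_W`. -/
theorem exists_mem_gradedHom {k : ZMod 2} {Ω : Spinor J}
    (hΩ : Ω ∈ (subRep J Wᗮ.subtypeₗᵢ J').vacua) (hk : Ω ∈ Spinor.parity J k) :
    ∃ T ∈ gradedHom W J J' k, T (vac _) = Ω := by
  obtain ⟨T, hT, rfl⟩ := CARRep.exists_isIntertwiner _ hΩ
  rcases zmod_two_eq k with rfl | rfl
  · refine ⟨T, ⟨fun l s hs => map_mem_parity hT hk hs, fun l a _ s => ?_⟩, rfl⟩
    rw [zero_mul, uzpow_zero, one_smul, map_cliffordAction hT]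
  · refine ⟨T ∘L grading _, ⟨fun l s hs => map_mem_parity hT hk (grading_mem_parity hs),
      fun l a ha s => ?_⟩, ?_⟩
    · change T (grading _ (cliffordAction J' a s)) = _ • cliffordAction J (clIncl _ a) (T (grading _ s))
      rw [grading_cliffordAction ha, one_mul, ← map_cliffordAction hT]
      rcases zmod_two_eq l with rfl | rfl
      · rw [uzpow_zero, one_smul, one_smul]
      · rw [uzpow_one, Units.neg_smul, one_smul, map_neg, Units.neg_smul, one_smul]
    · change T (grading _ (vac _)) = _
      rw [grading_vac]

theorem map_vac_mem_parity {k : ZMod 2} {T : Spinor J' →L[ℂ] Spinor J}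
    (hT : T ∈ gradedHom W J J' k) : T (vac _) ∈ Spinor.parity J k := by
  have := hT.1 0 _ vac_mem_parity
  rwa [add_zero] at this

theorem map_vac_mem_vacua {T : Spinor J' →L[ℂ] Spinor J} (hT : T ∈ spinorHom W J J') :
    T (vac _) ∈ (subRep J Wᗮ.subtypeₗᵢ J').vacua := by
  obtain ⟨T₀, h₀, T₁, h₁, rfl⟩ := Submodule.mem_sup.1 hT
  have i₀ := ((isIntertwiner_of_mem_gradedHom W).1 h₀).map_vac_mem
  have i₁ := ((isIntertwiner_of_mem_gradedHom W).2 h₁).map_vac_mem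
  rw [ContinuousLinearMap.comp_apply, grading_vac] at i₁
  exact add_mem i₀ i₁

/-- All elements of `S_W` are multiples of isometries: both their even and their odd parts are, and
the values of the two parts at the same spinor are orthogonal. -/
theorem norm_map_of_mem_spinorHom {T : Spinor J' →L[ℂ] Spinor J} (hT : T ∈ spinorHom W J J')
    (s : Spinor J') : ‖T s‖ = ‖T (vac _)‖ * ‖s‖ := by
  obtain ⟨T₀, h₀, T₁, h₁, rfl⟩ := Submodule.mem_sup.1 hT
  have i₀ := (isIntertwiner_of_mem_gradedHom W).1 h₀
  have i₁ := (isIntertwiner_of_mem_gradedHom W).2 h₁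
  have hv : (T₁ ∘L grading _) (vac _) = T₁ (vac _) := by
    rw [ContinuousLinearMap.comp_apply, grading_vac]
  have hT₁ : ∀ s, T₁ s = (T₁ ∘L grading _) (grading _ s) := fun s => by
    rw [ContinuousLinearMap.comp_apply, grading_grading]
  have h01 : ∀ s, inner ℂ (T₀ s) (T₁ s) = 0 := fun s => by
    rw [hT₁, i₀.inner_map_map _ i₁, hv, inner_eq_zero_of_mem_parity (map_vac_mem_parity W h₀)
      (map_vac_mem_parity W h₁), zero_mul]
  have hn : ∀ s, ‖(T₀ + T₁) s‖ ^ 2 = (‖T₀ (vac _)‖ ^ 2 + ‖T₁ (vac _)‖ ^ 2) * ‖s‖ ^ 2 := fun s => by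
    have e₁ : ‖T₁ s‖ = ‖T₁ (vac _)‖ * ‖s‖ := by
      rw [hT₁, i₁.norm_map, hv, norm_grading]
    rw [add_apply, norm_add_sq (𝕜 := ℂ), h01, map_zero, i₀.norm_map, e₁]
    ring
  have h2 : ‖(T₀ + T₁) s‖ ^ 2 = (‖(T₀ + T₁) (vac _)‖ * ‖s‖) ^ 2 := by
    rw [mul_pow, hn, hn (vac _), norm_vac]
    ring
  exact (sq_eq_sq₀ (norm_nonneg _) (by positivity)).1 h2

variable (J J') in
/-- Evaluation at the vacuum, as an isometry from `S_W` to the space of vacuum vectors. -/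
def evalVac : spinorHom W J J' →ₗᵢ[ℂ] Spinor J where
  toFun T := T.1 (vac _)
  map_add' _ _ := rfl
  map_smul' _ _ := rfl
  norm_map' T := by
    refine le_antisymm ?_ (ContinuousLinearMap.opNorm_le_bound _ (norm_nonneg _) fun s =>
      (norm_map_of_mem_spinorHom W T.2 s).le)
    have := T.1.le_opNorm (vac _)
    rwa [norm_vac, mul_one] at this

theorem range_evalVac : LinearMap.range (evalVac J W J').toLinearMap
    = (subRep J Wᗮ.subtypeₗᵢ J').vacua := by
  refine le_antisymm ?_ fun Ω hΩ => ?_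
  · rintro _ ⟨T, rfl⟩
    exact map_vac_mem_vacua W T.2
  · have hg := grading_mem_vacua hΩ
    obtain ⟨p₀, p₁⟩ := exists_add_mem_parity Ω
    obtain ⟨T₀, h₀, e₀⟩ := exists_mem_gradedHom W (Submodule.smul_mem _ _ (add_mem hΩ hg)) p₀
    obtain ⟨T₁, h₁, e₁⟩ := exists_mem_gradedHom W (Submodule.smul_mem _ _ (sub_mem hΩ hg)) p₁
    refine ⟨⟨T₀ + T₁, Submodule.add_mem_sup h₀ h₁⟩, ?_⟩
    change T₀ (vac _) + T₁ (vac _) = Ω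
    rw [e₀, e₁]
    module

theorem nontrivial_spinorHom_iff :
    Nontrivial (spinorHom W J J') ↔ (subRep J Wᗮ.subtypeₗᵢ J').vacua ≠ ⊥ := by
  rw [← range_evalVac, Ne, LinearMap.range_eq_bot, ← not_subsingleton_iff_nontrivial, not_iff_not]
  constructor
  · intro h
    ext T
    rw [Subsingleton.elim T 0, map_zero, map_zero]
  · intro h
    refine ⟨fun S T => (evalVac J W J').injective ?_⟩
    exact (congrArg (fun f : spinorHom W J J' →ₗ[ℂ] Spinor J => f S) h).trans
      (congrArg (fun f : spinorHom W J J' →ₗ[ℂ] Spinor J => f T) h).symm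

theorem mem_spinorHomParity_iff {k : ZMod 2} {T : spinorHom W J J'} :
    T ∈ spinorHomParity W J J' k ↔ evalVac J W J' T ∈ Spinor.parity J k := by
  refine ⟨fun hT => map_vac_mem_parity W hT, fun hT => ?_⟩
  obtain ⟨S, hS, h⟩ := exists_mem_gradedHom W (map_vac_mem_vacua W T.2) hT
  have : (⟨S, gradedHom_le W J J' k hS⟩ : spinorHom W J J') = T := (evalVac J W J').injective h
  rw [← this]
  exact hS

end Intertwining

/-! ### The spinor module of a finite-dimensional subspace -/

section ComplexStructures

/-- The complex structure `(x, y) ↦ (-y, x)`. -/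
def rotation (F : Type*) [NormedAddCommGroup F] [InnerProductSpace ℝ F] :
    WithLp 2 (F × F) →ₗ[ℝ] WithLp 2 (F × F) where
  toFun x := WithLp.toLp 2 (-x.snd, x.fst)
  map_add' x y := WithLp.ofLp_injective 2 (Prod.ext (by simp [add_comm]) (by simp))
  map_smul' c x := WithLp.ofLp_injective 2 (Prod.ext (by simp) (by simp))

theorem nonempty_orthComplexStructure {W : Type*} [NormedAddCommGroup W] [InnerProductSpace ℝ W]
    [FiniteDimensional ℝ W] (hW : Even (Module.finrank ℝ W)) :
    Nonempty (OrthComplexStructure W) := by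
  obtain ⟨m, hm⟩ := hW
  have hF : Module.finrank ℝ (WithLp 2 (EuclideanSpace ℝ (Fin m) × EuclideanSpace ℝ (Fin m)))
      = Module.finrank ℝ W := by
    rw [(WithLp.linearEquiv 2 ℝ _).finrank_eq, Module.finrank_prod, finrank_euclideanSpace_fin, hm]
  let e : W ≃ₗᵢ[ℝ] WithLp 2 (EuclideanSpace ℝ (Fin m) × EuclideanSpace ℝ (Fin m)) :=
    (stdOrthonormalBasis ℝ W).equiv (stdOrthonormalBasis ℝ _) (finCongr hF.symm)
  have hK : ∀ x, rotation (EuclideanSpace ℝ (Fin m)) (rotation _ x) = -x := fun x =>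
    WithLp.ofLp_injective 2 (Prod.ext (by simp [rotation]) (by simp [rotation]))
  have hK' : ∀ x y, inner ℝ (rotation (EuclideanSpace ℝ (Fin m)) x) (rotation _ y) = inner ℝ x y :=
    fun x y => by
      rw [WithLp.prod_inner_apply, WithLp.prod_inner_apply, add_comm]
      simp [rotation]
  refine ⟨⟨LinearMap.toContinuousLinearMap
    (e.symm.toLinearEquiv.toLinearMap ∘ₗ rotation _ ∘ₗ e.toLinearEquiv.toLinearMap), fun v => ?_,
      fun v w => ?_⟩⟩
  · change e.symm (rotation _ (e (e.symm (rotation _ (e v))))) = -v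
    rw [e.apply_symm_apply, hK, map_neg, e.symm_apply_apply]
  · change inner ℝ (e.symm (rotation _ (e v))) (e.symm (rotation _ (e w))) = _
    rw [e.symm.inner_map_map, hK', e.inner_map_map]

variable {H : Type*} [NormedAddCommGroup H] [InnerProductSpace ℝ H]
  (W : Submodule ℝ H) [FiniteDimensional ℝ W]

/-- The direct sum of orthogonal complex structures on a subspace and on its orthogonal
complement. -/
def OrthComplexStructure.directSum (K : OrthComplexStructure W) (J' : OrthComplexStructure Wᗮ) :
    OrthComplexStructure H where
  toCLM := W.subtypeL ∘L K.toCLM ∘L W.orthogonalProjectionOnto + extendByZero W J'.toCLM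
  sq v := by
    have h : ∀ (u : W) (u' : Wᗮ), W.orthogonalProjectionOnto ((u : H) + u') = u ∧
        Wᗮ.orthogonalProjectionOnto ((u : H) + u') = u' := fun u u' => by
      rw [map_add, map_add, Submodule.orthogonalProjectionOnto_mem_subspace_eq_self,
        Submodule.orthogonalProjectionOnto_mem_subspace_eq_self,
        Submodule.orthogonalProjectionOnto_orthogonal_apply_eq_zero u.2,
        Submodule.orthogonalProjectionOnto_apply_of_mem_orthogonal u'.2, add_zero, zero_add]
      exact ⟨rfl, rfl⟩
    change (K.toCLM (W.orthogonalProjectionOnto ((K.toCLM (W.orthogonalProjectionOnto v) : H)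
        + J'.toCLM (Wᗮ.orthogonalProjectionOnto v))) : H)
      + J'.toCLM (Wᗮ.orthogonalProjectionOnto ((K.toCLM (W.orthogonalProjectionOnto v) : H)
        + J'.toCLM (Wᗮ.orthogonalProjectionOnto v))) = -v
    rw [(h _ _).1, (h _ _).2, K.sq, J'.sq]
    conv_rhs => rw [← W.starProjection_add_starProjection_orthogonal v]
    rw [neg_add]
    rfl
  orth v w := by
    change inner ℝ ((K.toCLM (W.orthogonalProjectionOnto v) : H)
        + J'.toCLM (Wᗮ.orthogonalProjectionOnto v)) ((K.toCLM (W.orthogonalProjectionOnto w) : H)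
        + J'.toCLM (Wᗮ.orthogonalProjectionOnto w)) = inner ℝ v w
    have h : ∀ (u : W) (u' : Wᗮ), inner ℝ (u : H) (u' : H) = 0 := fun u u' => u'.2 u u.2
    have h' : ∀ (u : W) (u' : Wᗮ), inner ℝ (u' : H) (u : H) = 0 := fun u u' => by
      rw [real_inner_comm, h]
    conv_rhs => rw [← W.starProjection_add_starProjection_orthogonal v,
      ← W.starProjection_add_starProjection_orthogonal w]
    rw [Submodule.starProjection_apply, Submodule.starProjection_apply,
      Submodule.starProjection_apply, Submodule.starProjection_apply]
    simp only [inner_add_left, inner_add_right, h, h', add_zero, zero_add]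
    rw [← Submodule.coe_inner, ← Submodule.coe_inner, ← Submodule.coe_inner, ← Submodule.coe_inner,
      K.orth, J'.orth]

theorem finite_Cplx (W : Type*) [NormedAddCommGroup W] [InnerProductSpace ℝ W]
    [FiniteDimensional ℝ W] : FiniteDimensional ℂ (Cplx W) := by
  let f : W × W →ₗ[ℝ] Cplx W :=
    { toFun := fun p => ⟨p.1, p.2⟩
      map_add' := fun p q => by ext <;> simp
      map_smul' := fun c p => by
        change _ = (c : ℂ) • (⟨p.1, p.2⟩ : Cplx W)
        ext <;> simp [-Complex.coe_smul] }
  have : Module.Finite ℝ (Cplx W) := Module.Finite.of_surjective f fun x => ⟨(x.re, x.im), rfl⟩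
  exact Module.Finite.of_restrictScalars_finite ℝ ℂ (Cplx W)

end ComplexStructures

section SpinorModuleStructure

variable {H : Type*} [NormedAddCommGroup H] [InnerProductSpace ℝ H] {J : OrthComplexStructure H}

/-- The vacuum vector of an orthogonal complex structure on all of `H` is unique up to scalars,
because `S_{H,J}` is irreducible. -/
theorem exists_eq_smul_of_mem_vacua {K : OrthComplexStructure H} {Ω Ψ : Spinor J}
    (hΩ : Ω ∈ (subRep J LinearIsometry.id K).vacua) (h0 : Ω ≠ 0)
    (hΨ : Ψ ∈ (subRep J LinearIsometry.id K).vacua) : ∃ c : ℂ, Ψ = c • Ω := by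
  obtain ⟨T, hT, rfl⟩ := CARRep.exists_isIntertwiner _ hΩ
  have hpos : 0 < ‖T (vac _)‖ := norm_pos_iff.2 h0
  have hanti : AntilipschitzWith (‖T (vac _)‖₊)⁻¹ T := T.antilipschitz_of_bound fun s => by
    rw [hT.norm_map s, NNReal.coe_inv, coe_nnnorm, inv_mul_cancel_left₀ hpos.ne']
  have hrange : ∀ x, ∀ s ∈ LinearMap.range T.toLinearMap,
      vectorAction J x s ∈ LinearMap.range T.toLinearMap := by
    rintro x _ ⟨s, rfl⟩
    exact ⟨vectorAction K x s, map_vectorAction hT x s⟩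
  have htop : LinearMap.range T.toLinearMap = ⊤ := by
    refine Fock.irreducible ?_ ?_ (fun v s hs => ?_) fun v s hs => ?_
    · exact hanti.isClosed_range T.uniformContinuous
    · exact fun h => h0 ((Submodule.eq_bot_iff _).1 h _ ⟨_, rfl⟩)
    · rw [creation_eq]; exact Submodule.smul_mem _ _ (hrange _ _ hs)
    · rw [annihilation_eq]; exact Submodule.smul_mem _ _ (hrange _ _ hs)
  obtain ⟨s, rfl⟩ : Ψ ∈ LinearMap.range T.toLinearMap := htop ▸ Submodule.mem_top
  refine ⟨inner ℂ (vac _) s, ?_⟩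
  have hs := eq_smul_vac (s := s) fun v => hanti.injective
    ((hT.map_annihilation v s).trans ((hΨ v).trans (map_zero T).symm))
  conv_lhs => rw [hs]
  exact map_smul T _ _

variable (W : Submodule ℝ H) {K : OrthComplexStructure W} {J' : OrthComplexStructure Wᗮ}

theorem vectorAction_map_mem_vacua (x : Cplx W) {s : Spinor J}
    (hs : s ∈ (subRep J Wᗮ.subtypeₗᵢ J').vacua) :
    vectorAction J (Cplx.map W.subtypeₗᵢ.toLinearMap x) s
      ∈ (subRep J Wᗮ.subtypeₗᵢ J').vacua := by
  refine vectorAction_mem_vacua (fun h => ?_) hs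
  have e : ∀ (u : W) (u' : Wᗮ), inner ℝ (u : H) (u' : H) = 0 := fun u u' => u'.2 u u.2
  rw [Cplx.conj_map, Cplx.inner_def]
  apply Complex.ext <;> simp [e]

variable [FiniteDimensional ℝ W]

theorem mem_vacua_directSum {s : Spinor J} (h1 : s ∈ (subRep J W.subtypeₗᵢ K).vacua)
    (h2 : s ∈ (subRep J Wᗮ.subtypeₗᵢ J').vacua) :
    s ∈ (subRep J LinearIsometry.id (K.directSum W J')).vacua := by
  rw [mem_vacua_iff] at h1 h2 ⊢
  intro h
  change vectorAction J (⟨h, (K.directSum W J').toCLM h⟩ : Cplx H) s = 0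
  have e : (⟨h, (K.directSum W J').toCLM h⟩ : Cplx H)
      = ⟨W.subtypeₗᵢ (W.orthogonalProjectionOnto h),
          W.subtypeₗᵢ (K.toCLM (W.orthogonalProjectionOnto h))⟩
        + ⟨Wᗮ.subtypeₗᵢ (Wᗮ.orthogonalProjectionOnto h),
          Wᗮ.subtypeₗᵢ (J'.toCLM (Wᗮ.orthogonalProjectionOnto h))⟩ := by
    ext
    · exact (W.starProjection_add_starProjection_orthogonal h).symm
    · rfl
  rw [e, map_add, add_apply, h1, h2, add_zero]

/-- A subspace of the space of vacuum vectors for `Wᗮ` which is invariant under `Cl(W)` contains a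
vacuum vector for `H`. -/
theorem exists_mem_vacua_directSum {M : Submodule ℂ (Spinor J)} (hM : M ≠ ⊥)
    (hM' : M ≤ (subRep J Wᗮ.subtypeₗᵢ J').vacua) (K : OrthComplexStructure W)
    (hx : ∀ x, ∀ s ∈ M, vectorAction J (Cplx.map W.subtypeₗᵢ.toLinearMap x) s ∈ M) :
    ∃ s ∈ M, s ≠ 0 ∧ s ∈ (subRep J W.subtypeₗᵢ K).vacua ∧
      s ∈ (subRep J LinearIsometry.id (K.directSum W J')).vacua := by
  have := finite_Cplx W
  obtain ⟨s, hs, h0, hsv⟩ := (subRep J W.subtypeₗᵢ K).exists_mem_vacua hM fun v s hs => by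
    rw [subRep_an, Cplx.conj_map]
    exact Submodule.smul_mem _ _ (hx _ _ hs)
  exact ⟨s, hs, h0, hsv, mem_vacua_directSum W hsv (hM' hs)⟩

/-- If vacuum vectors for `Wᗮ` exist, then they form a copy of the spinor module of `W`. -/
theorem exists_linearIsometry_range_eq_vacua
    (hne : (subRep J Wᗮ.subtypeₗᵢ J').vacua ≠ ⊥) (K : OrthComplexStructure W) :
    ∃ T : Spinor K →L[ℂ] Spinor J, (subRep J W.subtypeₗᵢ K).IsIntertwiner T ∧
      ‖T (vac _)‖ = 1 ∧ (∃ p, T (vac _) ∈ Spinor.parity J p) ∧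
      LinearMap.range T.toLinearMap = (subRep J Wᗮ.subtypeₗᵢ J').vacua := by
  set R' := subRep J Wᗮ.subtypeₗᵢ J' with hR'
  obtain ⟨Ω', hΩ'v, hΩ'0, hΩ'W, hΩ'⟩ := exists_mem_vacua_directSum W hne le_rfl K fun x s hs =>
    vectorAction_map_mem_vacua W x hs
  obtain ⟨Ω, hΩ1, hΩv, hΩW, hΩ⟩ : ∃ Ω : Spinor J, ‖Ω‖ = 1 ∧ Ω ∈ R'.vacua ∧
      Ω ∈ (subRep J W.subtypeₗᵢ K).vacua ∧
      Ω ∈ (subRep J LinearIsometry.id (K.directSum W J')).vacua := by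
    refine ⟨((‖Ω'‖ : ℂ)⁻¹) • Ω', ?_, Submodule.smul_mem _ _ hΩ'v, Submodule.smul_mem _ _ hΩ'W,
      Submodule.smul_mem _ _ hΩ'⟩
    rw [norm_smul, norm_inv, Complex.norm_real, norm_norm, inv_mul_cancel₀ (norm_ne_zero_iff.2 hΩ'0)]
  have hΩ0 : Ω ≠ 0 := fun h => by rw [h, norm_zero] at hΩ1; exact zero_ne_one hΩ1
  obtain ⟨T, hT, hTΩ⟩ := CARRep.exists_isIntertwiner _ hΩW
  have hTn : ∀ s, ‖T s‖ = ‖s‖ := fun s => by rw [hT.norm_map, hTΩ, hΩ1, one_mul]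
  refine ⟨T, hT, hTΩ ▸ hΩ1, ?_, ?_⟩
  · -- the grading operator maps `Ω` to a multiple of itself
    obtain ⟨c, hc⟩ := exists_eq_smul_of_mem_vacua hΩ hΩ0 (grading_mem_vacua hΩ)
    have h2 := grading_grading Ω
    rw [hc, map_smul, hc, smul_smul] at h2
    have h3 : (c * c - 1) • Ω = 0 := by rw [sub_smul, h2, one_smul, sub_self]
    have h4 : (c - 1) * (c + 1) = 0 := by
      linear_combination (smul_eq_zero.1 h3).resolve_right hΩ0
    rw [hTΩ]
    rcases mul_eq_zero.1 h4 with h | h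
    · refine ⟨0, mem_parity_iff.2 ?_⟩
      rw [hc, sub_eq_zero.1 h, uzpow_zero, one_smul, one_smul]
    · refine ⟨1, mem_parity_iff.2 ?_⟩
      rw [hc, eq_neg_of_add_eq_zero_left h, uzpow_one, Units.neg_smul, one_smul, neg_smul, one_smul]
  · set N := LinearMap.range T.toLinearMap with hN
    have hNR : N ≤ R'.vacua := hT.range_le R'.isClosed_vacua (hTΩ ▸ hΩv) fun v s hs => by
      rw [subRep_cr]
      exact Submodule.smul_mem _ _ (vectorAction_map_mem_vacua W _ hs)
    refine le_antisymm hNR fun Ψ hΨ => ?_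
    have hNc : IsClosed (N : Set (Spinor J)) :=
      (AddMonoidHomClass.isometry_of_norm T hTn).isClosedEmbedding.isClosed_range
    have : CompleteSpace N := hNc.completeSpace_coe
    have hNx : ∀ x, ∀ s ∈ N, vectorAction J (Cplx.map W.subtypeₗᵢ.toLinearMap x) s ∈ N := by
      rintro x _ ⟨s, rfl⟩
      exact ⟨vectorAction K x s, map_vectorAction hT x s⟩
    -- the orthogonal complement of the range in the space of vacuum vectors is zero, as it would
    -- contain another vacuum vector for `H`
    have hbot : R'.vacua ⊓ Nᗮ = ⊥ := by
      by_contra hM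
      obtain ⟨s, hs, h0, -, hsv⟩ := exists_mem_vacua_directSum W hM inf_le_left K fun x s hs =>
        ⟨vectorAction_map_mem_vacua W x hs.1, fun t ht => by
          rw [← Cplx.conj_conj (Cplx.map _ x), ← inner_vectorAction_left, Cplx.conj_map]
          exact hs.2 _ (hNx _ _ ht)⟩
      obtain ⟨c, rfl⟩ := exists_eq_smul_of_mem_vacua hΩ hΩ0 hsv
      exact h0 (inner_self_eq_zero.1 (hs.2 _ (N.smul_mem c ⟨vac _, hTΩ⟩)))
    obtain ⟨m, hm, n, hn, rfl⟩ := N.exists_add_mem_mem_orthogonal Ψ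
    have hn' : n ∈ R'.vacua ⊓ Nᗮ := ⟨by simpa using sub_mem hΨ (hNR hm), hn⟩
    rw [hbot, Submodule.mem_bot] at hn'
    rwa [hn', add_zero]

theorem exists_linearIsometryEquiv_of_range_eq {A B C : Type*} [NormedAddCommGroup A]
    [Module ℂ A] [NormedAddCommGroup B] [Module ℂ B] [NormedAddCommGroup C] [Module ℂ C] (f : A →ₗᵢ[ℂ] C) (g : B →ₗᵢ[ℂ] C)
    (h : LinearMap.range f.toLinearMap = LinearMap.range g.toLinearMap) :
    ∃ Φ : A ≃ₗᵢ[ℂ] B, ∀ a, g (Φ a) = f a := by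
  let e : A ≃ₗ[ℂ] B := (LinearEquiv.ofInjective f.toLinearMap f.injective).trans
    ((LinearEquiv.ofEq _ _ h).trans (LinearEquiv.ofInjective g.toLinearMap g.injective).symm)
  have he : ∀ a, g (e a) = f a := fun a => congrArg Subtype.val
    ((LinearEquiv.ofInjective g.toLinearMap g.injective).apply_symm_apply
      (LinearEquiv.ofEq _ _ h (LinearEquiv.ofInjective f.toLinearMap f.injective a)))
  exact ⟨⟨e, fun a => by rw [← g.norm_map, he, f.norm_map]⟩, he⟩

set_option maxHeartbeats 800000 in
/-- The copies of `S_{W,K}` and of `S_W` in `S_{H,J}`, the latter embedded by the evaluation at the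
vacuum, are the same subspace: the space of vacuum vectors. -/
theorem isSpinorModule_spinorHom (hW : Even (Module.finrank ℝ W))
    (hne : (subRep J Wᗮ.subtypeₗᵢ J').vacua ≠ ⊥) :
    IsSpinorModule (W := W) (N := spinorHom W J J') (spinorHomAction W J J')
      (spinorHomParity W J J') := by
  refine ⟨nonempty_orthComplexStructure hW, fun K => ?_⟩
  have h := exists_linearIsometry_range_eq_vacua W hne K
  obtain ⟨T, hT, hT1, ⟨p, hp⟩, hr⟩ := h
  have hT0 : T (vac _) ≠ 0 := fun h => by rw [h, norm_zero] at hT1; exact zero_ne_one hT1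
  let T' : Spinor K →ₗᵢ[ℂ] Spinor J :=
    ⟨T.toLinearMap, fun s => (hT.norm_map s).trans (by rw [hT1, one_mul])⟩
  have hr' : LinearMap.range T'.toLinearMap = LinearMap.range (evalVac J W J').toLinearMap :=
    hr.trans (range_evalVac W).symm
  have h := exists_linearIsometryEquiv_of_range_eq T' (evalVac J W J') hr'
  obtain ⟨Φ, hΦ⟩ := h
  have hΦ' : ∀ s, evalVac J W J' (Φ s) = T s := hΦ
  refine ⟨Φ, fun a s => (evalVac J W J').injective ?_, p, fun k => ?_⟩
  · exact (hΦ' _).trans ((map_cliffordAction hT a s).trans (congrArg _ (hΦ' s).symm))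
  · ext S
    rw [mem_spinorHomParity_iff]
    constructor
    · rintro ⟨s, hs, rfl⟩
      exact (congrArg (· ∈ Spinor.parity J (p + k)) (hΦ' s)).mpr (map_mem_parity hT hp hs)
    · intro hS
      refine ⟨Φ.symm S, (map_mem_parity_iff hT hp hT0).1 ?_, Φ.apply_symm_apply S⟩
      exact (congrArg (· ∈ Spinor.parity J (p + k))
        ((hΦ' _).symm.trans (congrArg (evalVac J W J') (Φ.apply_symm_apply S)))).mpr hS

/-- A vacuum vector for `Wᗮ` exists if and only if the complex structures are equivalent. -/
theorem vacua_ne_bot_iff [CompleteSpace H] [TopologicalSpace.SeparableSpace H] :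
    (subRep J Wᗮ.subtypeₗᵢ J').vacua ≠ ⊥ ↔ HSEquiv J.toCLM (extendByZero W J'.toCLM) := by
  have : SecondCountableTopology H := UniformSpace.secondCountable_of_separable H
  refine ⟨hsEquiv_of_vacua_ne_bot J W J', fun h =>
    vacua_ne_bot_of_isHilbertSchmidt J Wᗮ.subtypeₗᵢ J' (fun x y => ?_) (fun x => ?_) h⟩
  · rw [sub_apply, sub_apply, inner_sub_left, inner_sub_right, J.inner_apply_left,
      inner_extendByZero_left]
    ring
  · change J.toCLM x - extendByZero W J'.toCLM x = J.toCLM x - J'.toCLM x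
    rw [extendByZero_coe]

end SpinorModuleStructure

end SpinorModules

theorem mainTheorem8 {H : Type*} [NormedAddCommGroup H] [InnerProductSpace ℝ H] [CompleteSpace H]
    [TopologicalSpace.SeparableSpace H]
    (W : Submodule ℝ H) [FiniteDimensional ℝ W] (hW : Even (Module.finrank ℝ W))
    (J : SpinorModules.OrthComplexStructure H) (J' : SpinorModules.OrthComplexStructure Wᗮ) :
    (Nontrivial (SpinorModules.spinorHom W J J') ↔
      SpinorModules.HSEquiv J.toCLM (SpinorModules.extendByZero W J'.toCLM)) ∧
    (Nontrivial (SpinorModules.ungradedHom W J J') ↔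
      SpinorModules.HSEquiv J.toCLM (SpinorModules.extendByZero W J'.toCLM)) ∧
    (SpinorModules.HSEquiv J.toCLM (SpinorModules.extendByZero W J'.toCLM) →
      SpinorModules.IsSpinorModule (W := W) (N := SpinorModules.spinorHom W J J')
        (SpinorModules.spinorHomAction W J J')
        (SpinorModules.spinorHomParity W J J')) := by
  rw [SpinorModules.nontrivial_spinorHom_iff, SpinorModules.nontrivial_ungradedHom_iff,
    SpinorModules.vacua_ne_bot_iff]
  exact ⟨Iff.rfl, Iff.rfl, fun h =>
    SpinorModules.isSpinorModule_spinorHom W hW ((SpinorModules.vacua_ne_bot_iff W).2 h)⟩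

end
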